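/- **Theorem 1.2 (tangency principles for $\gamma$-translators).** *Setting.* Let $\Gamma\subset\mathbb R^n$ be an open cone, invariant under permutations of coordinates, with $\Gamma_+:=\{\lambda\in\mathbb R^n:\lambda_i>0\ \forall i\}\subset\Gamma$ (for instance $\Gamma=\Gamma_+$). Let $\gamma:\Gamma\to(0,\infty)$ satisfy: a) $\gamma$ is smooth and symmetric; b) $\gamma$ is $\alpha$-homogeneous for some $\alpha>0$, that is, $\gamma(c\lambda)=c^\alpha\gamma(\lambda)$ for $c>0$; c) $\partial\gamma/\partial\lambda_i>0$ on $\Gamma$ for every $i$; d) $\gamma$ extends continuously to $\overline\Gamma$ with value $0$ on $\partial\Gamma$; the extension is again denoted $\gamma$. A *$\gamma$-translator* is a smooth embedded hypersurface $\Sigma\subset\mathbb R^{n+1}$, possibly with boundary, with a continuous unit normal field $\nu$ such that $\gamma(\lambda)=\langle\nu,e_{n+1}\rangle$ at every point of $\Sigma$. Here $\lambda=(\lambda_1,\dots,\lambda_n)\in\overline\Gamma$ are the principal curvatures, that is, the eigenvalues of $-d\nu$ on $T\Sigma$. Write $\partial\Sigma$ and $\operatorname{int}\Sigma=\Sigma\setminus\partial\Sigma$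 for the boundary and interior of $\Sigma$ as a manifold with boundary. Let $\Sigma_1,\Sigma_2\subset\mathbb R^{n+1}$ be connected $\gamma$-translators, $\Sigma_1$ strictly convex ($\lambda\in\Gamma_+$ everywhere on $\Sigma_1$) and $\Sigma_2$ convex ($\lambda\in\overline{\Gamma_+}$ everywhere on $\Sigma_2$). Suppose that $\Sigma_1$ lies at one side of $\Sigma_2$: near each common point $q$ there is a smooth embedded hypersurface that contains $\Sigma_2$ near $q$ and has $\Sigma_1$ in one of its two closed sides near $q$. 1. (*Interior tangency principle*) If $p\in\operatorname{int}\Sigma_1\cap\operatorname{int}\Sigma_2$ and $T_p\Sigma_1=T_p\Sigma_2$, then $\Sigma_1$ and $\Sigma_2$ coincide, in the sense made precise below. 2. (*Boundary tangency principle*) Let $\Pi$ be a hyperplane with $\partial\Sigma_1\cup\partial\Sigma_2\subset\Pi$ that both $\Sigma_1$ and $\Sigma_2$ meet transversally, and let $p\in\partial\Sigma_1\cap\partial\Sigma_2$ be such that near $p$ both hypersurfaces lie in the same closed half-space bounded by $\Pi$. If $T_p\Sigma_1=T_p\Sigma_2$ and $T_p\partial\Sigma_1=T_p\partial\Sigma_2$,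 then $\Sigma_1$ and $\Sigma_2$ coincide, in the sense made precise below. In both cases "coincide" means: $\Sigma_1\cap U=\Sigma_2\cap U$ for some neighbourhood $U$ of $p$; and if moreover $\Sigma_1$ and $\Sigma_2$ are complete (every curve $[0,1)\to\Sigma_i$ that is Lipschitz as a map into $\mathbb R^{n+1}$ converges, as the parameter tends to $1$, to a point of $\Sigma_i$) and no boundary point of one is an interior point of the other, then $\Sigma_1=\Sigma_2$. -/

import Mathlib

open scoped ContDiff Topology

/-- The Euclidean space `ℝ^(n+1)`; its last coordinate is the direction of translation. -/
abbrev Ambient (n : ℕ) : Type := EuclideanSpace ℝ (Fin (n + 1))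

/-- The open positive cone `Γ₊ ⊆ ℝⁿ`. -/
def positiveCone (n : ℕ) : Set (Fin n → ℝ) := {l | ∀ i, 0 < l i}

/-- The standing hypotheses a)-d) on the speed `γ`, which is a function on the open symmetric
cone `Γ ⊇ Γ₊`. The values of `γ` on `closure Γ` are those of its continuous extension, and the
values outside `closure Γ` play no role. -/
structure IsSpeedFunction {n : ℕ} (Γ : Set (Fin n → ℝ)) (γ : (Fin n → ℝ) → ℝ) (α : ℝ) : Prop where
  isOpen : IsOpen Γ
  cone_mem : ∀ l ∈ Γ, ∀ c : ℝ, 0 < c → c • l ∈ Γ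
  perm_mem : ∀ l ∈ Γ, ∀ σ : Equiv.Perm (Fin n), l ∘ σ ∈ Γ
  positiveCone_subset : positiveCone n ⊆ Γ
  smooth : ContDiffOn ℝ ∞ γ Γ
  pos : ∀ l ∈ Γ, 0 < γ l
  symmetric : ∀ l ∈ Γ, ∀ σ : Equiv.Perm (Fin n), γ (l ∘ σ) = γ l
  degree_pos : 0 < α
  homogeneous : ∀ l ∈ Γ, ∀ c : ℝ, 0 < c → γ (c • l) = c ^ α * γ l
  increasing : ∀ l ∈ Γ, ∀ i, 0 < fderiv ℝ γ l (Pi.single i 1)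
  continuousOn_closure : ContinuousOn γ (closure Γ)
  eq_zero_of_frontier : ∀ l ∈ frontier Γ, γ l = 0

/-- Near `q`, the set `M` is a smooth embedded hypersurface without boundary: a regular level
set. -/
def IsInteriorPoint {n : ℕ} (M : Set (Ambient n)) (q : Ambient n) : Prop :=
  ∃ (U : Set (Ambient n)) (f : Ambient n → ℝ), IsOpen U ∧ q ∈ U ∧ ContDiffOn ℝ ∞ f U ∧
    f q = 0 ∧ fderiv ℝ f q ≠ 0 ∧ M ∩ U = {x ∈ U | f x = 0}

/-- Near `q`, the set `M` is a smooth embedded hypersurface with boundary, and `q` lies on the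
boundary: `M` is one half `{f = 0, g ≥ 0}` of a regular level set, cut transversally. -/
def IsBoundaryPoint {n : ℕ} (M : Set (Ambient n)) (q : Ambient n) : Prop :=
  ∃ (U : Set (Ambient n)) (f g : Ambient n → ℝ), IsOpen U ∧ q ∈ U ∧
    ContDiffOn ℝ ∞ f U ∧ ContDiffOn ℝ ∞ g U ∧ f q = 0 ∧ g q = 0 ∧
    LinearIndependent ℝ ![fderiv ℝ f q, fderiv ℝ g q] ∧
    M ∩ U = {x ∈ U | f x = 0 ∧ 0 ≤ g x}

/-- The manifold interior of `M`. -/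
def hypInterior {n : ℕ} (M : Set (Ambient n)) : Set (Ambient n) := {q | IsInteriorPoint M q}

/-- The manifold boundary of `M`. -/
def hypBoundary {n : ℕ} (M : Set (Ambient n)) : Set (Ambient n) := {q | IsBoundaryPoint M q}

/-- A smooth embedded hypersurface of `ℝ^(n+1)`, with possibly empty boundary. -/
def IsEmbeddedHypersurface {n : ℕ} (M : Set (Ambient n)) : Prop :=
  ∀ q ∈ M, q ∈ hypInterior M ∨ q ∈ hypBoundary M

/-- The tangent space at `q`, as a linear subspace of `ℝ^(n+1)`. At a boundary point this is the
full tangent space and not only a half-space. -/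
noncomputable def tangentSpaceAt {n : ℕ} (M : Set (Ambient n)) (q : Ambient n) :
    Submodule ℝ (Ambient n) :=
  Submodule.span ℝ (tangentConeAt ℝ M q)

/-- `ν` is a continuous (hence smooth) unit normal field along `M`. -/
def IsUnitNormalField {n : ℕ} (M : Set (Ambient n)) (ν : Ambient n → Ambient n) : Prop :=
  ContinuousOn ν M ∧ ∀ q ∈ M, ‖ν q‖ = 1 ∧ ν q ∈ (tangentSpaceAt M q)ᗮ

/-- `l` lists, with multiplicity and in some order, the principal curvatures of `M` at `q` with
respect to the unit normal `ν`, that is, the eigenvalues of the Weingarten map `-dν` on the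
tangent space. With this sign a round sphere with its inward normal has positive curvatures. -/
def IsPrincipalCurvatures {n : ℕ} (M : Set (Ambient n)) (ν : Ambient n → Ambient n)
    (q : Ambient n) (l : Fin n → ℝ) : Prop :=
  ∃ (A : Ambient n →L[ℝ] Ambient n) (e : Fin n → Ambient n),
    HasFDerivWithinAt ν A M q ∧ Orthonormal ℝ e ∧ (∀ i, e i ∈ tangentSpaceAt M q) ∧
    ∀ i, A (e i) = -(l i • e i)

/-- `M`, with unit normal `ν`, is an embedded connected `γ`-translator:
`γ(λ) = ⟨ν, e_(n+1)⟩` at every point. -/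
structure IsTranslator {n : ℕ} (Γ : Set (Fin n → ℝ)) (γ : (Fin n → ℝ) → ℝ)
    (M : Set (Ambient n)) (ν : Ambient n → Ambient n) : Prop where
  hypersurface : IsEmbeddedHypersurface M
  connected : IsConnected M
  normal : IsUnitNormalField M ν
  equation : ∀ q ∈ M, ∃ l ∈ closure Γ, IsPrincipalCurvatures M ν q l ∧
    γ l = inner ℝ (ν q) (EuclideanSpace.single (Fin.last n) 1)

/-- All principal curvatures with respect to `ν` are positive. -/
def IsStrictlyConvexHyp {n : ℕ} (M : Set (Ambient n)) (ν : Ambient n → Ambient n) : Prop :=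
  ∀ q ∈ M, ∀ l, IsPrincipalCurvatures M ν q l → l ∈ positiveCone n

/-- All principal curvatures with respect to `ν` are nonnegative. -/
def IsConvexHyp {n : ℕ} (M : Set (Ambient n)) (ν : Ambient n → Ambient n) : Prop :=
  ∀ q ∈ M, ∀ l, IsPrincipalCurvatures M ν q l → l ∈ closure (positiveCone n)

/-- `M₁` lies at one side of `M₂`: near every common point `q` there is a smooth hypersurface
`{f = 0}` containing `M₂` (equal to `M₂` near `q` if `q` is interior to `M₂`) such that `M₁` lies
in one of its two closed sides. Replacing `f` by `-f` exchanges the sides. -/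
def LiesAtOneSide {n : ℕ} (M₁ M₂ : Set (Ambient n)) : Prop :=
  ∀ q ∈ M₁ ∩ M₂, ∃ (U : Set (Ambient n)) (f : Ambient n → ℝ), IsOpen U ∧ q ∈ U ∧
    ContDiffOn ℝ ∞ f U ∧ fderiv ℝ f q ≠ 0 ∧ (∀ x ∈ M₂ ∩ U, f x = 0) ∧ ∀ x ∈ M₁ ∩ U, 0 ≤ f x

/-- Completeness for the intrinsic distance: a curve of finite length in `M`, parametrized on
`[0, 1)` by a Lipschitz map, has an endpoint in `M`. Closed subsets have this property. -/
def IsCompleteHyp {n : ℕ} (M : Set (Ambient n)) : Prop :=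
  ∀ (c : ℝ → Ambient n) (K : NNReal), LipschitzOnWith K c (Set.Ico 0 1) →
    Set.MapsTo c (Set.Ico 0 1) M → ∃ q ∈ M, Filter.Tendsto c (𝓝[<] 1) (𝓝 q)

/-- No boundary point of one hypersurface is an interior point of the other. This holds when the
boundaries are empty, when they are equal, and when both hypersurfaces lie in a closed half-space,
meet its bounding hyperplane transversally, and have their boundaries in it. -/
def BoundariesCompatible {n : ℕ} (M₁ M₂ : Set (Ambient n)) : Prop :=
  Disjoint (hypBoundary M₁) (hypInterior M₂) ∧ Disjoint (hypBoundary M₂) (hypInterior M₁)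

/-- The hyperplane `{x | ⟨a, x⟩ = b}`, used with `a ≠ 0`. -/
def affineHyperplane {n : ℕ} (a : Ambient n) (b : ℝ) : Set (Ambient n) := {x | inner ℝ a x = b}

/-- `M` meets the hyperplane `{⟨a, x⟩ = b}` transversally. -/
def IsTransversalTo {n : ℕ} (M : Set (Ambient n)) (a : Ambient n) (b : ℝ) : Prop :=
  ∀ q ∈ M ∩ affineHyperplane a b, ∃ w ∈ tangentSpaceAt M q, inner ℝ a w ≠ 0

/-!
Near a common point with common tangent space, both hypersurfaces are graphs over a piece of one
hyperplane, the graph functions are ordered, and they agree to first order. Each solves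
`γ (relative eigenvalues of D²u) = ⟨ν, e_(n+1)⟩`. The right-hand side is positive near the base
point, so the curvatures there lie in `Γ`, where the equation is elliptic. Were the two functions
different, some ball free of contact points would have a contact point on its boundary, and the Hopf
barrier `exp (-k |y - z|²)`, with `z` the centre of the ball, would make the normal derivatives
differ there. Instead of linearizing the eigenvalues, which are not smooth where they collide, one
compares them by the Courant–Fischer principle at a minimum of the difference minus the barrier.

Along a Lipschitz path in one hypersurface that starts where the two coincide, completeness of the
other keeps the path inside it, and the local principles keep the coincidence going, so
connectedness gives equality.
-/
section RelativeEigenvalues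

open scoped Matrix

variable {n : ℕ} {V : Type*} [NormedAddCommGroup V] [NormedSpace ℝ V]
  {N N' H H' : V →L[ℝ] V →L[ℝ] ℝ} {e e' : Fin n → V} {l l' : Fin n → ℝ}

/-- The family `e` is orthonormal for the bilinear form `N`. -/
def IsOrthonormalFor (N : V →L[ℝ] V →L[ℝ] ℝ) (e : Fin n → V) : Prop :=
  ∀ i j, N (e i) (e j) = if i = j then 1 else 0

/-- `l` lists, with multiplicity and in some order, the eigenvalues of the bilinear form `H`
relative to the bilinear form `N`: some `N`-orthonormal family diagonalizes `H`. For the second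
and first fundamental forms of a hypersurface these are the principal curvatures. -/
def HasRelEigenvalues (N H : V →L[ℝ] V →L[ℝ] ℝ) (l : Fin n → ℝ) : Prop :=
  ∃ e : Fin n → V, IsOrthonormalFor N e ∧ ∀ i j, H (e i) (e j) = if i = j then l i else 0

theorem HasRelEigenvalues.comp_perm (h : HasRelEigenvalues N H l) (σ : Equiv.Perm (Fin n)) :
    HasRelEigenvalues N H (l ∘ σ) := by
  obtain ⟨e, he, hl⟩ := h
  exact ⟨e ∘ σ, fun i j => by simp [he _ _], fun i j => by simp [hl]⟩

/-- The matrix of the values of the bilinear form `H` on the family `e`. -/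
noncomputable def gramMatrix (H : V →L[ℝ] V →L[ℝ] ℝ) (e : Fin n → V) : Matrix (Fin n) (Fin n) ℝ :=
  Matrix.of fun i j => H (e i) (e j)

theorem apply_sum_smul_sum_smul (H : V →L[ℝ] V →L[ℝ] ℝ) (e : Fin n → V) (x y : Fin n → ℝ) :
    H (∑ i, x i • e i) (∑ j, y j • e j) = x ⬝ᵥ gramMatrix H e *ᵥ y := by
  simp only [map_sum, map_smul, sum_apply, smul_apply, smul_eq_mul, dotProduct, Matrix.mulVec,
    gramMatrix, Matrix.of_apply, Finset.mul_sum]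
  rw [Finset.sum_comm]
  exact Finset.sum_congr rfl fun i _ => Finset.sum_congr rfl fun j _ => by ring

namespace IsOrthonormalFor

theorem gramMatrix_eq_one (he : IsOrthonormalFor N e) : gramMatrix N e = 1 := by
  ext i j
  simp [gramMatrix, he i j, Matrix.one_apply]

theorem exists_relEigenvalues (he : IsOrthonormalFor N e) (hH : ∀ x y, H x y = H y x) :
    ∃ l : Fin n → ℝ, HasRelEigenvalues N H l ∧ ∑ i, l i = ∑ i, H (e i) (e i) := by
  have hA : (gramMatrix H e).IsHermitian := by
    ext i j
    simp [gramMatrix, hH (e i) (e j)]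
  let b := hA.eigenvectorBasis
  have hb : ∀ i j, b i ⬝ᵥ b j = if i = j then 1 else 0 := fun i j => by
    rw [← orthonormal_iff_ite.mp b.orthonormal i j, PiLp.inner_apply, dotProduct]
    exact Finset.sum_congr rfl fun k _ => mul_comm _ _
  refine ⟨hA.eigenvalues, ⟨fun i => ∑ k, b i k • e k, fun i j => ?_, fun i j => ?_⟩, ?_⟩
  · rw [apply_sum_smul_sum_smul, he.gramMatrix_eq_one, Matrix.one_mulVec, hb]
  · rw [apply_sum_smul_sum_smul, hA.mulVec_eigenvectorBasis, dotProduct_smul, hb]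
    split_ifs with hij <;> simp [hij]
  · simpa [Matrix.trace, gramMatrix] using hA.trace_eq_sum_eigenvalues.symm

theorem exists_monotone_relEigenvalues (he : IsOrthonormalFor N e)
    (hH : ∀ x y, H x y = H y x) :
    ∃ l : Fin n → ℝ, Monotone l ∧ HasRelEigenvalues N H l ∧
      ∑ i, l i = ∑ i, H (e i) (e i) := by
  obtain ⟨l, hl, hsum⟩ := he.exists_relEigenvalues hH
  exact ⟨l ∘ Tuple.sort l, Tuple.monotone_sort l, hl.comp_perm _,
    (Equiv.sum_comp (Tuple.sort l) l).trans hsum⟩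

theorem linearIndependent (he : IsOrthonormalFor N e) : LinearIndependent ℝ e := by
  rw [Fintype.linearIndependent_iff]
  intro g hg j
  simpa [he _ j] using congrArg (fun y => N y (e j)) hg

variable [FiniteDimensional ℝ V]

theorem sum_apply_smul (he : IsOrthonormalFor N e) (hV : Module.finrank ℝ V = n) (y : V) :
    ∑ i, N y (e i) • e i = y := by
  have hspan := he.linearIndependent.span_eq_top_of_card_eq_finrank' (by simp [hV])
  obtain ⟨c, rfl⟩ := (Submodule.mem_span_range_iff_exists_fun ℝ).mp
    (hspan ▸ Submodule.mem_top : y ∈ Submodule.span ℝ (Set.range e))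
  refine Finset.sum_congr rfl fun j _ => ?_
  simp [he _ j]

theorem apply_self_eq_sum_mul_sq (he : IsOrthonormalFor N e) (hV : Module.finrank ℝ V = n)
    (hl : ∀ i j, H (e i) (e j) = if i = j then l i else 0) (y : V) :
    H y y = ∑ i, l i * N y (e i) ^ 2 := by
  conv_lhs => rw [← he.sum_apply_smul hV y]
  simp only [map_sum, map_smul, sum_apply, smul_apply, smul_eq_mul, hl, mul_ite, mul_zero,
    Finset.sum_ite_eq', Finset.mem_univ, if_true]
  exact Finset.sum_congr rfl fun i _ => by ring

theorem apply_self_eq_sum_sq (he : IsOrthonormalFor N e) (hV : Module.finrank ℝ V = n) (y : V) :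
    N y y = ∑ i, N y (e i) ^ 2 := by
  simpa using he.apply_self_eq_sum_mul_sq hV he y

theorem apply_self_pos (he : IsOrthonormalFor N e) (hV : Module.finrank ℝ V = n) {y : V}
    (hy : y ≠ 0) : 0 < N y y := by
  have hsq : ∀ i ∈ Finset.univ, 0 ≤ N y (e i) ^ 2 := fun i _ => sq_nonneg _
  rw [he.apply_self_eq_sum_sq hV y]
  refine (Finset.sum_nonneg hsq).lt_of_ne' fun h => hy ?_
  rw [← he.sum_apply_smul hV y]
  refine Finset.sum_eq_zero fun i hi => ?_
  rw [pow_eq_zero_iff two_ne_zero |>.mp ((Finset.sum_eq_zero_iff_of_nonneg hsq).mp h i hi),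
    zero_smul]

theorem mul_apply_self_le (he : IsOrthonormalFor N e) (hV : Module.finrank ℝ V = n)
    (hl : ∀ i j, H (e i) (e j) = if i = j then l i else 0) (hmono : Monotone l) {k : Fin n}
    {y : V} (hy : ∀ i < k, N y (e i) = 0) : l k * N y y ≤ H y y := by
  rw [he.apply_self_eq_sum_sq hV, he.apply_self_eq_sum_mul_sq hV hl, Finset.mul_sum]
  refine Finset.sum_le_sum fun i _ => ?_
  rcases lt_or_ge i k with hi | hi
  · simp [hy i hi]
  · exact mul_le_mul_of_nonneg_right (hmono hi) (sq_nonneg _)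

theorem apply_self_le_mul (he : IsOrthonormalFor N e) (hV : Module.finrank ℝ V = n)
    (hl : ∀ i j, H (e i) (e j) = if i = j then l i else 0) (hmono : Monotone l) {k : Fin n}
    {y : V} (hy : ∀ i, k < i → N y (e i) = 0) : H y y ≤ l k * N y y := by
  rw [he.apply_self_eq_sum_sq hV, he.apply_self_eq_sum_mul_sq hV hl, Finset.mul_sum]
  refine Finset.sum_le_sum fun i _ => ?_
  rcases le_or_gt i k with hi | hi
  · exact mul_le_mul_of_nonneg_right (hmono hi) (sq_nonneg _)
  · simp [hy i hi]

end IsOrthonormalFor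

theorem exists_ne_zero_forall_lt_forall_gt_eq_zero [FiniteDimensional ℝ V]
    (hV : Module.finrank ℝ V = n) (φ ψ : Fin n → V →ₗ[ℝ] ℝ) (k : Fin n) :
    ∃ y ≠ 0, (∀ i < k, φ i y = 0) ∧ ∀ i, k < i → ψ i y = 0 := by
  let T : V →ₗ[ℝ] (Fin n → ℝ) := LinearMap.pi fun i =>
    if i < k then φ i else if k < i then ψ i else 0
  have hT : ¬ Function.Injective T := fun hinj => by
    obtain ⟨y, hy⟩ := (LinearMap.injective_iff_surjective_of_finrank_eq_finrank
      (by simp [hV])).mp hinj (Pi.single k 1)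
    simpa [T] using congrFun hy k
  obtain ⟨y, hy, hy0⟩ : ∃ y, T y = 0 ∧ y ≠ 0 := by
    simpa [injective_iff_map_eq_zero] using hT
  exact ⟨y, hy0, fun i hi => by simpa [T, hi] using congrFun hy i,
    fun i hi => by simpa [T, hi, hi.not_gt] using congrFun hy i⟩

/-- The Courant–Fischer comparison: the `k`-th eigenspaces from above and from below meet in a
common test vector. -/
theorem HasRelEigenvalues.le_add_of_rayleigh_le [FiniteDimensional ℝ V]
    (hV : Module.finrank ℝ V = n) (h : HasRelEigenvalues N H l) (h' : HasRelEigenvalues N' H' l')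
    (hl : Monotone l) (hl' : Monotone l') {c : ℝ}
    (hle : ∀ y, H y y * N' y y ≤ (H' y y + c * N' y y) * N y y) (k : Fin n) :
    l k ≤ l' k + c := by
  obtain ⟨e, he, hd⟩ := h
  obtain ⟨e', he', hd'⟩ := h'
  obtain ⟨y, hy, hlow, hhigh⟩ := exists_ne_zero_forall_lt_forall_gt_eq_zero hV
    (fun i => (N.flip (e i) : V →ₗ[ℝ] ℝ)) (fun i => (N'.flip (e' i) : V →ₗ[ℝ] ℝ)) k
  have hN := he.apply_self_pos hV hy
  have hN' := he'.apply_self_pos hV hy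
  have hH : l k * N y y ≤ H y y := he.mul_apply_self_le hV hd hl hlow
  have hH' : H' y y ≤ l' k * N' y y := he'.apply_self_le_mul hV hd' hl' hhigh
  refine le_of_mul_le_mul_right ?_ (mul_pos hN hN')
  calc l k * (N y y * N' y y) = l k * N y y * N' y y := by ring
    _ ≤ H y y * N' y y := by gcongr
    _ ≤ (H' y y + c * N' y y) * N y y := hle y
    _ ≤ (l' k * N' y y + c * N' y y) * N y y := by gcongr
    _ = (l' k + c) * (N y y * N' y y) := by ring

end RelativeEigenvalues

section EllipticSpeed

variable {n : ℕ} {Γ : Set (Fin n → ℝ)} {γ : (Fin n → ℝ) → ℝ}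

/-- The properties of a speed that make `γ(λ) = ⟨ν, e_(n+1)⟩` an elliptic equation with convex
solutions inside `Γ`; in contrast to `IsSpeedFunction`, neither homogeneity nor more than one
derivative is asked for. -/
structure IsEllipticSpeed (Γ : Set (Fin n → ℝ)) (γ : (Fin n → ℝ) → ℝ) : Prop where
  isOpen : IsOpen Γ
  perm_mem : ∀ l ∈ Γ, ∀ σ : Equiv.Perm (Fin n), l ∘ σ ∈ Γ
  positiveCone_subset : positiveCone n ⊆ Γ
  contDiffOn : ContDiffOn ℝ 1 γ Γ
  pos : ∀ l ∈ Γ, 0 < γ l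
  symmetric : ∀ l ∈ Γ, ∀ σ : Equiv.Perm (Fin n), γ (l ∘ σ) = γ l
  increasing : ∀ l ∈ Γ, ∀ i, 0 < fderiv ℝ γ l (Pi.single i 1)
  eq_zero_of_frontier : ∀ l ∈ frontier Γ, γ l = 0

theorem IsSpeedFunction.isEllipticSpeed {α : ℝ} (hγ : IsSpeedFunction Γ γ α) :
    IsEllipticSpeed Γ γ where
  isOpen := hγ.isOpen
  perm_mem := hγ.perm_mem
  positiveCone_subset := hγ.positiveCone_subset
  contDiffOn := hγ.smooth.of_le (by norm_cast)
  pos := hγ.pos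
  symmetric := hγ.symmetric
  increasing := hγ.increasing
  eq_zero_of_frontier := hγ.eq_zero_of_frontier

theorem closure_positiveCone (n : ℕ) : closure (positiveCone n) = {l | ∀ i, 0 ≤ l i} := by
  have h : positiveCone n = Set.pi Set.univ fun _ => Set.Ioi (0 : ℝ) := by
    ext l; simp [positiveCone]
  rw [h, closure_pi_set]
  ext l
  simp [Pi.le_def]

/-- The admissible lists of principal curvatures of a convex `γ`-translator: on the rest of
`closure (positiveCone n)` the speed vanishes. -/
def convexCone (Γ : Set (Fin n → ℝ)) : Set (Fin n → ℝ) := Γ ∩ {l | ∀ i, 0 ≤ l i}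

theorem eventually_segment_subset_of_isOpen {E : Type*} [AddCommGroup E] [Module ℝ E]
    [TopologicalSpace E] [ContinuousAdd E] [ContinuousSMul ℝ E] {s : Set E} (hs : IsOpen s)
    {a b : E} (h : segment ℝ a b ⊆ s) : ∀ᶠ p in 𝓝 (a, b), segment ℝ p.1 p.2 ⊆ s := by
  have hcont : Continuous fun q : (E × E) × ℝ => (1 - q.2) • q.1.1 + q.2 • q.1.2 := by fun_prop
  simp only [segment_eq_image, Set.image_subset_iff] at h ⊢
  exact isCompact_Icc.eventually_forall_of_forall_eventually
    fun t ht => hcont.continuousAt.eventually (hs.mem_nhds (h ht))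

namespace IsEllipticSpeed

theorem nonneg (hγ : IsEllipticSpeed Γ γ) {l : Fin n → ℝ} (hl : l ∈ closure Γ) : 0 ≤ γ l := by
  by_cases h : l ∈ Γ
  · exact (hγ.pos l h).le
  · exact (hγ.eq_zero_of_frontier l ⟨hl, fun h' => h (interior_subset h')⟩).ge

theorem mem_of_pos (hγ : IsEllipticSpeed Γ γ) {l : Fin n → ℝ} (hl : l ∈ closure Γ)
    (hpos : 0 < γ l) : l ∈ Γ := by
  by_contra h
  exact hpos.ne' (hγ.eq_zero_of_frontier l ⟨hl, fun h' => h (interior_subset h')⟩)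

theorem comp_perm_mem_convexCone (hγ : IsEllipticSpeed Γ γ) {l : Fin n → ℝ}
    (hl : l ∈ convexCone Γ) (σ : Equiv.Perm (Fin n)) : l ∘ σ ∈ convexCone Γ :=
  ⟨hγ.perm_mem l hl.1 σ, fun i => hl.2 (σ i)⟩

theorem segment_subset (hγ : IsEllipticSpeed Γ γ) {b a : Fin n → ℝ} (hb : b ∈ convexCone Γ)
    (ha : a ∈ convexCone Γ) (h : b ∈ positiveCone n ∨ a ∈ positiveCone n) :
    segment ℝ b a ⊆ Γ := by
  rw [← insert_endpoints_openSegment]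
  refine Set.insert_subset hb.1 (Set.insert_subset ha.1 (subset_trans ?_ hγ.positiveCone_subset))
  rintro _ ⟨s, t, hs, ht, -, rfl⟩ i
  have hbi := hb.2 i
  have hai := ha.2 i
  simp only [Pi.add_apply, Pi.smul_apply, smul_eq_mul]
  rcases h with h | h <;> have := h i <;> positivity

theorem contDiffAt (hγ : IsEllipticSpeed Γ γ) {l : Fin n → ℝ} (hl : l ∈ Γ) :
    ContDiffAt ℝ 1 γ l :=
  (hγ.contDiffOn l hl).contDiffAt (hγ.isOpen.mem_nhds hl)

theorem mean_value (hγ : IsEllipticSpeed Γ γ) {x y : Fin n → ℝ} (h : segment ℝ x y ⊆ Γ) :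
    ∃ z ∈ segment ℝ x y, γ y - γ x = ∑ i, fderiv ℝ γ z (Pi.single i 1) * (y i - x i) := by
  obtain ⟨z, hz, he⟩ := domain_mvt (f := γ) (f' := fun z => fderiv ℝ γ z)
    (fun z hz => ((hγ.contDiffAt (h hz)).differentiableAt one_ne_zero).hasFDerivAt
      |>.hasFDerivWithinAt)
    (convex_segment x y) (left_mem_segment ℝ x y) (right_mem_segment ℝ x y)
  refine ⟨z, hz, he.trans ?_⟩
  rw [← (fderiv ℝ γ z).coe_coe, LinearMap.pi_apply_eq_sum_univ]
  refine Finset.sum_congr rfl fun i _ => ?_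
  have hi : (fun j => if i = j then (1 : ℝ) else 0) = Pi.single i 1 := by
    ext j
    simp [Pi.single_apply, eq_comm]
  simp [hi, mul_comm]

theorem eventually_le (hγ : IsEllipticSpeed Γ γ) {b a : Fin n → ℝ} (h : segment ℝ b a ⊆ Γ) :
    ∀ᶠ p in 𝓝 (b, a), p.1 ≤ p.2 → γ p.1 ≤ γ p.2 := by
  filter_upwards [eventually_segment_subset_of_isOpen hγ.isOpen h] with p hp hle
  obtain ⟨z, hz, heq⟩ := hγ.mean_value hp
  rw [← sub_nonneg, heq]
  exact Finset.sum_nonneg fun i _ =>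
    mul_nonneg (hγ.increasing z (hp hz) i).le (sub_nonneg.mpr (hle i))

theorem exists_eventually_gradient_mem_Ioo (hγ : IsEllipticSpeed Γ γ) {b : Fin n → ℝ}
    (hb : b ∈ Γ) : ∃ c > 0, ∃ C > 0, ∀ᶠ z in 𝓝 b, z ∈ Γ ∧
      ∀ i, fderiv ℝ γ z (Pi.single i 1) ∈ Set.Ioo c C := by
  obtain ⟨c, hc0, hc⟩ : ∃ c > 0, ∀ i, c < fderiv ℝ γ b (Pi.single i 1) :=
    ((eventually_mem_nhdsWithin (s := Set.Ioi (0 : ℝ))).and (Filter.eventually_all.mpr fun i =>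
      (eventually_lt_nhds (hγ.increasing b hb i)).filter_mono nhdsWithin_le_nhds)).exists
  obtain ⟨C, hC0, hC⟩ : ∃ C > 0, ∀ i, fderiv ℝ γ b (Pi.single i 1) < C :=
    ((Filter.eventually_gt_atTop 0).and (Filter.eventually_all.mpr fun i =>
      Filter.eventually_gt_atTop _)).exists
  refine ⟨c, hc0, C, hC0, (hγ.isOpen.eventually_mem hb).and (Filter.eventually_all.mpr fun i => ?_)⟩
  have hcont : ContinuousAt (fun z => fderiv ℝ γ z (Pi.single i 1)) b :=
    ((hγ.contDiffAt hb).fderiv_right (m := 0) (by simp)).continuousAt.clm_apply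
      continuousAt_const
  exact hcont.eventually (Ioo_mem_nhds (hc i) (hC i))

theorem exists_eventually_sub_mem_Icc (hγ : IsEllipticSpeed Γ γ) {b : Fin n → ℝ} (hb : b ∈ Γ) :
    ∃ c > 0, ∃ C > 0, ∀ᶠ p in 𝓝 (b, b), p.1 ≤ p.2 →
      γ p.2 - γ p.1 ∈ Set.Icc (c * ∑ i, (p.2 i - p.1 i)) (C * ∑ i, (p.2 i - p.1 i)) := by
  obtain ⟨c, hc, C, hC, hgrad⟩ := hγ.exists_eventually_gradient_mem_Ioo hb
  obtain ⟨s, hs, hso, hbs⟩ := mem_nhds_iff.mp hgrad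
  have hseg : segment ℝ b b ⊆ s := by simpa using hbs
  refine ⟨c, hc, C, hC, ?_⟩
  filter_upwards [eventually_segment_subset_of_isOpen hso hseg] with p hp hle
  obtain ⟨z, hz, heq⟩ := hγ.mean_value fun w hw => (hs (hp hw)).1
  have hz' := (hs (hp hz)).2
  rw [heq, Finset.mul_sum, Finset.mul_sum]
  exact ⟨Finset.sum_le_sum fun i _ => mul_le_mul_of_nonneg_right (hz' i).1.le
      (sub_nonneg.mpr (hle i)),
    Finset.sum_le_sum fun i _ => mul_le_mul_of_nonneg_right (hz' i).2.le
      (sub_nonneg.mpr (hle i))⟩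

theorem exists_eventually_le_sub (hγ : IsEllipticSpeed Γ γ) {b a : Fin n → ℝ}
    (h : segment ℝ b a ⊆ Γ) :
    ∃ c > 0, ∃ C > 0, ∀ᶠ p : ((Fin n → ℝ) × (Fin n → ℝ)) × ((Fin n → ℝ) × ℝ) in
      𝓝 ((b, b), (a, 0)), 0 ≤ p.2.2 → (∀ i, p.1.1 i - p.2.2 ≤ p.1.2 i) → p.1.2 ≤ p.2.1 →
        c * ∑ i, (p.1.2 i - p.1.1 i) - C * (n * p.2.2) ≤ γ p.2.1 - γ p.1.1 := by
  obtain ⟨c, hc, C, hC, hev⟩ := hγ.exists_eventually_sub_mem_Icc (h (left_mem_segment ℝ b a))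
  refine ⟨c, hc, C, hC, ?_⟩
  let shift : ((Fin n → ℝ) × (Fin n → ℝ)) × ((Fin n → ℝ) × ℝ) → Fin n → ℝ :=
    fun p i => p.1.1 i - p.2.2
  have hshift : Continuous shift := by fun_prop
  have hshift₀ : shift ((b, b), (a, 0)) = b := by ext; simp [shift]
  have hdown : Filter.Tendsto (fun p => (shift p, p.1.1)) (𝓝 ((b, b), (a, 0))) (𝓝 (b, b)) :=
    (hshift.prodMk (by fun_prop)).tendsto' _ _ (by simp [hshift₀])
  have hup : Filter.Tendsto (fun p => (shift p, p.1.2)) (𝓝 ((b, b), (a, 0))) (𝓝 (b, b)) :=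
    (hshift.prodMk (by fun_prop)).tendsto' _ _ (by simp [hshift₀])
  have hmono : Filter.Tendsto (fun p : ((Fin n → ℝ) × (Fin n → ℝ)) × ((Fin n → ℝ) × ℝ) =>
      (p.1.2, p.2.1)) (𝓝 ((b, b), (a, 0))) (𝓝 (b, a)) :=
    (by fun_prop : Continuous _).tendsto' _ _ rfl
  filter_upwards [hdown.eventually hev, hup.eventually hev, hmono.eventually (hγ.eventually_le h)]
    with p hlow hhigh hle hs hshift_le hp
  have hlow := (hlow fun i => sub_le_self _ hs).2
  have hhigh := (hhigh hshift_le).1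
  simp only [shift, sub_sub_cancel, Finset.sum_const, Finset.card_univ, Fintype.card_fin,
    nsmul_eq_mul] at hlow
  have hsum : ∑ i, (p.1.2 i - p.1.1 i) ≤ ∑ i, (p.1.2 i - shift p i) :=
    Finset.sum_le_sum fun i _ => sub_le_sub_left (sub_le_self _ hs) _
  linarith [mul_le_mul_of_nonneg_left hsum hc.le, hle hp]

end IsEllipticSpeed

end EllipticSpeed

section Comparison

set_option maxSynthPendingDepth 3

variable {n : ℕ} {V : Type*} [NormedAddCommGroup V] [InnerProductSpace ℝ V]

/-- The inner product as a bounded real bilinear form; unlike `innerSL ℝ` it is not typed as a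
sesquilinear map. -/
noncomputable def realInner (V : Type*) [NormedAddCommGroup V] [InnerProductSpace ℝ V] :
    V →L[ℝ] V →L[ℝ] ℝ := innerSL ℝ

@[simp] theorem realInner_apply (x y : V) : realInner V x y = inner ℝ x y := rfl

@[simp] theorem norm_realInner_apply (x : V) : ‖realInner V x‖ = ‖x‖ :=
  innerSL_apply_norm ℝ x

/-- The Hessian, up to a positive factor, of the Gaussian barrier at displacement `ξ` from its
centre. -/
noncomputable def barrierForm (k : ℝ) (ξ : V) : V →L[ℝ] V →L[ℝ] ℝ :=
  (2 * k) • (realInner V ξ).smulRight (realInner V ξ) - realInner V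

theorem barrierForm_apply (k : ℝ) (ξ x y : V) :
    barrierForm k ξ x y = 2 * k * (inner ℝ ξ x * inner ℝ ξ y) - inner ℝ x y := by
  simp [barrierForm]

@[fun_prop]
theorem continuous_barrierForm (k : ℝ) : Continuous (barrierForm k : V → V →L[ℝ] V →L[ℝ] ℝ) := by
  have hsmulRight : Continuous fun ξ : V => (realInner V ξ).smulRight (realInner V ξ) :=
    (ContinuousLinearMap.smulRightL ℝ V (V →L[ℝ] ℝ)).continuous₂.comp
      ((realInner V).continuous.prodMk (realInner V).continuous)
  exact (hsmulRight.const_smul (2 * k)).sub continuous_const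

theorem abs_apply_self_le (H : V →L[ℝ] V →L[ℝ] ℝ) (y : V) : |H y y| ≤ ‖H‖ * ‖y‖ ^ 2 :=
  (H.le_opNorm₂ y y).trans_eq (by ring)

variable {N N' H H' : V →L[ℝ] V →L[ℝ] ℝ} {e : Fin n → V} {l l' : Fin n → ℝ}

theorem abs_mul_sub_mul_le (hN : ∀ y, ‖y‖ ^ 2 ≤ N y y) (hN' : ∀ y, ‖y‖ ^ 2 ≤ N' y y) (y : V) :
    |H y y * N' y y - H' y y * N y y| ≤
      (‖H - H'‖ + ‖H'‖ * ‖N - N'‖) * (N y y * N' y y) := by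
  have hsub : |H y y - H' y y| ≤ ‖H - H'‖ * ‖y‖ ^ 2 := abs_apply_self_le (H - H') y
  have hsub' : |N y y - N' y y| ≤ ‖N - N'‖ * ‖y‖ ^ 2 := abs_apply_self_le (N - N') y
  have hpos : 0 ≤ N y y := (sq_nonneg _).trans (hN y)
  have hpos' : 0 ≤ N' y y := (sq_nonneg _).trans (hN' y)
  calc |H y y * N' y y - H' y y * N y y|
      = |(H y y - H' y y) * N' y y - H' y y * (N y y - N' y y)| := by ring_nf
    _ ≤ |H y y - H' y y| * N' y y + |H' y y| * |N y y - N' y y| := by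
      refine (abs_sub _ _).trans_eq ?_
      rw [abs_mul, abs_mul, abs_of_nonneg hpos']
    _ ≤ (‖H - H'‖ * ‖y‖ ^ 2) * N' y y + (‖H'‖ * ‖y‖ ^ 2) * (‖N - N'‖ * ‖y‖ ^ 2) := by
      gcongr
      exact abs_apply_self_le H' y
    _ ≤ (‖H - H'‖ * N y y) * N' y y + (‖H'‖ * N y y) * (‖N - N'‖ * N' y y) := by
      gcongr
      exacts [hN y, hN y, hN' y]
    _ = _ := by ring

variable [FiniteDimensional ℝ V]

theorem HasRelEigenvalues.abs_sub_le (hV : Module.finrank ℝ V = n) (h : HasRelEigenvalues N H l)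
    (h' : HasRelEigenvalues N' H' l') (hl : Monotone l) (hl' : Monotone l')
    (hN : ∀ y, ‖y‖ ^ 2 ≤ N y y) (hN' : ∀ y, ‖y‖ ^ 2 ≤ N' y y) (k : Fin n) :
    |l k - l' k| ≤ ‖H - H'‖ + ‖H'‖ * ‖N - N'‖ := by
  have key := fun y => abs_le.mp (abs_mul_sub_mul_le (H := H) (H' := H') hN hN' y)
  have hle := h.le_add_of_rayleigh_le hV h' hl hl' (c := ‖H - H'‖ + ‖H'‖ * ‖N - N'‖)
    (fun y => by linarith [(key y).2]) k
  have hge := h'.le_add_of_rayleigh_le hV h hl' hl (c := ‖H - H'‖ + ‖H'‖ * ‖N - N'‖)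
    (fun y => by linarith [(key y).1]) k
  exact abs_sub_le_iff.mpr ⟨by linarith, by linarith⟩

theorem HasRelEigenvalues.le_of_apply_self_le (hV : Module.finrank ℝ V = n)
    (h : HasRelEigenvalues N H l) (h' : HasRelEigenvalues N H' l') (hl : Monotone l)
    (hl' : Monotone l') (hN : ∀ y, ‖y‖ ^ 2 ≤ N y y) {c : ℝ}
    (hle : ∀ y, H y y ≤ H' y y + c * N y y) (k : Fin n) : l k ≤ l' k + c :=
  h.le_add_of_rayleigh_le hV h' hl hl'
    (fun y => mul_le_mul_of_nonneg_right (hle y) ((sq_nonneg _).trans (hN y))) k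

theorem HasRelEigenvalues.eventually_forall_mem (hV : Module.finrank ℝ V = n)
    (h : HasRelEigenvalues N H l) (hl : Monotone l) (hN : ∀ y, ‖y‖ ^ 2 ≤ N y y)
    {s : Set (Fin n → ℝ)} (hs : s ∈ 𝓝 l) :
    ∀ᶠ p : (V →L[ℝ] V →L[ℝ] ℝ) × (V →L[ℝ] V →L[ℝ] ℝ) in 𝓝 (N, H),
      (∀ y, ‖y‖ ^ 2 ≤ p.1 y y) → ∀ l', Monotone l' → HasRelEigenvalues p.1 p.2 l' → l' ∈ s := by
  obtain ⟨δ, hδ, hball⟩ := Metric.mem_nhds_iff.mp hs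
  have hcont : Continuous fun p : (V →L[ℝ] V →L[ℝ] ℝ) × (V →L[ℝ] V →L[ℝ] ℝ) =>
      ‖p.2 - H‖ + ‖H‖ * ‖p.1 - N‖ := by fun_prop
  filter_upwards [hcont.continuousAt.eventually (gt_mem_nhds (by simpa using hδ))]
    with p hp hpN l' hl' h'
  exact hball ((dist_pi_lt_iff hδ).mpr fun i =>
    (h'.abs_sub_le hV h hl' hl hpN hN i).trans_lt hp)

namespace IsOrthonormalFor

theorem norm_sq_le_sum_inner (he : IsOrthonormalFor N e) (hV : Module.finrank ℝ V = n) {C : ℝ}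
    (hC : ‖N‖ ≤ C) (ξ : V) : ‖ξ‖ ^ 2 ≤ C * ∑ i, inner ℝ ξ (e i) ^ 2 := by
  rcases eq_or_ne ξ 0 with rfl | hξ
  · simp
  have hpos : 0 < ‖ξ‖ ^ 2 := by positivity
  have hexpand : ‖ξ‖ ^ 2 = ∑ i, N ξ (e i) * inner ℝ ξ (e i) := by
    rw [← real_inner_self_eq_norm_sq]
    conv_lhs => enter [3]; rw [← he.sum_apply_smul hV ξ]
    rw [inner_sum]
    exact Finset.sum_congr rfl fun i _ => inner_smul_right _ _ _
  have hself : N ξ ξ ≤ C * ‖ξ‖ ^ 2 :=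
    ((le_abs_self _).trans (abs_apply_self_le N ξ)).trans (mul_le_mul_of_nonneg_right hC hpos.le)
  refine le_of_mul_le_mul_right ?_ hpos
  calc ‖ξ‖ ^ 2 * ‖ξ‖ ^ 2 = (∑ i, N ξ (e i) * inner ℝ ξ (e i)) ^ 2 := by rw [← hexpand]; ring
    _ ≤ (∑ i, N ξ (e i) ^ 2) * ∑ i, inner ℝ ξ (e i) ^ 2 :=
      Finset.sum_mul_sq_le_sq_mul_sq Finset.univ _ _
    _ = N ξ ξ * ∑ i, inner ℝ ξ (e i) ^ 2 := by rw [he.apply_self_eq_sum_sq hV]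
    _ ≤ C * ‖ξ‖ ^ 2 * ∑ i, inner ℝ ξ (e i) ^ 2 := by gcongr
    _ = C * (∑ i, inner ℝ ξ (e i) ^ 2) * ‖ξ‖ ^ 2 := by ring

theorem le_sum_barrierForm (he : IsOrthonormalFor N e) (hV : Module.finrank ℝ V = n)
    (hN : ∀ y, ‖y‖ ^ 2 ≤ N y y) {M k : ℝ} (hM : 0 < M) (hNM : ‖N‖ ≤ M) (hk : 0 ≤ k) (ξ : V) :
    2 * k * (‖ξ‖ ^ 2 / M) - n ≤ ∑ i, barrierForm k ξ (e i) (e i) := by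
  have hnorm : ∑ i, ‖e i‖ ^ 2 ≤ n := by
    have : ∀ i ∈ Finset.univ, ‖e i‖ ^ 2 ≤ 1 := fun i _ => by simpa [he i i] using hN (e i)
    simpa using Finset.sum_le_sum this
  have hinner : ‖ξ‖ ^ 2 / M ≤ ∑ i, inner ℝ ξ (e i) ^ 2 := by
    rw [div_le_iff₀' hM]
    exact he.norm_sq_le_sum_inner hV hNM ξ
  simp only [barrierForm_apply, Finset.sum_sub_distrib, ← Finset.mul_sum, ← sq,
    real_inner_self_eq_norm_sq]
  gcongr

end IsOrthonormalFor

/-- A barrier of size `κ` with large `k` raises the trace by more than an order `κ` perturbation of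
the metric can lower it, whereas no single eigenvalue drops by more than order `κ`. -/
theorem HasRelEigenvalues.exists_add_barrierForm (hV : Module.finrank ℝ V = n)
    (h : HasRelEigenvalues N H l) (hl : Monotone l) (he : IsOrthonormalFor N' e)
    (hN : ∀ y, ‖y‖ ^ 2 ≤ N y y) (hN' : ∀ y, ‖y‖ ^ 2 ≤ N' y y) (hH : ∀ x y, H x y = H y x)
    {M L k κ : ℝ} (hM : 0 < M) (hNM : ‖N'‖ ≤ M) (hk : 0 ≤ k) (hκ : 0 ≤ κ)
    (hNN' : ‖N - N'‖ ≤ κ * L) (ξ : V) :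
    ∃ μ : Fin n → ℝ, Monotone μ ∧ HasRelEigenvalues N' (H + κ • barrierForm k ξ) μ ∧
      (∀ i, l i - κ * (‖H‖ * L + 1) ≤ μ i) ∧
      κ * (2 * k * (‖ξ‖ ^ 2 / M) - n * (‖H‖ * L + 1)) ≤ ∑ i, (μ i - l i) := by
  have hS : ∀ x y, (H + κ • barrierForm k ξ) x y = (H + κ • barrierForm k ξ) y x := fun x y => by
    simp only [add_apply, smul_apply, barrierForm_apply, hH x y, real_inner_comm x y,
      mul_comm (inner ℝ ξ x)]
  obtain ⟨β, hβm, hβ, hβsum⟩ := he.exists_monotone_relEigenvalues hH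
  obtain ⟨μ, hμm, hμ, hμsum⟩ := he.exists_monotone_relEigenvalues hS
  have hlβ : ∀ i, l i - β i ≤ κ * (‖H‖ * L) := fun i => by
    have := (le_abs_self _).trans (h.abs_sub_le hV hβ hl hβm hN hN' i)
    rw [sub_self, norm_zero, zero_add] at this
    linarith [mul_le_mul_of_nonneg_left hNN' (norm_nonneg H)]
  have hβμ : ∀ i, β i ≤ μ i + κ := hβ.le_of_apply_self_le hV hμ hβm hμm hN' fun y => by
    have hbar : 0 ≤ κ * (2 * k * inner ℝ ξ y ^ 2) := by positivity
    have hself := mul_le_mul_of_nonneg_left (hN' y) hκ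
    simp only [add_apply, smul_apply, barrierForm_apply, smul_eq_mul, ← sq,
      real_inner_self_eq_norm_sq]
    linarith
  refine ⟨μ, hμm, hμ, fun i => by linarith [hlβ i, hβμ i], ?_⟩
  have hsum : ∑ i, (μ i - l i) =
      κ * ∑ i, barrierForm k ξ (e i) (e i) - ∑ i, (l i - β i) := by
    simp only [Finset.sum_sub_distrib, hμsum, hβsum, add_apply, smul_apply, smul_eq_mul,
      Finset.sum_add_distrib, ← Finset.mul_sum]
    ring
  have hlow : ∑ i, (l i - β i) ≤ n * (κ * (‖H‖ * L)) := by
    simpa using Finset.sum_le_sum fun i (_ : i ∈ Finset.univ) => hlβ i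
  rw [hsum]
  linarith [mul_le_mul_of_nonneg_left (he.le_sum_barrierForm hV hN' hM hNM hk ξ) hκ]

theorem IsEllipticSpeed.exists_eventually_forall_relEigenvalues_le {Γ : Set (Fin n → ℝ)}
    {γ : (Fin n → ℝ) → ℝ} (hγ : IsEllipticSpeed Γ γ) (hV : Module.finrank ℝ V = n)
    (h : HasRelEigenvalues N H l) (h' : HasRelEigenvalues N H' l') (hl : Monotone l)
    (hl' : Monotone l') (hN : ∀ y, ‖y‖ ^ 2 ≤ N y y) (hseg : segment ℝ l l' ⊆ Γ) :
    ∃ c > 0, ∃ C > 0, ∀ᶠ p : ((V →L[ℝ] V →L[ℝ] ℝ) × (V →L[ℝ] V →L[ℝ] ℝ)) ×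
        ((V →L[ℝ] V →L[ℝ] ℝ) × (V →L[ℝ] V →L[ℝ] ℝ)) × ((V →L[ℝ] V →L[ℝ] ℝ) × ℝ) in
        𝓝 ((N, H), (N, H), (H', 0)),
      (∀ y, ‖y‖ ^ 2 ≤ p.1.1 y y) → (∀ y, ‖y‖ ^ 2 ≤ p.2.1.1 y y) →
      (∀ y, p.2.1.2 y y ≤ p.2.2.1 y y) → 0 ≤ p.2.2.2 →
      ∀ b μ a, Monotone b → Monotone μ → Monotone a → HasRelEigenvalues p.1.1 p.1.2 b →
        HasRelEigenvalues p.2.1.1 p.2.1.2 μ → HasRelEigenvalues p.2.1.1 p.2.2.1 a →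
        (∀ i, b i - p.2.2.2 ≤ μ i) →
          c * ∑ i, (μ i - b i) - C * (n * p.2.2.2) ≤ γ a - γ b := by
  obtain ⟨c, hc, C, hC, hev⟩ := hγ.exists_eventually_le_sub hseg
  refine ⟨c, hc, C, hC, ?_⟩
  rw [nhds_prod_eq, nhds_prod_eq, nhds_prod_eq] at hev
  obtain ⟨s, hs, t, ht, hst⟩ := Filter.mem_prod_iff.mp hev
  obtain ⟨s₁, hs₁, s₂, hs₂, hss⟩ := Filter.mem_prod_iff.mp hs
  obtain ⟨t₁, ht₁, t₂, ht₂, htt⟩ := Filter.mem_prod_iff.mp ht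
  have hb := h.eventually_forall_mem hV hl hN hs₁
  have hμ := h.eventually_forall_mem hV hl hN hs₂
  have ha := h'.eventually_forall_mem hV hl' hN ht₁
  filter_upwards [(continuous_fst.tendsto' _ _ rfl).eventually hb,
    (continuous_snd.fst.tendsto' _ _ rfl).eventually hμ,
    ((continuous_snd.fst.fst.prodMk continuous_snd.snd.fst).tendsto' _ _ rfl).eventually ha,
    (continuous_snd.snd.snd.tendsto' _ _ rfl).eventually ht₂]
    with p hpb hpμ hpa hps hN₁ hN₂ hle hs0 b μ a hbm hμm ham hb hμ ha hshift
  refine hst (a := ((b, μ), (a, p.2.2.2)))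
    ⟨hss ⟨hpb hN₁ b hbm hb, hpμ hN₂ μ hμm hμ⟩, htt ⟨hpa hN₂ a ham ha, hps⟩⟩ hs0 hshift fun i => ?_
  simpa using hμ.le_of_apply_self_le hV ha hμm ham hN₂ (c := 0) (by simpa using hle) i

end Comparison

section Barrier

set_option maxSynthPendingDepth 3

theorem deriv_deriv_nonneg_of_isLocalMin {f : ℝ → ℝ} {x : ℝ} (h : IsLocalMin f x)
    (hf : ContinuousAt f x) : 0 ≤ deriv (deriv f) x := by
  by_contra! hneg
  have hmax := isLocalMax_of_deriv_deriv_neg hneg h.deriv_eq_zero hf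
  have hconst : f =ᶠ[𝓝 x] fun _ => f x := by
    filter_upwards [h, hmax] with t h₁ h₂
    exact le_antisymm h₂ h₁
  refine hneg.ne ?_
  rw [hconst.deriv.deriv_eq]
  simp

section SecondOrder

variable {E : Type*} [NormedAddCommGroup E] [NormedSpace ℝ E] {u U : E → ℝ} {z : E}

theorem hasFDerivAt_fderiv (hu : ContDiffAt ℝ 2 u z) :
    HasFDerivAt (fderiv ℝ u) (fderiv ℝ (fderiv ℝ u) z) z :=
  ((hu.fderiv_right (m := 1) (by norm_num)).differentiableAt (by simp)).hasFDerivAt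

theorem continuousAt_fderiv_fderiv (hu : ContDiffAt ℝ 2 u z) :
    ContinuousAt (fderiv ℝ (fderiv ℝ u)) z :=
  ((hu.fderiv_right (m := 1) (by norm_num)).fderiv_right (m := 0) (by norm_num)).continuousAt

theorem fderiv_fderiv_nonneg_of_isLocalMin (h : IsLocalMin u z) (hu : ContDiffAt ℝ 2 u z)
    (y : E) : 0 ≤ fderiv ℝ (fderiv ℝ u) z y y := by
  let c : ℝ → E := fun t => z + t • y
  have hc : ∀ t, HasDerivAt c y t := fun t => by
    simpa [c] using ((hasDerivAt_id t).smul_const y).const_add z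
  have hc0 : c 0 = z := by simp [c]
  have hct : Filter.Tendsto c (𝓝 0) (𝓝 z) := hc0 ▸ (hc 0).continuousAt.tendsto
  have hd : deriv (u ∘ c) =ᶠ[𝓝 0] fun t => fderiv ℝ u (c t) y := by
    filter_upwards [hct.eventually (hu.eventually (by simp))] with t ht
    exact ((ht.differentiableAt (by simp)).hasFDerivAt.comp_hasDerivAt t (hc t)).deriv
  have hdd : HasDerivAt (fun t => fderiv ℝ u (c t) y) (fderiv ℝ (fderiv ℝ u) z y y) 0 := by
    have houter : HasFDerivAt (fderiv ℝ u) (fderiv ℝ (fderiv ℝ u) z) (c 0) := by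
      rw [hc0]
      exact hasFDerivAt_fderiv hu
    simpa using (houter.comp_hasDerivAt (0 : ℝ) (hc 0)).clm_apply (hasDerivAt_const (0 : ℝ) y)
  rw [← hdd.deriv, ← hd.deriv_eq]
  refine deriv_deriv_nonneg_of_isLocalMin ?_ ?_
  · filter_upwards [hct.eventually h] with t ht
    simpa [hc0] using ht
  · exact ContinuousAt.comp (hc0.symm ▸ hu.continuousAt) (hc 0).continuousAt

theorem fderiv_eq_of_isLocalMin_sub (h : IsLocalMin (fun x => U x - u x) z)
    (hu : DifferentiableAt ℝ u z) (hU : DifferentiableAt ℝ U z) :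
    fderiv ℝ U z = fderiv ℝ u z :=
  sub_eq_zero.mp (h.hasFDerivAt_eq_zero (hU.hasFDerivAt.sub hu.hasFDerivAt))

theorem fderiv_fderiv_le_of_isLocalMin_sub (h : IsLocalMin (fun x => U x - u x) z)
    (hu : ContDiffAt ℝ 2 u z) (hU : ContDiffAt ℝ 2 U z) (y : E) :
    fderiv ℝ (fderiv ℝ u) z y y ≤ fderiv ℝ (fderiv ℝ U) z y y := by
  have hd : fderiv ℝ (fun x => U x - u x) =ᶠ[𝓝 z] fun x => fderiv ℝ U x - fderiv ℝ u x := by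
    filter_upwards [hu.eventually (by simp), hU.eventually (by simp)] with x hux hUx
    exact fderiv_fun_sub (hUx.differentiableAt (by simp)) (hux.differentiableAt (by simp))
  have hdd := ((hasFDerivAt_fderiv hU).sub (hasFDerivAt_fderiv hu)).congr_of_eventuallyEq hd
  have := fderiv_fderiv_nonneg_of_isLocalMin h (hU.sub hu) y
  rw [hdd.fderiv] at this
  simpa using this

end SecondOrder

section Gaussian

variable {V : Type*} [NormedAddCommGroup V]

/-- The Gaussian barrier of height `ε` centred at `y₀`. -/
noncomputable def barrier (ε k : ℝ) (y₀ z : V) : ℝ := ε * Real.exp (-(k * ‖z - y₀‖ ^ 2))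

theorem barrier_pos {ε : ℝ} (hε : 0 < ε) (k : ℝ) (y₀ z : V) : 0 < barrier ε k y₀ z :=
  mul_pos hε (Real.exp_pos _)

theorem barrier_le {ε k : ℝ} (hε : 0 ≤ ε) (hk : 0 ≤ k) (y₀ z : V) : barrier ε k y₀ z ≤ ε :=
  mul_le_of_le_one_right hε (Real.exp_le_one_iff.mpr (neg_nonpos.mpr (by positivity)))

end Gaussian

variable {V : Type*} [NormedAddCommGroup V] [InnerProductSpace ℝ V]

theorem hasFDerivAt_barrier (ε k : ℝ) (y₀ z : V) :
    HasFDerivAt (barrier ε k y₀) (-(2 * k * barrier ε k y₀ z) • realInner V (z - y₀)) z := by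
  have hsq : HasFDerivAt (fun z : V => ‖z - y₀‖ ^ 2) (2 • realInner V (z - y₀)) z := by
    have := (hasStrictFDerivAt_norm_sq (z - y₀)).hasFDerivAt.comp z
      ((hasFDerivAt_id z).sub_const y₀)
    exact this
  refine ((hsq.const_mul k).neg.exp.const_mul ε).congr_fderiv (ContinuousLinearMap.ext fun y => ?_)
  simp only [barrier, smul_apply, smul_eq_mul, nsmul_eq_mul, Pi.neg_apply, smul_neg, neg_apply,
    neg_mul, Nat.cast_ofNat]
  ring

theorem contDiff_barrier (ε k : ℝ) (y₀ : V) : ContDiff ℝ 2 (barrier ε k y₀) :=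
  contDiff_const.mul (Real.contDiff_exp.comp
    (contDiff_const.mul ((contDiff_id.sub contDiff_const).norm_sq ℝ)).neg)

theorem hasFDerivAt_fderiv_barrier (ε k : ℝ) (y₀ z : V) :
    HasFDerivAt (fderiv ℝ (barrier ε k y₀))
      ((2 * k * barrier ε k y₀ z) • barrierForm k (z - y₀)) z := by
  rw [funext fun z => (hasFDerivAt_barrier ε k y₀ z).fderiv]
  have hcoeff : HasFDerivAt (fun z => -(2 * k * barrier ε k y₀ z))
      (-((2 * k) • (-(2 * k * barrier ε k y₀ z) • realInner V (z - y₀)))) z :=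
    ((hasFDerivAt_barrier ε k y₀ z).const_mul (2 * k)).neg
  have hinner : HasFDerivAt (fun z => realInner V (z - y₀)) (realInner V) z :=
    (realInner V).hasFDerivAt.comp z ((hasFDerivAt_id z).sub_const y₀)
  refine (hcoeff.smul hinner).congr_fderiv
    (ContinuousLinearMap.ext fun x => ContinuousLinearMap.ext fun y => ?_)
  simp only [add_apply, smul_apply, neg_apply, ContinuousLinearMap.smulRight_apply,
    realInner_apply, smul_eq_mul, barrierForm_apply]
  ring

theorem fderiv_add_barrier {u : V → ℝ} {z : V} (hu : DifferentiableAt ℝ u z) (ε k : ℝ) (y₀ : V) :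
    fderiv ℝ (fun x => u x + barrier ε k y₀ x) z =
      fderiv ℝ u z - (2 * k * barrier ε k y₀ z) • realInner V (z - y₀) := by
  rw [fderiv_fun_add hu (hasFDerivAt_barrier ε k y₀ z).differentiableAt,
    (hasFDerivAt_barrier ε k y₀ z).fderiv, neg_smul, ← sub_eq_add_neg]

theorem fderiv_fderiv_add_barrier {u : V → ℝ} {z : V} (hu : ContDiffAt ℝ 2 u z) (ε k : ℝ)
    (y₀ : V) : fderiv ℝ (fderiv ℝ fun x => u x + barrier ε k y₀ x) z =
      fderiv ℝ (fderiv ℝ u) z + (2 * k * barrier ε k y₀ z) • barrierForm k (z - y₀) := by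
  have hd : fderiv ℝ (fun x => u x + barrier ε k y₀ x) =ᶠ[𝓝 z]
      fun x => fderiv ℝ u x + fderiv ℝ (barrier ε k y₀) x := by
    filter_upwards [hu.eventually (by simp)] with x hx
    exact fderiv_fun_add (hx.differentiableAt (by simp))
      (hasFDerivAt_barrier ε k y₀ x).differentiableAt
  exact (((hasFDerivAt_fderiv hu).add
    (hasFDerivAt_fderiv_barrier ε k y₀ z)).congr_of_eventuallyEq hd).fderiv

section Contact

variable {u U : V → ℝ} {z y₀ : V} {ε k : ℝ}

theorem norm_fderiv_sub_fderiv_of_isLocalMin_sub_barrier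
    (hmin : IsLocalMin (fun x => U x - (u x + barrier ε k y₀ x)) z) (hε : 0 < ε) (hk : 0 ≤ k)
    (hu : DifferentiableAt ℝ u z) (hU : DifferentiableAt ℝ U z) :
    ‖fderiv ℝ u z - fderiv ℝ U z‖ = 2 * k * barrier ε k y₀ z * ‖z - y₀‖ := by
  have hκ : 0 ≤ 2 * k * barrier ε k y₀ z :=
    mul_nonneg (by positivity) (barrier_pos hε k y₀ z).le
  rw [fderiv_eq_of_isLocalMin_sub hmin
    (hu.add (hasFDerivAt_barrier ε k y₀ z).differentiableAt) hU, fderiv_add_barrier hu,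
    sub_sub_cancel, norm_smul, norm_realInner_apply, Real.norm_of_nonneg hκ]

theorem add_barrierForm_apply_self_le_of_isLocalMin_sub
    (hmin : IsLocalMin (fun x => U x - (u x + barrier ε k y₀ x)) z) (hu : ContDiffAt ℝ 2 u z)
    (hU : ContDiffAt ℝ 2 U z) (y : V) :
    (fderiv ℝ (fderiv ℝ u) z + (2 * k * barrier ε k y₀ z) • barrierForm k (z - y₀)) y y ≤
      fderiv ℝ (fderiv ℝ U) z y y := by
  rw [← fderiv_fderiv_add_barrier hu]
  exact fderiv_fderiv_le_of_isLocalMin_sub hmin (hu.add (contDiff_barrier ε k y₀).contDiffAt) hU y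

end Contact

end Barrier

section HopfLemma

set_option maxSynthPendingDepth 3

variable {n : ℕ} {V : Type*} [NormedAddCommGroup V] [InnerProductSpace ℝ V]

/-- The first fundamental form `N` and the right-hand side `φ` of a prescribed curvature equation
for graphs, as functions of the differential of the graphing function. -/
structure IsCurvatureOperator (N : (V →L[ℝ] ℝ) → V →L[ℝ] V →L[ℝ] ℝ) (φ : (V →L[ℝ] ℝ) → ℝ) :
    Prop where
  contDiff_metric : ContDiff ℝ 1 N
  contDiff_rhs : ContDiff ℝ 1 φ
  coercive : ∀ q y, ‖y‖ ^ 2 ≤ N q y y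

/-- `u` satisfies the curvature equation at `y`, with admissible curvatures `l`. -/
structure SolvesAt (Γ : Set (Fin n → ℝ)) (γ : (Fin n → ℝ) → ℝ)
    (N : (V →L[ℝ] ℝ) → V →L[ℝ] V →L[ℝ] ℝ) (φ : (V →L[ℝ] ℝ) → ℝ) (u : V → ℝ) (y : V)
    (l : Fin n → ℝ) : Prop where
  mem : l ∈ convexCone Γ
  hasRelEigenvalues : HasRelEigenvalues (N (fderiv ℝ u y)) (fderiv ℝ (fderiv ℝ u) y) l
  equation : γ l = φ (fderiv ℝ u y)

/-- `u` and `U` satisfy the curvature equation at `y`, one of them with positive curvatures. -/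
def SolvePairAt (Γ : Set (Fin n → ℝ)) (γ : (Fin n → ℝ) → ℝ)
    (N : (V →L[ℝ] ℝ) → V →L[ℝ] V →L[ℝ] ℝ) (φ : (V →L[ℝ] ℝ) → ℝ) (u U : V → ℝ) (y : V) : Prop :=
  ∃ b a : Fin n → ℝ, SolvesAt Γ γ N φ u y b ∧ SolvesAt Γ γ N φ U y a ∧
    (b ∈ positiveCone n ∨ a ∈ positiveCone n)

variable {Γ : Set (Fin n → ℝ)} {γ : (Fin n → ℝ) → ℝ} {N : (V →L[ℝ] ℝ) → V →L[ℝ] V →L[ℝ] ℝ}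
  {φ : (V →L[ℝ] ℝ) → ℝ} {u U : V → ℝ} {x₀ y₀ : V}

theorem SolvesAt.comp_perm (hγ : IsEllipticSpeed Γ γ) {l : Fin n → ℝ} {y : V}
    (h : SolvesAt Γ γ N φ u y l) (σ : Equiv.Perm (Fin n)) : SolvesAt Γ γ N φ u y (l ∘ σ) :=
  ⟨hγ.comp_perm_mem_convexCone h.mem σ, h.hasRelEigenvalues.comp_perm σ,
    (hγ.symmetric _ h.mem.1 σ).trans h.equation⟩

theorem SolvePairAt.exists_monotone (hγ : IsEllipticSpeed Γ γ) {y : V}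
    (h : SolvePairAt Γ γ N φ u U y) :
    ∃ b a : Fin n → ℝ, Monotone b ∧ Monotone a ∧ SolvesAt Γ γ N φ u y b ∧
      SolvesAt Γ γ N φ U y a ∧ (b ∈ positiveCone n ∨ a ∈ positiveCone n) := by
  obtain ⟨b, a, hb, ha, hpos⟩ := h
  exact ⟨b ∘ Tuple.sort b, a ∘ Tuple.sort a, Tuple.monotone_sort b, Tuple.monotone_sort a,
    hb.comp_perm hγ _, ha.comp_perm hγ _, hpos.imp (fun h i => h _) fun h i => h _⟩

theorem SolvePairAt.symm {y : V} (h : SolvePairAt Γ γ N φ u U y) : SolvePairAt Γ γ N φ U u y := by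
  obtain ⟨b, a, hb, ha, hpos⟩ := h
  exact ⟨a, b, ha, hb, hpos.symm⟩

theorem exists_eventually_norm_sub_le_of_contDiffAt {E F : Type*} [NormedAddCommGroup E]
    [NormedSpace ℝ E] [NormedAddCommGroup F] [NormedSpace ℝ F] {f : E → F} {x : E}
    (hf : ContDiffAt ℝ 1 f x) :
    ∃ L ≥ 0, ∀ᶠ p in 𝓝 (x, x), ‖f p.1 - f p.2‖ ≤ L * ‖p.1 - p.2‖ := by
  obtain ⟨L, s, hs, hL⟩ := hf.exists_lipschitzOnWith
  refine ⟨L, L.2, ?_⟩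
  filter_upwards [prod_mem_nhds hs hs] with p hp
  exact hL.norm_sub_le hp.1 hp.2

theorem tendsto_forms_add_barrier (hN : Continuous N) (hu : ContDiffAt ℝ 2 u x₀)
    (hU : ContDiffAt ℝ 2 U x₀) (hD : fderiv ℝ U x₀ = fderiv ℝ u x₀) {A : V → ℝ}
    (hA : ContinuousAt A x₀) (k : ℝ) (y₀ : V) :
    Filter.Tendsto (fun p : V × ℝ =>
      ((N (fderiv ℝ u p.1), fderiv ℝ (fderiv ℝ u) p.1),
        (N (fderiv ℝ U p.1), fderiv ℝ (fderiv ℝ u) p.1 +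
          (2 * k * barrier p.2 k y₀ p.1) • barrierForm k (p.1 - y₀)),
        (fderiv ℝ (fderiv ℝ U) p.1, 2 * k * barrier p.2 k y₀ p.1 * A p.1))) (𝓝 (x₀, 0))
      (𝓝 ((N (fderiv ℝ u x₀), fderiv ℝ (fderiv ℝ u) x₀),
        (N (fderiv ℝ u x₀), fderiv ℝ (fderiv ℝ u) x₀), (fderiv ℝ (fderiv ℝ U) x₀, 0))) := by
  have hDu := (hasFDerivAt_fderiv hu).continuousAt
  have hDU := (hasFDerivAt_fderiv hU).continuousAt
  have hDDu := continuousAt_fderiv_fderiv hu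
  have hDDU := continuousAt_fderiv_fderiv hU
  unfold barrier
  convert ContinuousAt.tendsto (x := (x₀, (0 : ℝ))) ?_ using 2
  · simp [hD]
  · fun_prop

theorem not_isLocalMinOn_sub_barrier {d : V → ℝ} {ε k : ℝ} (hε : 0 < ε) (hk : 0 < k)
    (hd : HasFDerivAt d (0 : V →L[ℝ] ℝ) x₀) (hne : x₀ ≠ y₀) :
    ¬ IsLocalMinOn (fun z => d z - barrier ε k y₀ z) (Metric.closedBall y₀ ‖x₀ - y₀‖) x₀ := by
  intro hmin
  have hseg : segment ℝ x₀ y₀ ⊆ Metric.closedBall y₀ ‖x₀ - y₀‖ :=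
    (convex_closedBall y₀ ‖x₀ - y₀‖).segment_subset (mem_closedBall_iff_norm.mpr le_rfl)
      (Metric.mem_closedBall_self (norm_nonneg _))
  have hslope := hmin.hasFDerivWithinAt_nonneg
    (hd.sub (hasFDerivAt_barrier ε k y₀ x₀)).hasFDerivWithinAt
    (sub_mem_posTangentConeAt_of_segment_subset (x := x₀) (y := y₀) hseg)
  have hξ : 0 < ‖x₀ - y₀‖ := norm_sub_pos_iff.mpr hne
  have hpos : 0 < 2 * k * barrier ε k y₀ x₀ * ‖x₀ - y₀‖ ^ 2 :=
    mul_pos (mul_pos (by positivity) (barrier_pos hε k y₀ x₀)) (by positivity)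
  rw [zero_sub, neg_smul, neg_neg, smul_apply, realInner_apply, ← neg_sub x₀ y₀, inner_neg_right,
    real_inner_self_eq_norm_sq, smul_eq_mul] at hslope
  linarith

variable [FiniteDimensional ℝ V]

theorem mul_le_of_isLocalMin_sub_barrier (hV : Module.finrank ℝ V = n)
    (hop : IsCurvatureOperator N φ) {z : V} {a b : Fin n → ℝ} {ε k c C L₁ L₂ M A : ℝ}
    (hM : 0 < M) (hNM : ‖N (fderiv ℝ U z)‖ ≤ M) (hc : 0 ≤ c) (hk : 0 < k) (hε : 0 < ε)
    (hu : ContDiffAt ℝ 2 u z) (hU : ContDiffAt ℝ 2 U z)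
    (hmin : IsLocalMin (fun x => U x - (u x + barrier ε k y₀ x)) z)
    (hL₁ : ‖N (fderiv ℝ u z) - N (fderiv ℝ U z)‖ ≤ L₁ * ‖fderiv ℝ u z - fderiv ℝ U z‖)
    (hL₂ : ‖φ (fderiv ℝ u z) - φ (fderiv ℝ U z)‖ ≤ L₂ * ‖fderiv ℝ u z - fderiv ℝ U z‖)
    (hbm : Monotone b) (hb : SolvesAt Γ γ N φ u z b) (ha : SolvesAt Γ γ N φ U z a)
    (hA : A = ‖fderiv ℝ (fderiv ℝ u) z‖ * (L₁ * ‖z - y₀‖) + 1)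
    (hspeed : ∀ μ : Fin n → ℝ, Monotone μ → HasRelEigenvalues (N (fderiv ℝ U z))
      (fderiv ℝ (fderiv ℝ u) z + (2 * k * barrier ε k y₀ z) • barrierForm k (z - y₀)) μ →
      (∀ i, b i - 2 * k * barrier ε k y₀ z * A ≤ μ i) →
      c * ∑ i, (μ i - b i) - C * (n * (2 * k * barrier ε k y₀ z * A)) ≤ γ a - γ b) :
    k * (2 * c * (‖z - y₀‖ ^ 2 / M)) ≤ L₂ * ‖z - y₀‖ + (c + C) * (n * A) := by
  obtain ⟨e, he, -⟩ := ha.hasRelEigenvalues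
  have hfirst := norm_fderiv_sub_fderiv_of_isLocalMin_sub_barrier hmin hε hk.le
    (hu.differentiableAt (by simp)) (hU.differentiableAt (by simp))
  have hκ : 0 < 2 * k * barrier ε k y₀ z := mul_pos (by positivity) (barrier_pos hε k y₀ z)
  set κ := 2 * k * barrier ε k y₀ z
  rw [hfirst, mul_left_comm] at hL₁ hL₂
  obtain ⟨μ, hμm, hμ, hμlow, hμsum⟩ := hb.hasRelEigenvalues.exists_add_barrierForm hV hbm he
    (hop.coercive _) (hop.coercive _) (hu.isSymmSndFDerivAt (by simp)) hM hNM hk.le hκ.le hL₁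
    (z - y₀)
  rw [← hA] at hμlow hμsum
  have hgap := hspeed μ hμm hμ hμlow
  rw [hb.equation, ha.equation] at hgap
  have hrhs := neg_le_of_abs_le hL₂
  have htrace := mul_le_mul_of_nonneg_left hμsum hc
  refine le_of_mul_le_mul_left ?_ hκ
  linarith

/-- At an interior minimum of `U - u - barrier`, the Hessian of the barrier forces the eigenvalues
of `U` up by more than the equation allows once `k` is large. The perturbations of metric and
right-hand side are Lipschitz in the slope of the barrier, so they carry the same small factor. -/
theorem SolvePairAt.exists_eventually_not_isLocalMin_sub (hγ : IsEllipticSpeed Γ γ)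
    (hV : Module.finrank ℝ V = n) (hop : IsCurvatureOperator N φ) (hu : ContDiffAt ℝ 2 u x₀)
    (hU : ContDiffAt ℝ 2 U x₀) (hD : fderiv ℝ U x₀ = fderiv ℝ u x₀)
    (hpair : SolvePairAt Γ γ N φ u U x₀) (hne : x₀ ≠ y₀) :
    ∃ k > 0, ∀ᶠ p : V × ℝ in 𝓝 (x₀, 0), 0 < p.2 → SolvePairAt Γ γ N φ u U p.1 →
      ¬ IsLocalMin (fun z => U z - (u z + barrier p.2 k y₀ z)) p.1 := by
  obtain ⟨b₀, a₀, hb₀m, ha₀m, hb₀, ha₀, hpos⟩ := hpair.exists_monotone hγ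
  obtain ⟨c, hc, C, -, hspeed⟩ := hγ.exists_eventually_forall_relEigenvalues_le hV
    hb₀.hasRelEigenvalues (hD ▸ ha₀.hasRelEigenvalues) hb₀m ha₀m (hop.coercive _)
    (hγ.segment_subset hb₀.mem ha₀.mem hpos)
  obtain ⟨L₁, hL₁0, hL₁⟩ := exists_eventually_norm_sub_le_of_contDiffAt
    (hop.contDiff_metric.contDiffAt (x := fderiv ℝ u x₀))
  obtain ⟨L₂, -, hL₂⟩ := exists_eventually_norm_sub_le_of_contDiffAt
    (hop.contDiff_rhs.contDiffAt (x := fderiv ℝ u x₀))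
  have hM : 0 < ‖N (fderiv ℝ u x₀)‖ + 1 := by positivity
  set M := ‖N (fderiv ℝ u x₀)‖ + 1
  have hξ : 0 < ‖x₀ - y₀‖ := norm_sub_pos_iff.mpr hne
  let A : V → ℝ := fun z => ‖fderiv ℝ (fderiv ℝ u) z‖ * (L₁ * ‖z - y₀‖) + 1
  obtain ⟨k, hk, hbig⟩ : ∃ k > 0, L₂ * ‖x₀ - y₀‖ + (c + C) * (n * A x₀) <
      k * (2 * c * (‖x₀ - y₀‖ ^ 2 / M)) :=
    ((Filter.eventually_gt_atTop 0).and ((Filter.tendsto_id.atTop_mul_const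
      (by positivity)).eventually_gt_atTop _)).exists
  have hN := hop.contDiff_metric.continuous
  have hDu := (hasFDerivAt_fderiv hu).continuousAt
  have hDU := (hasFDerivAt_fderiv hU).continuousAt
  have hDDu := continuousAt_fderiv_fderiv hu
  have hDD : Filter.Tendsto (fun z => (fderiv ℝ u z, fderiv ℝ U z)) (𝓝 x₀)
      (𝓝 (fderiv ℝ u x₀, fderiv ℝ u x₀)) := hDu.tendsto.prodMk_nhds (hD ▸ hDU.tendsto)
  have hNU : ContinuousAt (fun z => ‖N (fderiv ℝ U z)‖) x₀ := by fun_prop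
  have hNM : ∀ᶠ t in 𝓝 ‖N (fderiv ℝ U x₀)‖, t < M := gt_mem_nhds (by simp [hD, M])
  have hA : ContinuousAt A x₀ := by fun_prop
  have hlow : ContinuousAt (fun z => L₂ * ‖z - y₀‖ + (c + C) * (n * A z)) x₀ := by fun_prop
  have hhigh : ContinuousAt (fun z => k * (2 * c * (‖z - y₀‖ ^ 2 / M))) x₀ := by fun_prop
  refine ⟨k, hk, ?_⟩
  filter_upwards [(tendsto_forms_add_barrier hN hu hU hD hA k y₀).eventually hspeed,
    continuousAt_fst.eventually ((hDD.eventually hL₁).and (hDD.eventually hL₂)),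
    continuousAt_fst.eventually (hNU.tendsto.eventually hNM),
    continuousAt_fst.eventually (hlow.eventually_lt hhigh hbig),
    continuousAt_fst.eventually ((hu.eventually (by simp)).and (hU.eventually (by simp)))]
    with ⟨z, ε⟩ hp ⟨hL₁, hL₂⟩ hNM hbig ⟨hu, hU⟩ hε hpair hmin
  obtain ⟨b, a, hbm, ham, hb, ha, -⟩ := hpair.exists_monotone hγ
  refine hbig.not_ge (mul_le_of_isLocalMin_sub_barrier hV hop hM hNM.le hc.le hk hε hu hU hmin
    hL₁ hL₂ hbm hb ha rfl fun μ hμm hμ hμlow => hp (hop.coercive _) (hop.coercive _)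
      (add_barrierForm_apply_self_le_of_isLocalMin_sub hmin hu hU) ?_ b μ a hbm hμm ham
      hb.hasRelEigenvalues hμ ha.hasRelEigenvalues hμlow)
  have := barrier_pos hε k y₀ z
  positivity

theorem exists_isLocalMinOn_sub_barrier {d : V → ℝ} {k : ℝ} (hk : 0 ≤ k) (hdx : d x₀ = 0)
    (hd : ∀ᶠ z in 𝓝 x₀, ContinuousAt d z)
    (hpos : ∀ᶠ z in 𝓝 x₀, z ∈ Metric.closedBall y₀ ‖x₀ - y₀‖ → z ≠ x₀ → 0 < d z)
    (hmin : ∀ᶠ p : V × ℝ in 𝓝 (x₀, 0), 0 < p.2 → p.1 ∈ Metric.ball y₀ ‖x₀ - y₀‖ →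
      ¬ IsLocalMin (fun z => d z - barrier p.2 k y₀ z) p.1) :
    ∃ ε > 0, IsLocalMinOn (fun z => d z - barrier ε k y₀ z)
      (Metric.closedBall y₀ ‖x₀ - y₀‖) x₀ := by
  set R := ‖x₀ - y₀‖
  rw [nhds_prod_eq] at hmin
  obtain ⟨P, hP, Q, hQ, hPQ⟩ := Filter.eventually_prod_iff.mp hmin
  obtain ⟨ρ, hρ, hball⟩ := Metric.nhds_basis_closedBall.eventually_iff.mp (hd.and (hpos.and hP))
  obtain ⟨δ, hδ, hQ⟩ := Metric.nhds_basis_closedBall.eventually_iff.mp hQ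
  obtain ⟨m, hm, hmd⟩ := ((isCompact_sphere x₀ ρ).inter_right
    Metric.isClosed_closedBall).exists_forall_le' (f := d) (a := 0)
    (fun z hz => (hball (Metric.sphere_subset_closedBall hz.1)).1.continuousWithinAt)
    (fun z hz => (hball (Metric.sphere_subset_closedBall hz.1)).2.1 hz.2
      (Metric.ne_of_mem_sphere hz.1 hρ.ne'))
  have hε : 0 < min m δ := lt_min hm hδ
  set ε := min m δ
  refine ⟨ε, hε, ?_⟩
  have hcont : ContinuousOn (fun z => d z - barrier ε k y₀ z)
      (Metric.closedBall x₀ ρ ∩ Metric.closedBall y₀ R) := fun z hz =>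
    ((hball hz.1).1.sub (contDiff_barrier ε k y₀).continuous.continuousAt).continuousWithinAt
  have hx₀ : x₀ ∈ Metric.closedBall x₀ ρ ∩ Metric.closedBall y₀ R :=
    ⟨Metric.mem_closedBall_self hρ.le, mem_closedBall_iff_norm.mpr le_rfl⟩
  obtain ⟨z, hz, hzmin⟩ := ((isCompact_closedBall x₀ ρ).inter_right
    Metric.isClosed_closedBall).exists_isMinOn ⟨x₀, hx₀⟩ hcont
  have hle : d x₀ - barrier ε k y₀ x₀ ≤ d z - barrier ε k y₀ z := by
    rcases (Metric.mem_closedBall.mp hz.1).lt_or_eq with hzρ | hzρ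
    · rcases (Metric.mem_closedBall.mp hz.2).lt_or_eq with hzR | hzR
      · refine absurd (hzmin.isLocalMin ?_) (hPQ (hball hz.1).2.2
          (hQ (Metric.mem_closedBall.mpr ?_)) hε hzR)
        · exact Filter.inter_mem (Metric.closedBall_mem_nhds_of_mem hzρ)
            (Metric.closedBall_mem_nhds_of_mem hzR)
        · simp [abs_of_pos hε, ε]
      · rcases eq_or_ne z x₀ with rfl | hne
        · exact le_rfl
        · have hb : barrier ε k y₀ z = barrier ε k y₀ x₀ := by
            rw [barrier, barrier, ← dist_eq_norm, hzR]
          rw [hdx, hb]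
          exact sub_le_sub_right ((hball hz.1).2.1 hz.2 hne).le _
    · have := hmd z ⟨hzρ, hz.2⟩
      linarith [barrier_pos hε k y₀ x₀, barrier_le hε.le hk y₀ z, min_le_left m δ]
  filter_upwards [self_mem_nhdsWithin, mem_nhdsWithin_of_mem_nhds
    (Metric.closedBall_mem_nhds x₀ hρ)] with y hyR hyρ
  exact hle.trans (hzmin ⟨hyρ, hyR⟩)

theorem SolvePairAt.false_of_touching (hγ : IsEllipticSpeed Γ γ)
    (hV : Module.finrank ℝ V = n) (hop : IsCurvatureOperator N φ) (hu : ContDiffAt ℝ 2 u x₀)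
    (hU : ContDiffAt ℝ 2 U x₀) (heq : u x₀ = U x₀) (hD : fderiv ℝ U x₀ = fderiv ℝ u x₀)
    (hpair : SolvePairAt Γ γ N φ u U x₀) (hne : x₀ ≠ y₀)
    (hin : ∀ᶠ z in 𝓝 x₀, z ∈ Metric.ball y₀ ‖x₀ - y₀‖ → SolvePairAt Γ γ N φ u U z)
    (hlt : ∀ᶠ z in 𝓝 x₀, z ∈ Metric.closedBall y₀ ‖x₀ - y₀‖ → z ≠ x₀ → u z < U z) : False := by
  obtain ⟨k, hk, hinterior⟩ :=
    hpair.exists_eventually_not_isLocalMin_sub hγ hV hop hu hU hD hne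
  obtain ⟨ε, hε, hmin⟩ := exists_isLocalMinOn_sub_barrier (d := U - u) (y₀ := y₀) hk.le
    (by simp [heq])
    (((hU.eventually (by simp)).and (hu.eventually (by simp))).mono fun z hz =>
      hz.1.continuousAt.sub hz.2.continuousAt)
    (hlt.mono fun z hz hzR hzx => sub_pos.mpr (hz hzR hzx))
    (by
      filter_upwards [hinterior, continuousAt_fst.eventually hin] with p hp hin hp0 hpR
      simpa only [Pi.sub_apply, sub_sub] using hp hp0 (hin hpR))
  refine not_isLocalMinOn_sub_barrier hε hk ?_ hne hmin
  simpa [hD] using (hU.differentiableAt (by simp)).hasFDerivAt.sub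
    (hu.differentiableAt (by simp)).hasFDerivAt

end HopfLemma

section StrongMaximumPrinciple

set_option maxSynthPendingDepth 3

variable {n : ℕ} {V : Type*} [NormedAddCommGroup V] [InnerProductSpace ℝ V]

theorem eq_of_mem_closedBall_midpoint {x y z : V}
    (h : z ∈ Metric.closedBall (midpoint ℝ y x) ‖x - midpoint ℝ y x‖) (h' : ‖x - y‖ ≤ ‖z - y‖) :
    z = x := by
  rw [mem_closedBall_iff_norm] at h
  set m := midpoint ℝ y x with hm
  have hmid : x - m = m - y := by
    rw [hm, midpoint_eq_smul_add, invOf_eq_inv]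
    module
  have hpar := parallelogram_law_with_norm ℝ (z - m) (x - m)
  have hz : z - m + (x - m) = z - y := by
    rw [hmid]
    abel
  have hx : x - y = (2 : ℝ) • (x - m) := by
    rw [two_smul, ← sub_add_sub_cancel x m y, ← hmid]
  rw [hz, sub_sub_sub_cancel_right] at hpar
  rw [hx, norm_smul, Real.norm_of_nonneg zero_le_two] at h'
  have hzx : ‖z - x‖ * ‖z - x‖ ≤ 0 := by nlinarith [norm_nonneg (z - m), norm_nonneg (x - m)]
  exact sub_eq_zero.mp (norm_eq_zero.mp (by nlinarith [norm_nonneg (z - x)]))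

variable [FiniteDimensional ℝ V]

theorem exists_ball_touching_zeros {f : V → ℝ} {D : Set V} (hD : IsOpen D)
    (hDc : IsPreconnected D) (hf : ContinuousOn f D) {p q : V} (hp : p ∈ D) (hfp : f p = 0)
    (hq : q ∈ D) (hfq : f q ≠ 0) :
    ∃ x ∈ D, ∃ y, f x = 0 ∧ x ≠ y ∧ ∀ z ∈ Metric.ball y ‖x - y‖, f z ≠ 0 := by
  have hO : IsOpen (D ∩ f ⁻¹' {0}ᶜ) := hf.isOpen_inter_preimage hD isOpen_compl_singleton
  obtain ⟨x, hxO, hxD, hx⟩ : ∃ x ∈ closure (D ∩ f ⁻¹' {0}ᶜ), x ∈ D ∧ f x = 0 := by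
    by_contra! hno
    exact (hDc.subset_of_closure_inter_subset hO ⟨q, hq, hq, hfq⟩
      (fun z hz => ⟨hz.2, hno z hz.1 hz.2⟩) hp).2 hfp
  obtain ⟨s, hs, hball⟩ := Metric.isOpen_iff.mp hD x hxD
  obtain ⟨y, ⟨-, hfy⟩, hyx⟩ := Metric.mem_closure_iff.mp hxO (s / 2) (half_pos hs)
  have hsub : Metric.closedBall y (dist x y) ⊆ D :=
    (Metric.closedBall_subset_ball' (by linarith [dist_comm x y])).trans hball
  have hK : IsCompact (Metric.closedBall y (dist x y) ∩ f ⁻¹' {0}) :=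
    (isCompact_closedBall y (dist x y)).of_isClosed_subset
      ((hf.mono hsub).preimage_isClosed_of_isClosed Metric.isClosed_closedBall isClosed_singleton)
      Set.inter_subset_left
  obtain ⟨x₁, ⟨hx₁b, hx₁⟩, hx₁min⟩ := hK.exists_infDist_eq_dist
    ⟨x, Metric.mem_closedBall.mpr le_rfl, hx⟩ y
  refine ⟨x₁, hsub hx₁b, y, hx₁, fun h => hfy (h ▸ hx₁), fun z hz hfz => ?_⟩
  rw [← dist_eq_norm, Metric.mem_ball, dist_comm z, dist_comm x₁, ← hx₁min] at hz
  refine hz.not_ge (Metric.infDist_le_dist_of_mem ⟨?_, hfz⟩)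
  rw [Metric.mem_closedBall, dist_comm]
  exact (hz.trans_eq (hx₁min.trans (dist_comm _ _))).le.trans hx₁b

variable {Γ : Set (Fin n → ℝ)} {γ : (Fin n → ℝ) → ℝ} {N : (V →L[ℝ] ℝ) → V →L[ℝ] V →L[ℝ] ℝ}
  {φ : (V →L[ℝ] ℝ) → ℝ} {u U : V → ℝ} {D : Set V}

theorem eqOn_of_touching (hγ : IsEllipticSpeed Γ γ) (hV : Module.finrank ℝ V = n)
    (hop : IsCurvatureOperator N φ) (hD : IsOpen D) (hDc : IsPreconnected D)
    (hu : ∀ y ∈ D, ContDiffAt ℝ 2 u y) (hU : ∀ y ∈ D, ContDiffAt ℝ 2 U y)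
    (hle : ∀ y ∈ D, u y ≤ U y) (hpair : ∀ y ∈ D, SolvePairAt Γ γ N φ u U y) {p : V} (hp : p ∈ D)
    (hpe : u p = U p) : Set.EqOn u U D := by
  intro q hq
  by_contra hne
  obtain ⟨x, hx, y, hxe, hxy, hfar⟩ := exists_ball_touching_zeros (f := U - u) hD hDc
    (fun z hz => ((hU z hz).continuousAt.sub (hu z hz).continuousAt).continuousWithinAt)
    hp (by simp [hpe]) hq (sub_ne_zero.mpr (Ne.symm hne))
  have hxe : u x = U x := (sub_eq_zero.mp hxe).symm
  have hmin : IsLocalMin (fun z => U z - u z) x := by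
    filter_upwards [hD.mem_nhds hx] with z hz
    simpa [hxe] using hle z hz
  have hder := fderiv_eq_of_isLocalMin_sub hmin ((hu x hx).differentiableAt (by simp))
    ((hU x hx).differentiableAt (by simp))
  refine (hpair x hx).false_of_touching (y₀ := midpoint ℝ y x) hγ hV hop (hu x hx) (hU x hx) hxe
    hder (by simpa using hxy.symm) ?_ ?_
  · filter_upwards [hD.mem_nhds hx] with z hz _
    exact hpair z hz
  · filter_upwards [hD.mem_nhds hx] with z hz hzb hzne
    refine lt_of_le_of_ne (hle z hz) fun hze => hfar z ?_ (sub_eq_zero.mpr hze.symm)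
    rw [mem_ball_iff_norm]
    by_contra! hge
    exact hzne (eq_of_mem_closedBall_midpoint hzb hge)

/-- `0` is a point of `D` or a boundary point of `D` with an interior ball. -/
def HasInteriorBallAtZero (D : Set V) : Prop :=
  0 ∈ D ∨ ∃ a ≠ 0, Metric.closedBall a ‖a‖ \ {0} ⊆ D

omit [FiniteDimensional ℝ V] in
theorem HasInteriorBallAtZero.zero_mem_closure (h : HasInteriorBallAtZero D) : 0 ∈ closure D := by
  rcases h with h | ⟨a, ha, hsub⟩
  · exact subset_closure h
  · have hball : Metric.ball a ‖a‖ ⊆ D := fun z hz =>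
      hsub ⟨Metric.ball_subset_closedBall hz, by rintro rfl; simp at hz⟩
    refine closure_mono hball ?_
    rw [closure_ball a (norm_ne_zero_iff.mpr ha)]
    simp

theorem exists_touching_mem (hγ : IsEllipticSpeed Γ γ) (hV : Module.finrank ℝ V = n)
    (hop : IsCurvatureOperator N φ) (hD : HasInteriorBallAtZero D)
    (hu : ContDiffAt ℝ 2 u 0) (hU : ContDiffAt ℝ 2 U 0) (heq : u 0 = U 0)
    (hder : fderiv ℝ U 0 = fderiv ℝ u 0) (hle : ∀ᶠ y in 𝓝 0, y ∈ closure D → u y ≤ U y)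
    (hpair : ∀ᶠ y in 𝓝 0, y ∈ closure D → SolvePairAt Γ γ N φ u U y) {O : Set V} (hO : O ∈ 𝓝 0) :
    ∃ p ∈ D ∩ O, u p = U p := by
  have h0 := hD.zero_mem_closure
  rcases hD with hD | ⟨a, ha, hsub⟩
  · exact ⟨0, ⟨hD, mem_of_mem_nhds hO⟩, heq⟩
  by_contra! hno
  have hnorm : ‖(0 : V) - a‖ = ‖a‖ := by simp
  refine (hpair.self_of_nhds h0).false_of_touching hγ hV hop hu hU heq hder ha.symm ?_ ?_
  · filter_upwards [hpair] with z hz hzb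
    rw [hnorm] at hzb
    refine hz (subset_closure (hsub ⟨Metric.ball_subset_closedBall hzb, ?_⟩))
    rintro rfl
    simp at hzb
  · filter_upwards [hO, hle] with z hzO hle hzb hz0
    have hzD : z ∈ D := hsub ⟨hnorm ▸ hzb, hz0⟩
    exact lt_of_le_of_ne (hle (subset_closure hzD)) (hno z ⟨hzD, hzO⟩)

theorem eventually_eq_of_touching (hγ : IsEllipticSpeed Γ γ) (hV : Module.finrank ℝ V = n)
    (hop : IsCurvatureOperator N φ) (hDo : IsOpen D) (hDc : Convex ℝ D)
    (hD : HasInteriorBallAtZero D) (hu : ContDiffAt ℝ 2 u 0) (hU : ContDiffAt ℝ 2 U 0)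
    (heq : u 0 = U 0) (hder : fderiv ℝ U 0 = fderiv ℝ u 0)
    (hle : ∀ᶠ y in 𝓝 0, y ∈ closure D → u y ≤ U y)
    (hpair : ∀ᶠ y in 𝓝 0, y ∈ closure D → SolvePairAt Γ γ N φ u U y) :
    ∀ᶠ y in 𝓝 0, y ∈ closure D → u y = U y := by
  obtain ⟨ρ, hρ, hball⟩ := Metric.eventually_nhds_iff_ball.mp
    ((hu.eventually (by simp)).and ((hU.eventually (by simp)).and (hle.and hpair)))
  obtain ⟨p, hp, hpe⟩ := exists_touching_mem hγ hV hop hD hu hU heq hder hle hpair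
    (Metric.ball_mem_nhds 0 hρ)
  have heqOn : Set.EqOn u U (D ∩ Metric.ball 0 ρ) := eqOn_of_touching hγ hV hop
    (hDo.inter Metric.isOpen_ball) (hDc.inter (convex_ball 0 ρ)).isPreconnected
    (fun y hy => (hball y hy.2).1) (fun y hy => (hball y hy.2).2.1)
    (fun y hy => (hball y hy.2).2.2.1 (subset_closure hy.1))
    (fun y hy => (hball y hy.2).2.2.2 (subset_closure hy.1)) hp hpe
  have hclosure : Set.EqOn u U (closure (D ∩ Metric.ball 0 ρ) ∩ Metric.ball 0 ρ) :=
    heqOn.of_subset_closure (fun y hy => (hball y hy.2).1.continuousAt.continuousWithinAt)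
      (fun y hy => (hball y hy.2).2.1.continuousAt.continuousWithinAt)
      (fun y hy => ⟨subset_closure hy, hy.2⟩) Set.inter_subset_left
  filter_upwards [Metric.ball_mem_nhds 0 hρ] with y hy hyD
  refine hclosure ⟨?_, hy⟩
  rw [Set.inter_comm]
  exact Metric.isOpen_ball.inter_closure ⟨hy, hyD⟩

end StrongMaximumPrinciple

section GraphGeometry

set_option maxSynthPendingDepth 3

section Sharp

variable {K : Type*} [NormedAddCommGroup K] [InnerProductSpace ℝ K] [FiniteDimensional ℝ K]

variable (K) in
/-- The Riesz representative of a functional. -/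
noncomputable def sharp : (K →L[ℝ] ℝ) →L[ℝ] K :=
  ((InnerProductSpace.toDual ℝ K).symm :
    (K →L[ℝ] ℝ) ≃ₗᵢ[ℝ] K).toContinuousLinearEquiv.toContinuousLinearMap

theorem inner_sharp (q : K →L[ℝ] ℝ) (x : K) : inner ℝ (sharp K q) x = q x :=
  InnerProductSpace.toDual_symm_apply (𝕜 := ℝ) (x := x) (y := q)

end Sharp

variable {E : Type*} [NormedAddCommGroup E] [InnerProductSpace ℝ E]

/-- The orthogonal complement of `v`, over which hypersurfaces are written as graphs. -/
noncomputable abbrev graphBase (v : E) : Submodule ℝ E := (ℝ ∙ v)ᗮ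

/-- The projection along `v`. -/
noncomputable abbrev graphProj (v : E) : E →L[ℝ] graphBase v :=
  (graphBase v).orthogonalProjectionOnto

theorem inner_graphBase (v : E) (y : graphBase v) : inner ℝ v (y : E) = 0 :=
  Submodule.mem_orthogonal_singleton_iff_inner_right.mp y.2

theorem graphProj_coe {v : E} (y : graphBase v) : graphProj v (y : E) = y :=
  Submodule.orthogonalProjectionOnto_mem_subspace_eq_self y

theorem graphProj_self (v : E) : graphProj v v = 0 :=
  Submodule.orthogonalProjectionOnto_orthogonalComplement_singleton_eq_zero v

theorem graphProj_add_smul {v : E} (hv : ‖v‖ = 1) (w : E) :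
    (graphProj v w : E) + (inner ℝ v w : ℝ) • v = w := by
  have h : w - (inner ℝ v w : ℝ) • v ∈ graphBase v := by
    rw [Submodule.mem_orthogonal_singleton_iff_inner_right, inner_sub_right, inner_smul_right,
      real_inner_self_eq_norm_sq, hv]
    ring
  have hproj : graphProj v w = ⟨w - (inner ℝ v w : ℝ) • v, h⟩ := by
    conv_lhs => rw [← sub_add_cancel w ((inner ℝ v w : ℝ) • v)]
    rw [map_add, map_smul, graphProj_self, smul_zero, add_zero]
    exact graphProj_coe (⟨_, h⟩ : graphBase v)
  rw [hproj]
  simp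

theorem inner_eq_graphProj {v : E} (hv : ‖v‖ = 1) (w w' : E) :
    inner ℝ w w' = inner ℝ (graphProj v w) (graphProj v w') + inner ℝ v w * inner ℝ v w' := by
  conv_lhs => rw [← graphProj_add_smul hv w, ← graphProj_add_smul hv w']
  rw [inner_add_left, inner_add_right, inner_add_right, inner_smul_left, inner_smul_left,
    inner_smul_right, inner_smul_right, real_inner_self_eq_norm_sq, hv, inner_graphBase,
    real_inner_comm v, inner_graphBase, Submodule.coe_inner]
  simp

theorem finrank_graphBase {n : ℕ} (hE : Module.finrank ℝ E = n + 1) {v : E} (hv : v ≠ 0) :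
    Module.finrank ℝ (graphBase v) = n := by
  have : Fact (Module.finrank ℝ E = n + 1) := ⟨hE⟩
  exact Submodule.finrank_orthogonal_span_singleton hv

variable [FiniteDimensional ℝ E]

/-- The gradient of `x ↦ ⟨v, x⟩ - u (π x)` when `u` has derivative `q`. -/
noncomputable def graphGrad (v : E) (q : graphBase v →L[ℝ] ℝ) : E :=
  v - (sharp (graphBase v) q : E)

theorem inner_graphGrad (v : E) (q : graphBase v →L[ℝ] ℝ) (w : E) :
    inner ℝ (graphGrad v q) w = inner ℝ v w - q (graphProj v w) := by
  rw [graphGrad, inner_sub_left, ← inner_sharp q,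
    ← Submodule.inner_orthogonalProjectionOnto_eq_of_mem_left]

theorem inner_graphGrad_self {v : E} (hv : ‖v‖ = 1) (q : graphBase v →L[ℝ] ℝ) :
    inner ℝ (graphGrad v q) v = 1 := by
  rw [inner_graphGrad, graphProj_self, map_zero, real_inner_self_eq_norm_sq, hv]
  norm_num

theorem one_le_norm_graphGrad {v : E} (hv : ‖v‖ = 1) (q : graphBase v →L[ℝ] ℝ) :
    1 ≤ ‖graphGrad v q‖ := by
  have := real_inner_le_norm (graphGrad v q) v
  rwa [inner_graphGrad_self hv, hv, mul_one] at this

theorem graphGrad_ne_zero {v : E} (hv : ‖v‖ = 1) (q : graphBase v →L[ℝ] ℝ) : graphGrad v q ≠ 0 :=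
  norm_pos_iff.mp (one_pos.trans_le (one_le_norm_graphGrad hv q))

theorem contDiff_graphGrad (v : E) : ContDiff ℝ 1 (graphGrad v) :=
  contDiff_const.sub ((graphBase v).subtypeL.contDiff.comp (sharp (graphBase v)).contDiff)

theorem hasFDerivAt_graphGrad (v : E) (q : graphBase v →L[ℝ] ℝ) :
    HasFDerivAt (graphGrad v) (-((graphBase v).subtypeL.comp (sharp (graphBase v)))) q :=
  (((graphBase v).subtypeL.comp (sharp (graphBase v))).hasFDerivAt).const_sub v

theorem graphGrad_injective (v : E) : Function.Injective (graphGrad v) := by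
  intro q q' h
  ext y
  have hq := inner_graphGrad v q y
  rw [h, inner_graphGrad, graphProj_coe] at hq
  linarith

/-- The first fundamental form of a graph with slope `q`, weighted by the area element. -/
noncomputable def graphMetric (v : E) (q : graphBase v →L[ℝ] ℝ) :
    graphBase v →L[ℝ] graphBase v →L[ℝ] ℝ :=
  ‖graphGrad v q‖ • (realInner (graphBase v) + q.smulRight q)

theorem graphMetric_apply (v : E) (q : graphBase v →L[ℝ] ℝ) (x y : graphBase v) :
    graphMetric v q x y = ‖graphGrad v q‖ * (inner ℝ x y + q x * q y) := by
  simp only [graphMetric, smul_apply, add_apply, realInner_apply,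
    ContinuousLinearMap.smulRight_apply, smul_eq_mul]

theorem contDiff_graphMetric {v : E} (hv : ‖v‖ = 1) : ContDiff ℝ 1 (graphMetric v) := by
  have hsmulRight : ContDiff ℝ 1 fun q : graphBase v →L[ℝ] ℝ => q.smulRight q :=
    (isBoundedBilinearMap_smulRight (𝕜 := ℝ) (E := graphBase v)
      (F := graphBase v →L[ℝ] ℝ)).contDiff.comp (contDiff_id.prodMk contDiff_id)
  exact ((contDiff_graphGrad v).norm ℝ (graphGrad_ne_zero hv)).smul
    (contDiff_const.add hsmulRight)

theorem norm_sq_le_graphMetric {v : E} (hv : ‖v‖ = 1) (q : graphBase v →L[ℝ] ℝ)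
    (y : graphBase v) : ‖y‖ ^ 2 ≤ graphMetric v q y y := by
  rw [graphMetric_apply, real_inner_self_eq_norm_sq]
  nlinarith [one_le_norm_graphGrad hv q, sq_nonneg ‖y‖, mul_self_nonneg (q y)]

/-- The upward unit normal of a graph with slope `q`. -/
noncomputable def graphNormal (v : E) (q : graphBase v →L[ℝ] ℝ) : E :=
  ‖graphGrad v q‖⁻¹ • graphGrad v q

theorem contDiff_graphNormal {v : E} (hv : ‖v‖ = 1) : ContDiff ℝ 1 (graphNormal v) :=
  (((contDiff_graphGrad v).norm ℝ (graphGrad_ne_zero hv)).inv fun q =>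
    norm_ne_zero_iff.mpr (graphGrad_ne_zero hv q)).smul (contDiff_graphGrad v)

theorem inner_fderiv_graphNormal {v w : E} (hv : ‖v‖ = 1) {q : graphBase v →L[ℝ] ℝ}
    (hw : inner ℝ (graphGrad v q) w = 0) (q' : graphBase v →L[ℝ] ℝ) :
    inner ℝ (fderiv ℝ (graphNormal v) q q') w = -(‖graphGrad v q‖⁻¹ * q' (graphProj v w)) := by
  have hne := graphGrad_ne_zero hv q
  have hinv : DifferentiableAt ℝ (fun q => ‖graphGrad v q‖⁻¹) q :=
    ((hasFDerivAt_graphGrad v q).differentiableAt.norm ℝ hne).inv (norm_ne_zero_iff.mpr hne)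
  have hfderiv := (hinv.hasFDerivAt.smul (hasFDerivAt_graphGrad v q)).fderiv
  change fderiv ℝ (graphNormal v) q = _ at hfderiv
  rw [hfderiv]
  simp only [add_apply, smul_apply, ContinuousLinearMap.smulRight_apply,
    ContinuousLinearMap.comp_apply, neg_apply, inner_add_left, inner_smul_left, inner_neg_left, hw,
    Submodule.subtypeL_apply]
  rw [← Submodule.inner_orthogonalProjectionOnto_eq_of_mem_left, inner_sharp]
  simp

/-- The component along `e` of the upward unit normal of a graph with slope `q`. -/
noncomputable def graphTilt (v e : E) (q : graphBase v →L[ℝ] ℝ) : ℝ :=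
  inner ℝ (graphNormal v q) e

theorem isCurvatureOperator_graph {v : E} (hv : ‖v‖ = 1) (e : E) :
    IsCurvatureOperator (graphMetric v) (graphTilt v e) :=
  ⟨contDiff_graphMetric hv, (contDiff_graphNormal hv).inner ℝ contDiff_const,
    norm_sq_le_graphMetric hv⟩

theorem exists_implicit_function {K : Type*} [NormedAddCommGroup K] [NormedSpace ℝ K]
    [CompleteSpace K] {F : K × ℝ → ℝ} (hF : ContDiffAt ℝ 2 F (0, 0)) (hF0 : F (0, 0) = 0)
    (hF1 : fderiv ℝ F (0, 0) (0, 1) ≠ 0) :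
    ∃ u : K → ℝ, ContDiffAt ℝ 2 u 0 ∧ u 0 = 0 ∧
      ∀ᶠ z in 𝓝 ((0, 0) : K × ℝ), F z = 0 ↔ z.2 = u z.1 := by
  have hinv : (fderiv ℝ F (0, 0) ∘L ContinuousLinearMap.inr ℝ K ℝ).IsInvertible := by
    refine ⟨ContinuousLinearEquiv.unitsEquivAut ℝ (Units.mk0 _ hF1), ?_⟩
    ext
    simp
  have h20 : (2 : ℕ∞ω) ≠ 0 := by simp
  refine ⟨hF.implicitFunction h20 hinv, hF.contDiffAt_implicitFunction h20 hinv,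
    hF.implicitFunction_apply_self h20 hinv, ?_⟩
  filter_upwards [hF.eventually_apply_eq_iff_implicitFunction h20 hinv] with z hz
  exact (Iff.of_eq (congrArg _ hF0.symm)).trans (hz.trans eq_comm)

theorem exists_graph_of_regular {f : E → ℝ} {p v : E} (hv : ‖v‖ = 1) (hf : ContDiffAt ℝ 2 f p)
    (hfp : f p = 0) (hfv : fderiv ℝ f p v ≠ 0) :
    ∃ u : graphBase v → ℝ, ContDiffAt ℝ 2 u 0 ∧ u 0 = 0 ∧
      ∀ᶠ x in 𝓝 p, f x = 0 ↔ inner ℝ v (x - p) = u (graphProj v (x - p)) := by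
  let L : graphBase v × ℝ →L[ℝ] E :=
    (graphBase v).subtypeL.coprod (ContinuousLinearMap.toSpanSingleton ℝ v)
  have hL : ∀ y t, L (y, t) = (y : E) + t • v := fun y t => by simp [L]
  have hp : p + L (0, 0) = p := by simp [hL]
  have hF : ContDiffAt ℝ 2 (fun z => f (p + L z)) (0, 0) :=
    ContDiffAt.comp (0, 0) (hp.symm ▸ hf) (contDiff_const.add L.contDiff).contDiffAt
  have hFd : HasFDerivAt (fun z => f (p + L z)) ((fderiv ℝ f p).comp L) (0, 0) := by
    have hfd : HasFDerivAt f (fderiv ℝ f p) (p + L (0, 0)) := by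
      rw [hp]
      exact (hf.differentiableAt (by simp)).hasFDerivAt
    exact hfd.comp (0, 0) (L.hasFDerivAt.const_add p)
  obtain ⟨u, hu, hu0, hFu⟩ := exists_implicit_function hF (hp.symm ▸ hfp)
    (by
    rw [hFd.fderiv]
    simpa [hL] using hfv)
  refine ⟨u, hu, hu0, ?_⟩
  have hcoord : Filter.Tendsto (fun x => (graphProj v (x - p), inner ℝ v (x - p))) (𝓝 p)
      (𝓝 ((0, 0) : graphBase v × ℝ)) := by
    have : ContinuousAt (fun x => (graphProj v (x - p), inner ℝ v (x - p))) p := by fun_prop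
    simpa [ContinuousAt] using this
  filter_upwards [hcoord.eventually hFu] with x hx
  simpa only [hL, graphProj_add_smul hv (x - p), add_sub_cancel] using hx

end GraphGeometry

section CurvatureOfGraphs

set_option maxSynthPendingDepth 3

variable {n : ℕ} {M : Set (Ambient n)} {ν : Ambient n → Ambient n} {p v x g : Ambient n}
  {l : Fin n → ℝ}

/-- The direction of translation. -/
noncomputable abbrev upward (n : ℕ) : Ambient n := EuclideanSpace.single (Fin.last n) 1

theorem tangentSpaceAt_le_orthogonal {F : Ambient n → ℝ} (hF : HasFDerivAt F (innerSL ℝ g) x)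
    (hx : x ∈ M) (hM : ∀ᶠ z in 𝓝 x, z ∈ M → F z = 0) : tangentSpaceAt M x ≤ (ℝ ∙ g)ᗮ := by
  have hconst : HasFDerivWithinAt F (0 : Ambient n →L[ℝ] ℝ) M x :=
    (hasFDerivWithinAt_const (0 : ℝ) x M).congr_of_eventuallyEq
      (eventually_nhdsWithin_iff.mpr hM) (hM.self_of_nhds hx)
  refine Submodule.span_le.mpr fun y hy => ?_
  rw [SetLike.mem_coe, Submodule.mem_orthogonal_singleton_iff_inner_right]
  exact hF.hasFDerivWithinAt.unique_on hconst hy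

theorem IsPrincipalCurvatures.tangentSpaceAt_eq_orthogonal (hl : IsPrincipalCurvatures M ν x l)
    (hg : g ≠ 0) {F : Ambient n → ℝ} (hF : HasFDerivAt F (innerSL ℝ g) x) (hx : x ∈ M)
    (hM : ∀ᶠ z in 𝓝 x, z ∈ M → F z = 0) : tangentSpaceAt M x = (ℝ ∙ g)ᗮ := by
  obtain ⟨A, e, -, he, heT, -⟩ := hl
  refine Submodule.eq_of_le_of_finrank_le (tangentSpaceAt_le_orthogonal hF hx hM) ?_
  have hrank : Module.finrank ℝ (ℝ ∙ g)ᗮ = n := finrank_graphBase (by simp) hg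
  have hind : LinearIndependent ℝ fun i => (⟨e i, heT i⟩ : tangentSpaceAt M x) :=
    LinearIndependent.of_comp (tangentSpaceAt M x).subtype he.linearIndependent
  rw [hrank]
  simpa using hind.fintype_card_le_finrank

section GraphFun

variable {E : Type*} [NormedAddCommGroup E] [InnerProductSpace ℝ E]

theorem eq_smul_of_mem_orthogonal {g ν e : E} (hν : ‖ν‖ = 1) (hmem : ν ∈ (ℝ ∙ g)ᗮᗮ)
    (hνe : 0 ≤ inner ℝ ν e) (hge : 0 < inner ℝ g e) : ν = ‖g‖⁻¹ • g := by
  rw [Submodule.orthogonal_orthogonal, Submodule.mem_span_singleton] at hmem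
  obtain ⟨c, rfl⟩ := hmem
  have hc : 0 ≤ c := by
    rw [real_inner_smul_left] at hνe
    exact nonneg_of_mul_nonneg_left hνe hge
  rw [norm_smul, Real.norm_of_nonneg hc] at hν
  rw [eq_inv_of_mul_eq_one_left hν]

/-- The defining function of the graph of `u`, based at `p`, in the direction `v`. -/
noncomputable def graphFun (p v : E) (u : graphBase v → ℝ) (x : E) : ℝ :=
  inner ℝ v (x - p) - u (graphProj v (x - p))

theorem hasFDerivAt_graphFun [FiniteDimensional ℝ E] {p v x : E} {u : graphBase v → ℝ}
    (hu : DifferentiableAt ℝ u (graphProj v (x - p))) :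
    HasFDerivAt (graphFun p v u)
      (innerSL ℝ (graphGrad v (fderiv ℝ u (graphProj v (x - p))))) x := by
  have hsub : HasFDerivAt (fun x => x - p) (ContinuousLinearMap.id ℝ E) x :=
    (hasFDerivAt_id x).sub_const p
  have hheight : HasFDerivAt (fun x => inner ℝ v (x - p)) (realInner E v) x :=
    (realInner E v).hasFDerivAt.comp x hsub
  have hgraph : HasFDerivAt (fun x => u (graphProj v (x - p)))
      ((fderiv ℝ u (graphProj v (x - p))).comp (graphProj v)) x :=
    hu.hasFDerivAt.comp x ((graphProj v).hasFDerivAt.comp x hsub)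
  refine (hheight.sub hgraph).congr_fderiv (ContinuousLinearMap.ext fun w => ?_)
  exact (inner_graphGrad v _ w).symm

end GraphFun

theorem inner_weingarten_of_graph {u : graphBase v → ℝ} {A : Ambient n →L[ℝ] Ambient n}
    (hv : ‖v‖ = 1) (hA : HasFDerivWithinAt ν A M x) (hx : x ∈ M)
    (hu : ContDiffAt ℝ 2 u (graphProj v (x - p)))
    (hT : tangentSpaceAt M x ≤ (ℝ ∙ graphGrad v (fderiv ℝ u (graphProj v (x - p))))ᗮ)
    (hν : ∀ᶠ z in 𝓝 x, z ∈ M → ν z = graphNormal v (fderiv ℝ u (graphProj v (z - p))))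
    {w w' : Ambient n} (hw : w ∈ tangentSpaceAt M x) (hw' : w' ∈ tangentSpaceAt M x) :
    inner ℝ (A w) w' = -(‖graphGrad v (fderiv ℝ u (graphProj v (x - p)))‖⁻¹ *
      fderiv ℝ (fderiv ℝ u) (graphProj v (x - p)) (graphProj v w) (graphProj v w')) := by
  have hproj : HasFDerivAt (fun z => graphProj v (z - p)) (graphProj v) x :=
    (graphProj v).hasFDerivAt.comp x ((hasFDerivAt_id x).sub_const p)
  have hslope : HasFDerivAt (fun z => fderiv ℝ u (graphProj v (z - p)))
      ((fderiv ℝ (fderiv ℝ u) (graphProj v (x - p))).comp (graphProj v)) x :=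
    HasFDerivAt.comp (g := fderiv ℝ u) (f := fun z => graphProj v (z - p)) x
      (hasFDerivAt_fderiv hu) hproj
  have hnormal := ((contDiff_graphNormal hv).differentiable (by simp) _).hasFDerivAt.comp x hslope
  have hAw : A w = fderiv ℝ (graphNormal v) (fderiv ℝ u (graphProj v (x - p)))
      (fderiv ℝ (fderiv ℝ u) (graphProj v (x - p)) (graphProj v w)) :=
    LinearMap.eqOn_span (f := (A : Ambient n →ₗ[ℝ] Ambient n))
      (hA.unique_on (hnormal.hasFDerivWithinAt.congr_of_eventuallyEq
        (eventually_nhdsWithin_iff.mpr hν) (hν.self_of_nhds hx))) hw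
  rw [hAw, inner_fderiv_graphNormal hv
    (Submodule.mem_orthogonal_singleton_iff_inner_right.mp (hT hw'))]

theorem isOrthonormalFor_graphMetric {q : graphBase v →L[ℝ] ℝ} (hv : ‖v‖ = 1)
    {e : Fin n → Ambient n} (he : Orthonormal ℝ e) (heT : ∀ i, e i ∈ (ℝ ∙ graphGrad v q)ᗮ) :
    IsOrthonormalFor (graphMetric v q)
      fun i => (√‖graphGrad v q‖)⁻¹ • graphProj v (e i) := by
  have hg : 0 < ‖graphGrad v q‖ := norm_pos_iff.mpr (graphGrad_ne_zero hv q)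
  have hslope : ∀ i, q (graphProj v (e i)) = inner ℝ v (e i) := fun i => by
    have := inner_graphGrad v q (e i)
    rw [Submodule.mem_orthogonal_singleton_iff_inner_right.mp (heT i)] at this
    linarith
  intro i j
  rw [← orthonormal_iff_ite.mp he i j, inner_eq_graphProj hv (e i) (e j), map_smul, map_smul,
    smul_apply, graphMetric_apply, hslope, hslope, smul_eq_mul, smul_eq_mul, ← mul_assoc,
    ← mul_assoc, ← mul_inv, Real.mul_self_sqrt hg.le, inv_mul_cancel₀ hg.ne', one_mul]

theorem IsPrincipalCurvatures.hasRelEigenvalues {u : graphBase v → ℝ} (hv : ‖v‖ = 1)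
    (hl : IsPrincipalCurvatures M ν x l) (hx : x ∈ M)
    (hu : ContDiffAt ℝ 2 u (graphProj v (x - p)))
    (hT : tangentSpaceAt M x ≤ (ℝ ∙ graphGrad v (fderiv ℝ u (graphProj v (x - p))))ᗮ)
    (hν : ∀ᶠ z in 𝓝 x, z ∈ M → ν z = graphNormal v (fderiv ℝ u (graphProj v (z - p)))) :
    HasRelEigenvalues (graphMetric v (fderiv ℝ u (graphProj v (x - p))))
      (fderiv ℝ (fderiv ℝ u) (graphProj v (x - p))) l := by
  obtain ⟨A, e, hA, he, heT, hAe⟩ := hl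
  refine ⟨_, isOrthonormalFor_graphMetric hv he fun i => hT (heT i), fun i j => ?_⟩
  have hshape := inner_weingarten_of_graph hv hA hx hu hT hν (heT i) (heT j)
  rw [hAe i, inner_neg_left, neg_inj, real_inner_smul_left, orthonormal_iff_ite.mp he i j] at hshape
  rw [map_smul, map_smul, smul_apply, smul_eq_mul, smul_eq_mul, ← mul_assoc, ← mul_inv,
    Real.mul_self_sqrt (norm_nonneg _), ← hshape, mul_ite, mul_one, mul_zero]

end CurvatureOfGraphs

section LocalCoincidence

set_option maxSynthPendingDepth 3

section GraphPoint

variable {E : Type*} [NormedAddCommGroup E] [InnerProductSpace ℝ E] {p v x : E}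
  {u : graphBase v → ℝ}

/-- The point over `y` of the graph of `u`, based at `p`, in the direction `v`. -/
noncomputable def graphPoint (p v : E) (u : graphBase v → ℝ) (y : graphBase v) : E :=
  p + ((y : E) + u y • v)

theorem graphPoint_zero (hu : u 0 = 0) : graphPoint p v u 0 = p := by
  simp [graphPoint, hu]

theorem graphProj_graphPoint (y : graphBase v) : graphProj v (graphPoint p v u y - p) = y := by
  rw [graphPoint, add_sub_cancel_left, map_add, map_smul, graphProj_self, smul_zero, add_zero]
  exact graphProj_coe y

theorem graphFun_graphPoint (hv : ‖v‖ = 1) (y : graphBase v) :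
    graphFun p v u (graphPoint p v u y) = 0 := by
  rw [graphFun, graphProj_graphPoint, graphPoint, add_sub_cancel_left, inner_add_right,
    inner_graphBase, inner_smul_right, real_inner_self_eq_norm_sq, hv]
  simp

theorem graphPoint_of_graphFun_eq_zero (hv : ‖v‖ = 1) (h : graphFun p v u x = 0) :
    graphPoint p v u (graphProj v (x - p)) = x := by
  rw [graphFun, sub_eq_zero] at h
  rw [graphPoint, ← h, graphProj_add_smul hv, add_sub_cancel]

theorem continuousAt_graphPoint {y : graphBase v} (hu : ContinuousAt u y) :
    ContinuousAt (graphPoint p v u) y :=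
  continuousAt_const.add (continuous_subtype_val.continuousAt.add (hu.smul continuousAt_const))

theorem tendsto_graphPoint (hu : ContinuousAt u 0) (h0 : u 0 = 0) :
    Filter.Tendsto (graphPoint p v u) (𝓝 0) (𝓝 p) := by
  simpa only [ContinuousAt, graphPoint_zero h0] using continuousAt_graphPoint (p := p) hu

theorem tendsto_graphProj (p v : E) :
    Filter.Tendsto (fun x => graphProj v (x - p)) (𝓝 p) (𝓝 0) := by
  have : ContinuousAt (fun x => graphProj v (x - p)) p := by fun_prop
  simpa only [ContinuousAt, sub_self, map_zero] using this

/-- Near `p`, the set `M` is the graph of `u` in the direction `v` over the closure of `D`. -/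
structure IsGraphNear (M : Set E) (p v : E) (u : graphBase v → ℝ) (D : Set (graphBase v)) :
    Prop where
  contDiffAt : ContDiffAt ℝ 2 u 0
  map_zero : u 0 = 0
  mem_iff : ∀ᶠ x in 𝓝 p, x ∈ M ↔ graphProj v (x - p) ∈ closure D ∧ graphFun p v u x = 0

namespace IsGraphNear

variable {M M₁ M₂ : Set E} {u₁ u₂ : graphBase v → ℝ} {D : Set (graphBase v)}

theorem tendsto_graphPoint (hg : IsGraphNear M p v u D) :
    Filter.Tendsto (graphPoint p v u) (𝓝 0) (𝓝 p) :=
  _root_.tendsto_graphPoint hg.contDiffAt.continuousAt hg.map_zero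

theorem graphFun_eq_zero (hg : IsGraphNear M p v u D) :
    ∀ᶠ x in 𝓝 p, x ∈ M → graphFun p v u x = 0 :=
  hg.mem_iff.mono fun _ hx hxM => (hx.mp hxM).2

theorem graphPoint_mem (hv : ‖v‖ = 1) (hg : IsGraphNear M p v u D) :
    ∀ᶠ y in 𝓝 0, y ∈ closure D → graphPoint p v u y ∈ M := by
  filter_upwards [hg.tendsto_graphPoint.eventually hg.mem_iff] with y hy hyD
  exact hy.mpr ⟨by rwa [graphProj_graphPoint], graphFun_graphPoint hv y⟩

theorem eventually_mem_iff_mem (hg₁ : IsGraphNear M₁ p v u₁ D) (hg₂ : IsGraphNear M₂ p v u₂ D)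
    (heq : ∀ᶠ y in 𝓝 0, y ∈ closure D → u₁ y = u₂ y) : ∀ᶠ x in 𝓝 p, x ∈ M₁ ↔ x ∈ M₂ := by
  filter_upwards [hg₁.mem_iff, hg₂.mem_iff, (tendsto_graphProj p v).eventually heq]
    with x hx₁ hx₂ hx
  rw [hx₁, hx₂]
  refine and_congr_right fun hxD => ?_
  rw [graphFun, graphFun, hx hxD]

end IsGraphNear

theorem nonpos_of_hasStrictFDerivAt {E : Type*} [NormedAddCommGroup E] [NormedSpace ℝ E]
    {f : E → ℝ} {f' : E →L[ℝ] ℝ} {p v : E} (hf : HasStrictFDerivAt f f' p) (hv : 0 < f' v) :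
    ∀ᶠ q in 𝓝 (p, p), ∀ t : ℝ, q.1 - q.2 = t • v → f q.1 ≤ f q.2 → t ≤ 0 := by
  have hv0 : 0 < ‖v‖ := norm_pos_iff.mpr fun h => by simp [h] at hv
  filter_upwards [hf.isLittleO.bound (show 0 < f' v / (2 * ‖v‖) by positivity)] with q hq t ht hle
  rw [ht, map_smul, smul_eq_mul, norm_smul, Real.norm_eq_abs, Real.norm_eq_abs] at hq
  have hhalf : f' v / (2 * ‖v‖) * (|t| * ‖v‖) = f' v * |t| / 2 := by field_simp
  by_contra! hpos
  rw [hhalf, abs_of_pos hpos] at hq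
  nlinarith [(abs_le.mp hq).1]

theorem IsGraphNear.ordered {M₁ M₂ : Set E} {u₁ u₂ : graphBase v → ℝ} {D : Set (graphBase v)}
    (hv : ‖v‖ = 1) (hg₁ : IsGraphNear M₁ p v u₁ D) (hg₂ : IsGraphNear M₂ p v u₂ D) {f : E → ℝ}
    {f' : E →L[ℝ] ℝ} (hf : HasStrictFDerivAt f f' p) (hfv : f' v ≠ 0)
    (hf₁ : ∀ᶠ x in 𝓝 p, x ∈ M₁ → 0 ≤ f x) (hf₂ : ∀ᶠ x in 𝓝 p, x ∈ M₂ → f x = 0) :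
    (∀ᶠ y in 𝓝 0, y ∈ closure D → u₁ y ≤ u₂ y) ∨ ∀ᶠ y in 𝓝 0, y ∈ closure D → u₂ y ≤ u₁ y := by
  have hsub (w₁ w₂ : graphBase v → ℝ) (y : graphBase v) :
      graphPoint p v w₁ y - graphPoint p v w₂ y = (w₁ y - w₂ y) • v := by
    simp only [graphPoint]
    module
  have hvalues : ∀ᶠ y in 𝓝 0, y ∈ closure D →
      0 ≤ f (graphPoint p v u₁ y) ∧ f (graphPoint p v u₂ y) = 0 := by
    filter_upwards [hg₁.graphPoint_mem hv, hg₂.graphPoint_mem hv,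
      hg₁.tendsto_graphPoint.eventually hf₁, hg₂.tendsto_graphPoint.eventually hf₂]
      with y hy₁ hy₂ hf₁ hf₂ hyD using ⟨hf₁ (hy₁ hyD), hf₂ (hy₂ hyD)⟩
  rcases hfv.lt_or_gt with hneg | hpos
  · left
    have hmono := nonpos_of_hasStrictFDerivAt hf.neg (v := v) (by simpa using hneg)
    filter_upwards [hvalues,
      (hg₁.tendsto_graphPoint.prodMk_nhds hg₂.tendsto_graphPoint).eventually hmono] with y hy hm hyD
    exact sub_nonpos.mp (hm _ (hsub u₁ u₂ y) (by simp [hy hyD]))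
  · right
    filter_upwards [hvalues, (hg₂.tendsto_graphPoint.prodMk_nhds hg₁.tendsto_graphPoint).eventually
      (nonpos_of_hasStrictFDerivAt hf hpos)] with y hy hm hyD
    exact sub_nonpos.mp (hm _ (hsub u₂ u₁ y) ((hy hyD).2.trans_le (hy hyD).1))

end GraphPoint

variable {n : ℕ} {Γ : Set (Fin n → ℝ)} {γ : (Fin n → ℝ) → ℝ} {M M₁ M₂ : Set (Ambient n)}
  {ν ν₁ ν₂ : Ambient n → Ambient n} {p v : Ambient n} {u u₁ u₂ : graphBase v → ℝ}
  {D : Set (graphBase v)}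

theorem IsStrictlyConvexHyp.isConvexHyp (h : IsStrictlyConvexHyp M ν) : IsConvexHyp M ν :=
  fun q hq l hl => subset_closure (h q hq l hl)

namespace IsGraphNear

theorem eventually_contDiffAt_and_upward (hg : IsGraphNear M p v u D)
    (hup : 0 < inner ℝ (graphGrad v (fderiv ℝ u 0)) (upward n)) :
    ∀ᶠ x in 𝓝 p, ContDiffAt ℝ 2 u (graphProj v (x - p)) ∧
      0 < inner ℝ (graphGrad v (fderiv ℝ u (graphProj v (x - p)))) (upward n) := by
  have hslope : ContinuousAt (fderiv ℝ u) 0 :=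
    (hg.contDiffAt.fderiv_right (m := 0) (by norm_num)).continuousAt
  have hgrad : ContinuousAt (fun y => graphGrad v (fderiv ℝ u y)) 0 :=
    (contDiff_graphGrad v).continuous.continuousAt.comp hslope
  exact (tendsto_graphProj p v).eventually ((hg.contDiffAt.eventually (by simp)).and
    ((hgrad.inner continuousAt_const).eventually (lt_mem_nhds hup)))

theorem eventually_tangentSpaceAt_le_and_normal_eq (hγ : IsEllipticSpeed Γ γ)
    (hM : IsTranslator Γ γ M ν) (hv : ‖v‖ = 1) (hg : IsGraphNear M p v u D)
    (hup : 0 < inner ℝ (graphGrad v (fderiv ℝ u 0)) (upward n)) :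
    ∀ᶠ x in 𝓝 p, x ∈ M →
      tangentSpaceAt M x ≤ (ℝ ∙ graphGrad v (fderiv ℝ u (graphProj v (x - p))))ᗮ ∧
      ν x = graphNormal v (fderiv ℝ u (graphProj v (x - p))) := by
  filter_upwards [hg.eventually_contDiffAt_and_upward hup, hg.graphFun_eq_zero.eventually_nhds]
    with x ⟨hu, hpos⟩ hzero hxM
  obtain ⟨l, hlΓ, hl, hleq⟩ := hM.equation x hxM
  have hT := hl.tangentSpaceAt_eq_orthogonal (graphGrad_ne_zero hv _)
    (hasFDerivAt_graphFun (hu.differentiableAt (by simp))) hxM hzero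
  obtain ⟨hν, hνT⟩ := hM.normal.2 x hxM
  refine ⟨hT.le, eq_smul_of_mem_orthogonal hν (by rwa [hT] at hνT) ?_ hpos⟩
  rw [← hleq]
  exact hγ.nonneg hlΓ

theorem eventually_solvesAt (hγ : IsEllipticSpeed Γ γ) (hM : IsTranslator Γ γ M ν)
    (hconv : IsConvexHyp M ν) (hv : ‖v‖ = 1) (hg : IsGraphNear M p v u D)
    (hup : 0 < inner ℝ (graphGrad v (fderiv ℝ u 0)) (upward n)) :
    ∀ᶠ y in 𝓝 0, y ∈ closure D → ∃ q ∈ M, ∃ l, IsPrincipalCurvatures M ν q l ∧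
      SolvesAt Γ γ (graphMetric v) (graphTilt v (upward n)) u y l := by
  have hsolves : ∀ᶠ x in 𝓝 p, x ∈ M → ∃ l, IsPrincipalCurvatures M ν x l ∧
      SolvesAt Γ γ (graphMetric v) (graphTilt v (upward n)) u (graphProj v (x - p)) l := by
    filter_upwards [hg.eventually_contDiffAt_and_upward hup,
      (hg.eventually_tangentSpaceAt_le_and_normal_eq hγ hM hv hup).eventually_nhds]
      with x ⟨hu, hpos⟩ hnormal hxM
    obtain ⟨l, hlΓ, hl, hleq⟩ := hM.equation x hxM
    obtain ⟨hT, hν⟩ := hnormal.self_of_nhds hxM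
    have heq : γ l = graphTilt v (upward n) (fderiv ℝ u (graphProj v (x - p))) := by
      rw [hleq, hν, graphTilt]
    have htilt : 0 < graphTilt v (upward n) (fderiv ℝ u (graphProj v (x - p))) := by
      rw [graphTilt, graphNormal, real_inner_smul_left]
      exact mul_pos (inv_pos.mpr (norm_pos_iff.mpr (graphGrad_ne_zero hv _))) hpos
    have hnonneg : ∀ i, 0 ≤ l i := by
      simpa only [closure_positiveCone, Set.mem_ofPred_eq] using hconv x hxM l hl
    exact ⟨l, hl, ⟨hγ.mem_of_pos hlΓ (heq.symm ▸ htilt), hnonneg⟩,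
      hl.hasRelEigenvalues hv hxM hu hT (hnormal.mono fun z hz hzM => (hz hzM).2), heq⟩
  filter_upwards [hg.tendsto_graphPoint.eventually hsolves, hg.graphPoint_mem hv] with y hy hyM hyD
  obtain ⟨l, hl, hs⟩ := hy (hyM hyD)
  exact ⟨_, hyM hyD, l, hl, by rwa [graphProj_graphPoint] at hs⟩

end IsGraphNear

theorem eventually_mem_iff_of_isGraphNear (hγ : IsEllipticSpeed Γ γ)
    (h₁ : IsTranslator Γ γ M₁ ν₁) (h₂ : IsTranslator Γ γ M₂ ν₂)
    (hconv₁ : IsStrictlyConvexHyp M₁ ν₁) (hconv₂ : IsConvexHyp M₂ ν₂) (hv : ‖v‖ = 1)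
    (hg₁ : IsGraphNear M₁ p v u₁ D) (hg₂ : IsGraphNear M₂ p v u₂ D)
    (hup : 0 < inner ℝ (graphGrad v (fderiv ℝ u₁ 0)) (upward n))
    (hder : fderiv ℝ u₁ 0 = fderiv ℝ u₂ 0) (hDo : IsOpen D) (hDc : Convex ℝ D)
    (hD : HasInteriorBallAtZero D)
    (hle : (∀ᶠ y in 𝓝 0, y ∈ closure D → u₁ y ≤ u₂ y) ∨
      ∀ᶠ y in 𝓝 0, y ∈ closure D → u₂ y ≤ u₁ y) :
    ∀ᶠ x in 𝓝 p, x ∈ M₁ ↔ x ∈ M₂ := by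
  have hrank : Module.finrank ℝ (graphBase v) = n :=
    finrank_graphBase (by simp) (norm_ne_zero_iff.mp (by rw [hv]; exact one_ne_zero))
  have hop := isCurvatureOperator_graph hv (upward n)
  have heq : u₁ 0 = u₂ 0 := hg₁.map_zero.trans hg₂.map_zero.symm
  have hpair : ∀ᶠ y in 𝓝 0, y ∈ closure D →
      SolvePairAt Γ γ (graphMetric v) (graphTilt v (upward n)) u₁ u₂ y := by
    filter_upwards [hg₁.eventually_solvesAt hγ h₁ hconv₁.isConvexHyp hv hup,
      hg₂.eventually_solvesAt hγ h₂ hconv₂ hv (hder ▸ hup)] with y hy₁ hy₂ hyD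
    obtain ⟨q, hq, l₁, hl₁, hs₁⟩ := hy₁ hyD
    obtain ⟨-, -, l₂, -, hs₂⟩ := hy₂ hyD
    exact ⟨l₁, l₂, hs₁, hs₂, Or.inl (hconv₁ q hq l₁ hl₁)⟩
  rcases hle with hle | hle
  · exact hg₁.eventually_mem_iff_mem hg₂ (eventually_eq_of_touching hγ hrank hop hDo hDc hD
      hg₁.contDiffAt hg₂.contDiffAt heq hder.symm hle hpair)
  · exact (hg₂.eventually_mem_iff_mem hg₁ (eventually_eq_of_touching hγ hrank hop hDo hDc hD
      hg₂.contDiffAt hg₁.contDiffAt heq.symm hder hle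
      (hpair.mono fun y hy hyD => (hy hyD).symm))).mono fun _ => Iff.symm

end LocalCoincidence

section HalfSpace

variable {V : Type*} [NormedAddCommGroup V] [NormedSpace ℝ V] {ℓ : V →L[ℝ] ℝ} {G : V → ℝ}

theorem closure_setOf_map_pos (hℓ : ℓ ≠ 0) : closure {y | 0 < ℓ y} = {y | 0 ≤ ℓ y} :=
  ((ContinuousLinearMap.isOpenMap_of_ne_zero ℓ hℓ).preimage_closure_eq_closure_preimage
    ℓ.continuous (Set.Ioi 0)).symm.trans (congrArg (ℓ ⁻¹' ·) (closure_Ioi 0))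

theorem interior_setOf_map_nonneg (hℓ : ℓ ≠ 0) : interior {y | 0 ≤ ℓ y} = {y | 0 < ℓ y} :=
  ((ContinuousLinearMap.isOpenMap_of_ne_zero ℓ hℓ).preimage_interior_eq_interior_preimage
    ℓ.continuous (Set.Ici 0)).symm.trans (congrArg (ℓ ⁻¹' ·) interior_Ici)

theorem pos_of_ne_zero_of_isPreconnected {X : Type*} [TopologicalSpace X] {S : Set X} {G : X → ℝ}
    (hS : IsPreconnected S) (hG : ContinuousOn G S) (hne : ∀ z ∈ S, G z ≠ 0) {y : X} (hy : y ∈ S)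
    (hpos : 0 < G y) {z : X} (hz : z ∈ S) : 0 < G z := by
  by_contra! hneg
  obtain ⟨x, hx, hx0⟩ := hS.intermediate_value hz hy hG ⟨hneg, hpos.le⟩
  exact hne x hx hx0

theorem eventually_nonneg_iff {G' : V →L[ℝ] ℝ} (hℓ : ℓ ≠ 0) (hG : HasFDerivAt G G' 0)
    (hG' : G' ≠ 0) (hG0 : G 0 = 0) (hcont : ∀ᶠ y in 𝓝 0, ContinuousAt G y)
    (hzero : ∀ᶠ y in 𝓝 0, G y = 0 → ℓ y = 0) (hnonneg : ∀ᶠ y in 𝓝 0, 0 ≤ G y → 0 ≤ ℓ y) :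
    ∀ᶠ y in 𝓝 0, 0 ≤ G y ↔ 0 ≤ ℓ y := by
  obtain ⟨ρ, hρ, hball⟩ := Metric.eventually_nhds_iff_ball.mp (hcont.and (hzero.and hnonneg))
  have hcontOn : ContinuousOn G (Metric.ball 0 ρ) := fun y hy =>
    (hball y hy).1.continuousWithinAt
  obtain ⟨y₁, hy₁, hGy₁⟩ : ∃ y ∈ Metric.ball 0 ρ, 0 < G y := by
    by_contra! hle
    have hmax : IsLocalMax G 0 := by
      filter_upwards [Metric.ball_mem_nhds 0 hρ] with y hy using hG0.symm ▸ hle y hy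
    exact hG' (hmax.hasFDerivAt_eq_zero hG)
  have hℓy₁ : 0 < ℓ y₁ := by
    have hopen : IsOpen (Metric.ball 0 ρ ∩ G ⁻¹' Set.Ioi 0) :=
      hcontOn.isOpen_inter_preimage Metric.isOpen_ball isOpen_Ioi
    have hsub : Metric.ball 0 ρ ∩ G ⁻¹' Set.Ioi 0 ⊆ {y | 0 ≤ ℓ y} := fun y hy =>
      (hball y hy.1).2.2 (le_of_lt hy.2)
    exact (interior_setOf_map_nonneg hℓ).subset (interior_maximal hsub hopen ⟨hy₁, hGy₁⟩)
  set S : Set V := Metric.ball 0 ρ ∩ {y | 0 < ℓ y}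
  have hS : IsPreconnected S := ((convex_ball 0 ρ).inter
    (convex_halfSpace_gt ℓ.toLinearMap.isLinear 0)).isPreconnected
  have hpos : ∀ y ∈ S, 0 ≤ G y := fun y hy =>
    (pos_of_ne_zero_of_isPreconnected hS (hcontOn.mono Set.inter_subset_left)
      (fun z hz hz0 => hz.2.ne' ((hball z hz.1).2.1 hz0)) ⟨hy₁, hℓy₁⟩ hGy₁ hy).le
  filter_upwards [Metric.ball_mem_nhds 0 hρ] with y hy
  refine ⟨(hball y hy).2.2, fun hℓy => ?_⟩
  have hyS : y ∈ closure S :=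
    Metric.isOpen_ball.inter_closure ⟨hy, (closure_setOf_map_pos hℓ).symm.subset hℓy⟩
  exact closure_minimal (Set.image_subset_iff.mpr hpos) isClosed_Ici
    ((hball y hy).1.continuousWithinAt.mem_closure_image hyS)

theorem hasInteriorBallAtZero_halfSpace {V : Type*} [NormedAddCommGroup V]
    [InnerProductSpace ℝ V] {a : V} (ha : a ≠ 0) :
    HasInteriorBallAtZero {y : V | 0 < inner ℝ a y} := by
  refine Or.inr ⟨a, ha, fun z ⟨hz, hz0⟩ => ?_⟩
  have hle : ‖z - a‖ ^ 2 ≤ ‖a‖ ^ 2 := by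
    gcongr
    exact mem_closedBall_iff_norm.mp hz
  rw [norm_sub_sq_real, real_inner_comm] at hle
  have hpos : 0 < ‖z‖ ^ 2 := pow_pos (norm_pos_iff.mpr hz0) 2
  exact (by linarith : 0 < inner ℝ a z)

end HalfSpace

section DefiningFunctions

variable {n : ℕ} {M M₁ M₂ : Set (Ambient n)} {q : Ambient n}

theorem IsInteriorPoint.mem (h : IsInteriorPoint M q) : q ∈ M := by
  obtain ⟨U, f, -, hqU, -, hfq, -, hMU⟩ := h
  exact (hMU.symm.subset ⟨hqU, hfq⟩).1

theorem IsBoundaryPoint.mem (h : IsBoundaryPoint M q) : q ∈ M := by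
  obtain ⟨U, f, g, -, hqU, -, -, hfq, hgq, -, hMU⟩ := h
  exact (hMU.symm.subset ⟨hqU, hfq, hgq.ge⟩).1

theorem IsInteriorPoint.exists_defining (h : IsInteriorPoint M q) :
    ∃ f : Ambient n → ℝ, ContDiffAt ℝ 2 f q ∧ f q = 0 ∧ fderiv ℝ f q ≠ 0 ∧
      ∀ᶠ x in 𝓝 q, (x ∈ M ↔ f x = 0) ∧ (f x = 0 → x ∈ hypInterior M) := by
  obtain ⟨U, f, hU, hqU, hf, hfq, hf0, hMU⟩ := h
  have hf2 : ContDiffAt ℝ 2 f q := (hf.contDiffAt (hU.mem_nhds hqU)).of_le (by decide)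
  have hregular : ∀ᶠ x in 𝓝 q, fderiv ℝ f x ≠ 0 :=
    (hf2.fderiv_right (m := 0) (by norm_num)).continuousAt.eventually_ne hf0
  refine ⟨f, hf2, hfq, hf0, ?_⟩
  filter_upwards [hU.mem_nhds hqU, hregular] with x hxU hx
  have hxM := Set.ext_iff.mp hMU x
  simp only [Set.mem_inter_iff, hxU, and_true, Set.mem_ofPred_eq, true_and] at hxM
  exact ⟨hxM, fun hfx => ⟨U, f, hU, hxU, hf, hfx, hx, hMU⟩⟩

theorem IsBoundaryPoint.exists_defining (h : IsBoundaryPoint M q) :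
    ∃ f g : Ambient n → ℝ, ContDiffAt ℝ 2 f q ∧ ContDiffAt ℝ 2 g q ∧ f q = 0 ∧ g q = 0 ∧
      LinearIndependent ℝ ![fderiv ℝ f q, fderiv ℝ g q] ∧
      ∀ᶠ x in 𝓝 q, (x ∈ M ↔ f x = 0 ∧ 0 ≤ g x) ∧ (f x = 0 → g x = 0 → x ∈ hypBoundary M) ∧
        (f x = 0 → 0 < g x → x ∈ hypInterior M) := by
  obtain ⟨U, f, g, hU, hqU, hf, hg, hfq, hgq, hli, hMU⟩ := h
  have hf2 : ContDiffAt ℝ 2 f q := (hf.contDiffAt (hU.mem_nhds hqU)).of_le (by decide)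
  have hg2 : ContDiffAt ℝ 2 g q := (hg.contDiffAt (hU.mem_nhds hqU)).of_le (by decide)
  have hregular : ∀ᶠ x in 𝓝 q, LinearIndependent ℝ ![fderiv ℝ f x, fderiv ℝ g x] := by
    have hcont : ContinuousAt (fun x => ![fderiv ℝ f x, fderiv ℝ g x]) q := by
      refine continuousAt_pi.mpr (Fin.forall_fin_two.mpr ⟨?_, ?_⟩)
      · exact (hf2.fderiv_right (m := 0) (by norm_num)).continuousAt
      · exact (hg2.fderiv_right (m := 0) (by norm_num)).continuousAt
    exact hcont.eventually (isOpen_setOfPred_linearIndependent.mem_nhds hli)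
  refine ⟨f, g, hf2, hg2, hfq, hgq, hli, ?_⟩
  filter_upwards [hU.mem_nhds hqU, hregular] with x hxU hx
  have hxM := Set.ext_iff.mp hMU x
  simp only [Set.mem_inter_iff, hxU, and_true, Set.mem_ofPred_eq, true_and] at hxM
  refine ⟨hxM, fun hfx hgx => ⟨U, f, g, hU, hxU, hf, hg, hfx, hgx, hx, hMU⟩, fun hfx hgx => ?_⟩
  have hUg : IsOpen (U ∩ g ⁻¹' Set.Ioi 0) := hg.continuousOn.isOpen_inter_preimage hU isOpen_Ioi
  refine ⟨U ∩ g ⁻¹' Set.Ioi 0, f, hUg, ⟨hxU, hgx⟩, hf.mono Set.inter_subset_left, hfx,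
    hx.ne_zero 0, ?_⟩
  rw [← Set.inter_assoc, hMU]
  ext z
  exact ⟨fun ⟨⟨hzU, hfz, _⟩, hgz⟩ => ⟨⟨hzU, hgz⟩, hfz⟩,
    fun ⟨⟨hzU, hgz⟩, hfz⟩ => ⟨⟨hzU, hfz, le_of_lt hgz⟩, hgz⟩⟩

theorem LiesAtOneSide.exists_supporting (h : LiesAtOneSide M₁ M₂) (hq₁ : q ∈ M₁) (hq₂ : q ∈ M₂) :
    ∃ f : Ambient n → ℝ, ContDiffAt ℝ 2 f q ∧ fderiv ℝ f q ≠ 0 ∧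
      (∀ᶠ x in 𝓝 q, x ∈ M₁ → 0 ≤ f x) ∧ ∀ᶠ x in 𝓝 q, x ∈ M₂ → f x = 0 := by
  obtain ⟨U, f, hU, hqU, hf, hf0, hf₂, hf₁⟩ := h q ⟨hq₁, hq₂⟩
  refine ⟨f, (hf.contDiffAt (hU.mem_nhds hqU)).of_le (by decide), hf0, ?_, ?_⟩
  · filter_upwards [hU.mem_nhds hqU] with x hx hxM using hf₁ x ⟨hxM, hx⟩
  · filter_upwards [hU.mem_nhds hqU] with x hx hxM using hf₂ x ⟨hxM, hx⟩

theorem IsPrincipalCurvatures.mem_tangentSpaceAt_iff {ν : Ambient n → Ambient n} {l : Fin n → ℝ}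
    (hl : IsPrincipalCurvatures M ν q l) (hq : q ∈ M) {f : Ambient n → ℝ}
    (hf : DifferentiableAt ℝ f q) (hf0 : fderiv ℝ f q ≠ 0) (hM : ∀ᶠ x in 𝓝 q, x ∈ M → f x = 0)
    (w : Ambient n) : w ∈ tangentSpaceAt M q ↔ fderiv ℝ f q w = 0 := by
  have hsharp : innerSL ℝ (sharp (Ambient n) (fderiv ℝ f q)) = fderiv ℝ f q :=
    ContinuousLinearMap.ext fun w => inner_sharp (fderiv ℝ f q) w
  have hne : sharp (Ambient n) (fderiv ℝ f q) ≠ 0 := fun h => hf0 (by rw [← hsharp, h, map_zero])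
  rw [hl.tangentSpaceAt_eq_orthogonal hne (by rw [hsharp]; exact hf.hasFDerivAt) hq hM,
    Submodule.mem_orthogonal_singleton_iff_inner_right, inner_sharp]

end DefiningFunctions

section LocalGraphs

set_option maxSynthPendingDepth 3

section GraphTangent

variable {E : Type*} [NormedAddCommGroup E] [InnerProductSpace ℝ E] {p v : E}
  {u : graphBase v → ℝ}

/-- The derivative of `graphPoint p v u` at a point where `u` has derivative `q`; its range is the
tangent space of the graph. -/
noncomputable def graphTangent (v : E) (q : graphBase v →L[ℝ] ℝ) : graphBase v →L[ℝ] E :=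
  (graphBase v).subtypeL + q.smulRight v

theorem hasFDerivAt_graphPoint {y : graphBase v} (hu : DifferentiableAt ℝ u y) :
    HasFDerivAt (graphPoint p v u) (graphTangent v (fderiv ℝ u y)) y :=
  ((graphBase v).subtypeL.hasFDerivAt.add (hu.hasFDerivAt.smul_const v)).const_add p

theorem graphTangent_graphProj_add_smul (hv : ‖v‖ = 1) (q : graphBase v →L[ℝ] ℝ) (w : E) :
    graphTangent v q (graphProj v w) + (inner ℝ v w - q (graphProj v w)) • v = w := by
  have htangent : graphTangent v q (graphProj v w) =
      (graphProj v w : E) + q (graphProj v w) • v := rfl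
  conv_rhs => rw [← graphProj_add_smul hv w]
  rw [htangent]
  module

theorem comp_graphTangent_ne_zero (hv : ‖v‖ = 1) {q : graphBase v →L[ℝ] ℝ} {F G : E →L[ℝ] ℝ}
    (hli : LinearIndependent ℝ ![F, G]) (hFv : F v ≠ 0) (hF : F.comp (graphTangent v q) = 0) :
    G.comp (graphTangent v q) ≠ 0 := by
  intro hG
  have hrel : G v • F + (-F v) • G = 0 := by
    ext w
    have hFw : F (graphTangent v q (graphProj v w)) = 0 := DFunLike.congr_fun hF _
    have hGw : G (graphTangent v q (graphProj v w)) = 0 := DFunLike.congr_fun hG _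
    rw [← graphTangent_graphProj_add_smul hv q w]
    simp only [add_apply, smul_apply, map_add, map_smul, smul_eq_mul, hFw, hGw, zero_apply]
    ring
  exact hFv (neg_eq_zero.mp (LinearIndependent.pair_iff.mp hli _ _ hrel).2)

theorem eventually_nonneg_graphPoint_iff (hv : ‖v‖ = 1) {f g : E → ℝ}
    (hf : DifferentiableAt ℝ f p) (hg : ContDiffAt ℝ 2 g p) (hgp : g p = 0)
    (hli : LinearIndependent ℝ ![fderiv ℝ f p, fderiv ℝ g p]) (hfv : fderiv ℝ f p v ≠ 0)
    (hu : ContDiffAt ℝ 2 u 0) (hu0 : u 0 = 0) (hfu : ∀ᶠ y in 𝓝 0, f (graphPoint p v u y) = 0)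
    {ℓ : graphBase v →L[ℝ] ℝ} (hℓ : ℓ ≠ 0)
    (hzero : ∀ᶠ y in 𝓝 0, g (graphPoint p v u y) = 0 → ℓ y = 0)
    (hnonneg : ∀ᶠ y in 𝓝 0, 0 ≤ g (graphPoint p v u y) → 0 ≤ ℓ y) :
    ∀ᶠ y in 𝓝 0, 0 ≤ g (graphPoint p v u y) ↔ 0 ≤ ℓ y := by
  have hchain {F : E → ℝ} (hF : DifferentiableAt ℝ F p) :
      HasFDerivAt (fun y => F (graphPoint p v u y))
        ((fderiv ℝ F p).comp (graphTangent v (fderiv ℝ u 0))) 0 := by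
    rw [← graphPoint_zero (p := p) (v := v) hu0] at hF
    have := hF.hasFDerivAt.comp 0 (hasFDerivAt_graphPoint (hu.differentiableAt (by simp)))
    rwa [graphPoint_zero hu0] at this
  have hftangent : (fderiv ℝ f p).comp (graphTangent v (fderiv ℝ u 0)) = 0 :=
    (hchain hf).unique ((hasFDerivAt_const 0 0).congr_of_eventuallyEq hfu)
  have hcont : ∀ᶠ y in 𝓝 0, ContinuousAt (fun y => g (graphPoint p v u y)) y := by
    filter_upwards [hu.eventually (by simp),
      (tendsto_graphPoint hu.continuousAt hu0).eventually (hg.eventually (by simp))] with y hy hgy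
    exact hgy.continuousAt.comp (continuousAt_graphPoint hy.continuousAt)
  exact eventually_nonneg_iff hℓ (hchain (hg.differentiableAt (by simp)))
    (comp_graphTangent_ne_zero hv hli hfv hftangent) (by rw [graphPoint_zero hu0, hgp]) hcont
    hzero hnonneg

end GraphTangent

variable {n : ℕ} {M : Set (Ambient n)} {ν : Ambient n → Ambient n} {p v : Ambient n}
  {l : Fin n → ℝ}

theorem IsPrincipalCurvatures.exists_graph_of_defining (hl : IsPrincipalCurvatures M ν p l)
    (hp : p ∈ M) (hv : ‖v‖ = 1) (hvT : v ∉ tangentSpaceAt M p) {f : Ambient n → ℝ}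
    (hf : ContDiffAt ℝ 2 f p) (hfp : f p = 0) (hf0 : fderiv ℝ f p ≠ 0)
    (hM : ∀ᶠ x in 𝓝 p, x ∈ M → f x = 0) :
    fderiv ℝ f p v ≠ 0 ∧ ∃ u : graphBase v → ℝ, ContDiffAt ℝ 2 u 0 ∧ u 0 = 0 ∧
      ∀ᶠ x in 𝓝 p, f x = 0 ↔ graphFun p v u x = 0 := by
  have hfv : fderiv ℝ f p v ≠ 0 := fun h0 => hvT
    ((hl.mem_tangentSpaceAt_iff hp (hf.differentiableAt (by simp)) hf0 hM v).mpr h0)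
  refine ⟨hfv, ?_⟩
  simpa only [graphFun, sub_eq_zero] using exists_graph_of_regular hv hf hfp hfv

theorem IsInteriorPoint.exists_isGraphNear (h : IsInteriorPoint M p)
    (hl : IsPrincipalCurvatures M ν p l) (hv : ‖v‖ = 1) (hvT : v ∉ tangentSpaceAt M p) :
    ∃ u, IsGraphNear M p v u Set.univ := by
  obtain ⟨f, hf, hfp, hf0, hM⟩ := h.exists_defining
  obtain ⟨-, u, hu, hu0, hgraph⟩ := hl.exists_graph_of_defining h.mem hv hvT hf hfp hf0
    (hM.mono fun x hx => hx.1.mp)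
  refine ⟨u, hu, hu0, ?_⟩
  filter_upwards [hM, hgraph] with x hxM hx
  rw [hxM.1, hx, closure_univ, and_iff_right (Set.mem_univ _)]

theorem IsBoundaryPoint.exists_isGraphNear {a : Ambient n} {b : ℝ} (h : IsBoundaryPoint M p)
    (hl : IsPrincipalCurvatures M ν p l) (hv : ‖v‖ = 1) (hvT : v ∉ tangentSpaceAt M p)
    (ha : a ≠ 0) (hav : inner ℝ v a = 0) (hbd : hypBoundary M ⊆ affineHyperplane a b)
    (hhalf : ∀ᶠ x in 𝓝 p, x ∈ M → b ≤ inner ℝ a x) :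
    ∃ u, IsGraphNear M p v u {y | 0 < inner ℝ a (y : Ambient n)} := by
  have hpb : inner ℝ a p = b := hbd h
  obtain ⟨f, g, hf, hg, hfp, hgp, hli, hM⟩ := h.exists_defining
  obtain ⟨hfv, u, hu, hu0, hgraph⟩ := hl.exists_graph_of_defining h.mem hv hvT hf hfp
    (hli.ne_zero 0) (hM.mono fun x hx hxM => (hx.1.mp hxM).1)
  have htend := tendsto_graphPoint (p := p) hu.continuousAt hu0
  set ℓ : graphBase v →L[ℝ] ℝ := (innerSL ℝ a).comp (graphBase v).subtypeL
  have hℓ : ℓ ≠ 0 := by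
    intro h0
    have : ℓ ⟨a, Submodule.mem_orthogonal_singleton_iff_inner_right.mpr hav⟩ = 0 := by
      rw [h0, zero_apply]
    exact ha (inner_self_eq_zero.mp this)
  have hheight (y : graphBase v) : ℓ y = inner ℝ a (graphPoint p v u y) - b := by
    rw [graphPoint, inner_add_right, inner_add_right, inner_smul_right, real_inner_comm v a, hav,
      hpb, mul_zero, add_zero, add_sub_cancel_left]
    rfl
  have hfu : ∀ᶠ y in 𝓝 0, f (graphPoint p v u y) = 0 :=
    (htend.eventually hgraph).mono fun y hy => hy.mpr (graphFun_graphPoint hv y)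
  have hside : ∀ᶠ y in 𝓝 0, 0 ≤ g (graphPoint p v u y) ↔ 0 ≤ ℓ y := by
    refine eventually_nonneg_graphPoint_iff hv (hf.differentiableAt (by simp)) hg hgp hli hfv hu
      hu0 hfu hℓ ?_ ?_
    · filter_upwards [hfu, htend.eventually hM] with y hfy hy hgy
      rw [hheight, sub_eq_zero]
      exact hbd (hy.2.1 hfy hgy)
    · filter_upwards [hfu, htend.eventually (hM.and hhalf)] with y hfy hy hgy
      rw [hheight, sub_nonneg]
      exact hy.2 (hy.1.1.mpr ⟨hfy, hgy⟩)
  refine ⟨u, hu, hu0, ?_⟩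
  filter_upwards [hM, hgraph, (tendsto_graphProj p v).eventually hside] with x hxM hx hsidex
  change _ ↔ _ ∈ closure {y | 0 < ℓ y} ∧ _
  rw [hxM.1, closure_setOf_map_pos hℓ, and_comm, hx]
  refine and_congr_left fun hx0 => ?_
  rwa [graphPoint_of_graphFun_eq_zero hv hx0] at hsidex

end LocalGraphs

section TangencyPrinciples

set_option maxSynthPendingDepth 3

section InnerProductSpace

variable {E : Type*} [NormedAddCommGroup E] [InnerProductSpace ℝ E] {T : Submodule ℝ E} {a v ν : E}

theorem notMem_of_mem_orthogonal (hν : ν ∈ Tᗮ) (h : inner ℝ ν v ≠ 0) : v ∉ T := fun hv =>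
  h (Submodule.inner_left_of_mem_orthogonal hv hν)

theorem exists_unit_orthogonal (hνT : ν ∈ Tᗮ) (hν : ν ≠ 0) (hT : ∃ w ∈ T, inner ℝ a w ≠ 0) :
    ∃ v : E, ‖v‖ = 1 ∧ inner ℝ v a = 0 ∧ 0 < inner ℝ ν v := by
  obtain ⟨w, hw, haw⟩ := hT
  obtain ⟨y, hy, z, hz, rfl⟩ := (ℝ ∙ a).exists_add_mem_mem_orthogonal ν
  have hyz : inner ℝ y z = 0 := Submodule.inner_right_of_mem_orthogonal hy hz
  have hz0 : z ≠ 0 := by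
    rintro rfl
    obtain ⟨c, rfl⟩ := Submodule.mem_span_singleton.mp hy
    have hcw : inner ℝ (c • a + 0) w = 0 := Submodule.inner_left_of_mem_orthogonal hw hνT
    rw [add_zero, real_inner_smul_left] at hcw
    simp [(mul_eq_zero.mp hcw).resolve_right haw] at hν
  refine ⟨‖z‖⁻¹ • z, norm_smul_inv_norm hz0, ?_, ?_⟩
  · rw [real_inner_smul_left, Submodule.mem_orthogonal_singleton_iff_inner_left.mp hz, mul_zero]
  · rw [real_inner_smul_right, inner_add_left, hyz, zero_add, real_inner_self_eq_norm_sq]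
    positivity

end InnerProductSpace

theorem fderiv_eq_zero_iff_of_isLocalMinOn {E : Type*} [NormedAddCommGroup E] [NormedSpace ℝ E]
    [CompleteSpace E] {f g : E → ℝ} {p : E} (hmin : IsLocalMinOn f {x | g x = g p} p)
    (hf : ContDiffAt ℝ 1 f p) (hg : ContDiffAt ℝ 1 g p) (hf0 : fderiv ℝ f p ≠ 0)
    (hg0 : fderiv ℝ g p ≠ 0) (w : E) : fderiv ℝ g p w = 0 ↔ fderiv ℝ f p w = 0 := by
  obtain ⟨s, t, hst, hrel⟩ := IsLocalExtrOn.exists_multipliers_of_hasStrictFDerivAt_1d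
    (Or.inl hmin) (hg.hasStrictFDerivAt (by simp)) (hf.hasStrictFDerivAt (by simp))
  have hs : s ≠ 0 := by
    rintro rfl
    rw [zero_smul, zero_add, smul_eq_zero] at hrel
    exact hst (Prod.ext rfl (hrel.resolve_right hf0))
  have ht : t ≠ 0 := by
    rintro rfl
    rw [zero_smul, add_zero, smul_eq_zero] at hrel
    exact hrel.elim hs hg0
  have hw : s * fderiv ℝ g p w + t * fderiv ℝ f p w = 0 := DFunLike.congr_fun hrel w
  constructor <;> intro h
  · simpa [h, ht] using hw
  · simpa [h, hs] using hw

variable {n : ℕ} {Γ : Set (Fin n → ℝ)} {γ : (Fin n → ℝ) → ℝ} {M M₁ M₂ : Set (Ambient n)}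
  {ν ν₁ ν₂ : Ambient n → Ambient n} {p v : Ambient n} {l l₁ l₂ : Fin n → ℝ}
  {D : Set (graphBase v)}

theorem tangentSpaceAt_eq_of_liesAtOneSide (hl₁ : IsPrincipalCurvatures M₁ ν₁ p l₁)
    (hl₂ : IsPrincipalCurvatures M₂ ν₂ p l₂) (hp₁ : p ∈ hypInterior M₁) (hp₂ : p ∈ M₂)
    (hside : LiesAtOneSide M₁ M₂) : tangentSpaceAt M₁ p = tangentSpaceAt M₂ p := by
  have hpM₁ : p ∈ M₁ := IsInteriorPoint.mem hp₁
  obtain ⟨f, hf, hf0, hf₁, hf₂⟩ := hside.exists_supporting hpM₁ hp₂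
  obtain ⟨g, hg, hgp, hg0, hM₁⟩ := IsInteriorPoint.exists_defining hp₁
  have hfp : f p = 0 := hf₂.self_of_nhds hp₂
  have hmin : IsLocalMinOn f {x | g x = g p} p := by
    refine eventually_nhdsWithin_iff.mpr ?_
    filter_upwards [hM₁, hf₁] with x hx hfx hgx
    rw [hfp]
    exact hfx (hx.1.mpr (hgx.trans hgp))
  ext w
  rw [hl₁.mem_tangentSpaceAt_iff hpM₁ (hg.differentiableAt (by simp)) hg0
      (hM₁.mono fun x hx => hx.1.mp),
    hl₂.mem_tangentSpaceAt_iff hp₂ (hf.differentiableAt (by simp)) hf0 hf₂,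
    fderiv_eq_zero_iff_of_isLocalMinOn hmin (hf.of_le (by norm_num)) (hg.of_le (by norm_num)) hf0
      hg0]

theorem IsGraphNear.graphGrad_eq_smul {u : graphBase v → ℝ} (hg : IsGraphNear M p v u D)
    (hl : IsPrincipalCurvatures M ν p l) (hp : p ∈ M) (hv : ‖v‖ = 1) {w : Ambient n}
    (hw : w ∈ (tangentSpaceAt M p)ᗮ) (hwv : inner ℝ w v ≠ 0) :
    graphGrad v (fderiv ℝ u 0) = (inner ℝ w v)⁻¹ • w := by
  have hproj : graphProj v (p - p) = 0 := by simp
  have hT := hl.tangentSpaceAt_eq_orthogonal (graphGrad_ne_zero hv _) (hasFDerivAt_graphFun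
    (by rw [hproj]; exact hg.contDiffAt.differentiableAt (by simp))) hp hg.graphFun_eq_zero
  rw [hT, hproj, Submodule.orthogonal_orthogonal, Submodule.mem_span_singleton] at hw
  obtain ⟨c, rfl⟩ := hw
  rw [real_inner_smul_left, inner_graphGrad_self hv, mul_one] at hwv ⊢
  rw [smul_smul, inv_mul_cancel₀ hwv, one_smul]

theorem eventually_mem_iff_of_tangent (hγ : IsEllipticSpeed Γ γ) (h₁ : IsTranslator Γ γ M₁ ν₁)
    (h₂ : IsTranslator Γ γ M₂ ν₂) (hconv₁ : IsStrictlyConvexHyp M₁ ν₁)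
    (hconv₂ : IsConvexHyp M₂ ν₂) (hside : LiesAtOneSide M₁ M₂) (hp₁ : p ∈ M₁) (hp₂ : p ∈ M₂)
    (hT : tangentSpaceAt M₁ p = tangentSpaceAt M₂ p) (hv : ‖v‖ = 1) (hνv : 0 < inner ℝ (ν₁ p) v)
    {u₁ u₂ : graphBase v → ℝ} (hg₁ : IsGraphNear M₁ p v u₁ D) (hg₂ : IsGraphNear M₂ p v u₂ D)
    (hDo : IsOpen D) (hDc : Convex ℝ D) (hD : HasInteriorBallAtZero D) :
    ∀ᶠ x in 𝓝 p, x ∈ M₁ ↔ x ∈ M₂ := by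
  obtain ⟨l₁, -, hl₁, hleq₁⟩ := h₁.equation p hp₁
  obtain ⟨l₂, -, hl₂, -⟩ := h₂.equation p hp₂
  have hνT : ν₁ p ∈ (tangentSpaceAt M₁ p)ᗮ := (h₁.normal.2 p hp₁).2
  have hgrad := hg₁.graphGrad_eq_smul hl₁ hp₁ hv hνT hνv.ne'
  have hder : fderiv ℝ u₁ 0 = fderiv ℝ u₂ 0 := graphGrad_injective v
    (hgrad.trans (hg₂.graphGrad_eq_smul hl₂ hp₂ hv (hT ▸ hνT) hνv.ne').symm)
  have hup : 0 < inner ℝ (graphGrad v (fderiv ℝ u₁ 0)) (upward n) := by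
    rw [hgrad, real_inner_smul_left]
    refine mul_pos (inv_pos.mpr hνv) ?_
    exact (hγ.pos l₁ (hγ.positiveCone_subset (hconv₁ p hp₁ l₁ hl₁))).trans_eq hleq₁
  obtain ⟨f, hf, hf0, hf₁, hf₂⟩ := hside.exists_supporting hp₁ hp₂
  have hfv : fderiv ℝ f p v ≠ 0 := by
    rw [Ne, ← hl₂.mem_tangentSpaceAt_iff hp₂ (hf.differentiableAt (by simp)) hf0 hf₂ v, ← hT]
    exact notMem_of_mem_orthogonal hνT hνv.ne'
  exact eventually_mem_iff_of_isGraphNear hγ h₁ h₂ hconv₁ hconv₂ hv hg₁ hg₂ hup hder hDo hDc hD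
    (hg₁.ordered hv hg₂ (hf.hasStrictFDerivAt (by simp)) hfv hf₁ hf₂)

theorem eventually_mem_iff_of_mem_hypInterior (hγ : IsEllipticSpeed Γ γ)
    (h₁ : IsTranslator Γ γ M₁ ν₁) (h₂ : IsTranslator Γ γ M₂ ν₂)
    (hconv₁ : IsStrictlyConvexHyp M₁ ν₁) (hconv₂ : IsConvexHyp M₂ ν₂)
    (hside : LiesAtOneSide M₁ M₂) (hp₁ : p ∈ hypInterior M₁) (hp₂ : p ∈ hypInterior M₂) :
    ∀ᶠ x in 𝓝 p, x ∈ M₁ ↔ x ∈ M₂ := by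
  have hpM₁ : p ∈ M₁ := IsInteriorPoint.mem hp₁
  have hpM₂ : p ∈ M₂ := IsInteriorPoint.mem hp₂
  obtain ⟨l₁, -, hl₁, -⟩ := h₁.equation p hpM₁
  obtain ⟨l₂, -, hl₂, -⟩ := h₂.equation p hpM₂
  obtain ⟨hν, hνT⟩ := h₁.normal.2 p hpM₁
  have hT := tangentSpaceAt_eq_of_liesAtOneSide hl₁ hl₂ hp₁ hpM₂ hside
  have hνν : 0 < inner ℝ (ν₁ p) (ν₁ p) := by
    rw [real_inner_self_eq_norm_sq, hν]
    norm_num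
  have hνnT := notMem_of_mem_orthogonal hνT hνν.ne'
  obtain ⟨u₁, hg₁⟩ := IsInteriorPoint.exists_isGraphNear hp₁ hl₁ hν hνnT
  obtain ⟨u₂, hg₂⟩ := IsInteriorPoint.exists_isGraphNear hp₂ hl₂ hν (hT ▸ hνnT)
  exact eventually_mem_iff_of_tangent hγ h₁ h₂ hconv₁ hconv₂ hside hpM₁ hpM₂ hT hν hνν hg₁ hg₂
    isOpen_univ convex_univ (Or.inl trivial)

theorem eventually_mem_iff_of_mem_hypBoundary (hγ : IsEllipticSpeed Γ γ)
    (h₁ : IsTranslator Γ γ M₁ ν₁) (h₂ : IsTranslator Γ γ M₂ ν₂)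
    (hconv₁ : IsStrictlyConvexHyp M₁ ν₁) (hconv₂ : IsConvexHyp M₂ ν₂)
    (hside : LiesAtOneSide M₁ M₂) {a : Ambient n} {b : ℝ} (ha : a ≠ 0)
    (hbd₁ : hypBoundary M₁ ⊆ affineHyperplane a b) (hbd₂ : hypBoundary M₂ ⊆ affineHyperplane a b)
    (htr : ∃ w ∈ tangentSpaceAt M₁ p, inner ℝ a w ≠ 0) (hp₁ : p ∈ hypBoundary M₁)
    (hp₂ : p ∈ hypBoundary M₂) (hhalf : ∀ᶠ x in 𝓝 p, x ∈ M₁ ∪ M₂ → b ≤ inner ℝ a x)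
    (hT : tangentSpaceAt M₁ p = tangentSpaceAt M₂ p) : ∀ᶠ x in 𝓝 p, x ∈ M₁ ↔ x ∈ M₂ := by
  have hpM₁ : p ∈ M₁ := IsBoundaryPoint.mem hp₁
  have hpM₂ : p ∈ M₂ := IsBoundaryPoint.mem hp₂
  obtain ⟨l₁, -, hl₁, -⟩ := h₁.equation p hpM₁
  obtain ⟨l₂, -, hl₂, -⟩ := h₂.equation p hpM₂
  obtain ⟨hν, hνT⟩ := h₁.normal.2 p hpM₁
  obtain ⟨v, hv, hva, hνv⟩ := exists_unit_orthogonal hνT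
    (norm_ne_zero_iff.mp (hν.trans_ne one_ne_zero)) htr
  have hvT := notMem_of_mem_orthogonal hνT hνv.ne'
  obtain ⟨u₁, hg₁⟩ := IsBoundaryPoint.exists_isGraphNear hp₁ hl₁ hv hvT ha hva hbd₁
    (hhalf.mono fun x hx hxM => hx (Or.inl hxM))
  obtain ⟨u₂, hg₂⟩ := IsBoundaryPoint.exists_isGraphNear hp₂ hl₂ hv (hT ▸ hvT) ha hva hbd₂
    (hhalf.mono fun x hx hxM => hx (Or.inr hxM))
  let a' : graphBase v := ⟨a, Submodule.mem_orthogonal_singleton_iff_inner_right.mpr hva⟩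
  have ha' : a' ≠ 0 := fun h0 => ha (congrArg Subtype.val h0)
  exact eventually_mem_iff_of_tangent hγ h₁ h₂ hconv₁ hconv₂ hside hpM₁ hpM₂ hT hv hνv hg₁ hg₂
    (isOpen_lt continuous_const (by fun_prop))
    (convex_halfSpace_gt (innerₗ _ a').isLinear 0) (hasInteriorBallAtZero_halfSpace ha')

end TangencyPrinciples

section LocalStructure

set_option maxSynthPendingDepth 3

section Straightening

variable {E : Type*} [NormedAddCommGroup E] [NormedSpace ℝ E]

theorem prod_surjective_of_linearIndependent {L L' : E →L[ℝ] ℝ}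
    (hli : LinearIndependent ℝ ![L, L']) : Function.Surjective (L.prod L') := by
  suffices h : (L.prod L').toLinearMap.range = ⊤ from LinearMap.range_eq_top.mp h
  by_contra hne
  obtain ⟨ψ, hψ, hker⟩ := Submodule.exists_le_ker_of_lt_top _ (lt_top_iff_ne_top.mpr hne)
  have hcoord (z : ℝ × ℝ) : ψ z = ψ (1, 0) * z.1 + ψ (0, 1) * z.2 := by
    have hz : z = z.1 • (1, 0) + z.2 • (0, 1) := by simp
    conv_lhs => rw [hz, map_add, map_smul, map_smul, smul_eq_mul, smul_eq_mul]
    ring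
  have hrel : ψ (1, 0) • L + ψ (0, 1) • L' = 0 :=
    ContinuousLinearMap.ext fun x => (hcoord (L x, L' x)).symm.trans (hker ⟨x, rfl⟩)
  obtain ⟨h₁, h₂⟩ := LinearIndependent.pair_iff.mp hli _ _ hrel
  exact hψ (LinearMap.ext fun z => by simp only [hcoord z, h₁, h₂, zero_mul, add_zero,
    LinearMap.zero_apply])

theorem exists_straightening {K : Type*} [NormedAddCommGroup K] [NormedSpace ℝ K]
    [FiniteDimensional ℝ K] {F : E → K} {L : E →L[ℝ] K} {q : E} (hF : HasStrictFDerivAt F L q)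
    (hL : Function.Surjective L) (hFq : F q = 0) :
    ∃ Φ : E → E, HasStrictFDerivAt Φ (ContinuousLinearEquiv.refl ℝ E : E →L[ℝ] E) q ∧ Φ q = 0 ∧
      ∀ x, L (Φ x) = F x := by
  obtain ⟨R, hR⟩ := L.exists_rightInverse_of_surjective (LinearMap.range_eq_top.mpr hL)
  refine ⟨fun x => (x - q) + R (F x - L (x - q)), ?_, by simp [hFq], fun x => ?_⟩
  · have hsub : HasStrictFDerivAt (fun x => x - q) (ContinuousLinearMap.id ℝ E) q :=
      (hasStrictFDerivAt_id q).sub_const q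
    have hcorr := R.hasStrictFDerivAt.comp q (hF.sub (L.hasStrictFDerivAt.comp q hsub))
    refine (hsub.add hcorr).congr_fderiv ?_
    ext x
    simp
  · have hLR (k : K) : L (R k) = k := DFunLike.congr_fun hR k
    rw [map_add, hLR, add_sub_cancel]

end Straightening

variable {n : ℕ} {M : Set (Ambient n)} {q : Ambient n} {Φ Ψ : Ambient n → Ambient n}
  {C C' : Set (Ambient n)} {r : ℝ} {K : NNReal}

/-- `Φ` straightens `M` near `q`: it maps `M` to the closed convex set `C`, and its inverse maps
the convex set `C'` to interior points. -/
structure IsStraightening (M : Set (Ambient n)) (q : Ambient n) (Φ : Ambient n → Ambient n)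
    (C C' : Set (Ambient n)) : Prop where
  hasStrictFDerivAt : HasStrictFDerivAt Φ
    (ContinuousLinearEquiv.refl ℝ (Ambient n) : Ambient n →L[ℝ] Ambient n) q
  map_self : Φ q = 0
  isClosed : IsClosed C
  convex : Convex ℝ C
  convex' : Convex ℝ C'
  zero_mem : 0 ∈ C
  subset_closure : C ⊆ closure C'
  mem_iff : ∀ᶠ x in 𝓝 q, x ∈ M ↔ Φ x ∈ C
  mem_interior : ∀ᶠ x in 𝓝 q, Φ x ∈ C' → x ∈ hypInterior M

theorem exists_isStraightening_of_defining {K : Type*} [NormedAddCommGroup K] [NormedSpace ℝ K]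
    [FiniteDimensional ℝ K] {F : Ambient n → K} {L : Ambient n →L[ℝ] K}
    (hF : HasStrictFDerivAt F L q) (hL : Function.Surjective L) (hFq : F q = 0) {S S' : Set K}
    (hS : IsClosed S) (hSc : Convex ℝ S) (hSc' : Convex ℝ S') (h0 : 0 ∈ S) (hSS' : S ⊆ closure S')
    (hM : ∀ᶠ x in 𝓝 q, (x ∈ M ↔ F x ∈ S) ∧ (F x ∈ S' → x ∈ hypInterior M)) :
    ∃ Φ C C', IsStraightening M q Φ C C' := by
  obtain ⟨Φ, hΦ, hΦq, hLΦ⟩ := exists_straightening hF hL hFq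
  refine ⟨Φ, L ⁻¹' S, L ⁻¹' S', hΦ, hΦq, hS.preimage L.continuous,
    hSc.linear_preimage L.toLinearMap, hSc'.linear_preimage L.toLinearMap, ?_, ?_, ?_, ?_⟩
  · rwa [Set.mem_preimage, map_zero]
  · rw [← (L.isOpenMap hL).preimage_closure_eq_closure_preimage L.continuous]
    exact Set.preimage_mono hSS'
  · exact hM.mono fun x hx => by rw [Set.mem_preimage, hLΦ, hx.1]
  · exact hM.mono fun x hx => by rw [Set.mem_preimage, hLΦ]; exact hx.2

theorem IsInteriorPoint.exists_isStraightening (h : IsInteriorPoint M q) :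
    ∃ Φ C C', IsStraightening M q Φ C C' := by
  obtain ⟨f, hf, hfq, hf0, hM⟩ := h.exists_defining
  have hsurj : Function.Surjective (fderiv ℝ f q) :=
    LinearMap.surjective fun h0 => hf0 (ContinuousLinearMap.coe_injective h0)
  exact exists_isStraightening_of_defining (hf.hasStrictFDerivAt (by simp)) hsurj hfq
    isClosed_singleton (convex_singleton 0) (convex_singleton 0) rfl subset_closure hM

theorem IsBoundaryPoint.exists_isStraightening (h : IsBoundaryPoint M q) :
    ∃ Φ C C', IsStraightening M q Φ C C' := by
  obtain ⟨f, g, hf, hg, hfq, hgq, hli, hM⟩ := h.exists_defining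
  refine exists_isStraightening_of_defining (F := fun x => (f x, g x)) (S := {0} ×ˢ Set.Ici 0)
    (S' := {0} ×ˢ Set.Ioi 0) ((hf.hasStrictFDerivAt (by simp)).prodMk
      (hg.hasStrictFDerivAt (by simp))) (prod_surjective_of_linearIndependent hli)
    (Prod.ext hfq hgq) (isClosed_singleton.prod isClosed_Ici)
    ((convex_singleton 0).prod (convex_Ici 0)) ((convex_singleton 0).prod (convex_Ioi 0))
    ⟨rfl, Set.self_mem_Ici⟩ ?_ (hM.mono fun x hx => ⟨hx.1, fun hF => hx.2.2 hF.1 hF.2⟩)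
  rw [closure_prod_eq, closure_singleton, closure_Ioi]

theorem IsEmbeddedHypersurface.exists_isStraightening (hM : IsEmbeddedHypersurface M)
    (hq : q ∈ M) : ∃ Φ C C', IsStraightening M q Φ C C' :=
  (hM q hq).elim IsInteriorPoint.exists_isStraightening IsBoundaryPoint.exists_isStraightening

theorem IsEmbeddedHypersurface.eventually_mem_of_mem_closure (hM : IsEmbeddedHypersurface M)
    (hq : q ∈ M) : ∀ᶠ x in 𝓝 q, x ∈ closure M → x ∈ M := by
  obtain ⟨Φ, C, C', h⟩ := hM.exists_isStraightening hq
  obtain ⟨K, s, hs, hK⟩ := h.hasStrictFDerivAt.exists_lipschitzOnWith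
  filter_upwards [h.mem_iff.eventually_nhds, eventually_eventually_nhds.mpr hs] with x hx hxs hxM
  have hcont : ContinuousAt Φ x := hK.continuousOn.continuousAt hxs
  have := mem_closure_iff_nhdsWithin_neBot.mp hxM
  exact hx.self_of_nhds.mpr (h.isClosed.mem_of_tendsto hcont.continuousWithinAt
    (eventually_nhdsWithin_iff.mpr (hx.mono fun y hy => hy.mp)))

/-- `Ψ` parametrizes `M` near `q` by a relatively open piece of the convex set `C`, with the
points of the dense convex part `C'` going to interior points. -/
structure IsConvexChart (M : Set (Ambient n)) (q : Ambient n) (Ψ : Ambient n → Ambient n)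
    (K : NNReal) (r : ℝ) (C C' : Set (Ambient n)) : Prop where
  lipschitz : LipschitzOnWith K Ψ (Metric.ball 0 r)
  map_zero : Ψ 0 = q
  radius_pos : 0 < r
  convex : Convex ℝ C
  convex' : Convex ℝ C'
  zero_mem : 0 ∈ C
  subset_closure : C ⊆ closure C'
  mapsTo : Set.MapsTo Ψ (C ∩ Metric.ball 0 r) M
  mapsTo_interior : Set.MapsTo Ψ (C' ∩ Metric.ball 0 r) (hypInterior M)
  mem_image : ∀ᶠ x in 𝓝 q, x ∈ M → x ∈ Ψ '' (C ∩ Metric.ball 0 r)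

theorem IsStraightening.exists_isConvexChart (h : IsStraightening M q Φ C C')
    {W : Set (Ambient n)} (hW : W ∈ 𝓝 q) :
    ∃ Ψ K r, IsConvexChart M q Ψ K r C C' ∧ Set.MapsTo Ψ (Metric.ball 0 r) W := by
  have hd := h.hasStrictFDerivAt
  set Ψ := hd.localInverse Φ _ q
  have hΨ : HasStrictFDerivAt Ψ _ (Φ q) := hd.to_localInverse
  have hleft : ∀ᶠ x in 𝓝 q, Ψ (Φ x) = x := hd.eventually_left_inverse
  have hright : ∀ᶠ y in 𝓝 (Φ q), Φ (Ψ y) = y := hd.eventually_right_inverse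
  have hΦ0 : Filter.Tendsto Φ (𝓝 q) (𝓝 0) := h.map_self ▸ hd.continuousAt
  have hΨq : Ψ (Φ q) = q := hleft.self_of_nhds
  rw [h.map_self] at hΨ hright hΨq
  have hΨ0 : Filter.Tendsto Ψ (𝓝 0) (𝓝 q) := by simpa only [hΨq] using hΨ.continuousAt.tendsto
  obtain ⟨K, s, hs, hK⟩ := hΨ.exists_lipschitzOnWith
  obtain ⟨r, hr, hball⟩ := Metric.eventually_nhds_iff_ball.mp
    ((hΨ0.eventually ((h.mem_iff.and h.mem_interior).and hW)).and
      (hright.and (Filter.eventually_mem_set.mpr hs)))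
  refine ⟨Ψ, K, r, ⟨hK.mono fun y hy => (hball y hy).2.2, hΨq, hr, h.convex, h.convex', h.zero_mem,
    h.subset_closure, fun y hy => ?_, fun y hy => ?_, ?_⟩, fun y hy => (hball y hy).1.2⟩
  · obtain ⟨⟨⟨hmem, -⟩, -⟩, hy', -⟩ := hball y hy.2
    exact hmem.mpr (hy'.symm ▸ hy.1)
  · obtain ⟨⟨⟨-, hint⟩, -⟩, hy', -⟩ := hball y hy.2
    exact hint (hy'.symm ▸ hy.1)
  · filter_upwards [h.mem_iff, hΦ0.eventually (Metric.ball_mem_nhds 0 hr), hleft]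
      with x hx hxr hxΨ hxM
    exact ⟨Φ x, ⟨hx.mp hxM, hxr⟩, hxΨ⟩

theorem IsConvexChart.subset_closure_image (h : IsConvexChart M q Ψ K r C C') :
    Ψ '' (C ∩ Metric.ball 0 r) ⊆ closure (Ψ '' (C' ∩ Metric.ball 0 r)) := by
  rintro _ ⟨y, ⟨hyC, hy⟩, rfl⟩
  have hyC' : y ∈ closure (C' ∩ Metric.ball 0 r) := by
    rw [Set.inter_comm]
    exact Metric.isOpen_ball.inter_closure ⟨hy, h.subset_closure hyC⟩
  exact mem_closure_image
    (h.lipschitz.continuousOn.continuousAt (Metric.isOpen_ball.mem_nhds hy)) hyC'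

theorem IsConvexChart.exists_lipschitz_path (h : IsConvexChart M q Ψ K r C C') {x : Ambient n}
    (hx : x ∈ Ψ '' (C ∩ Metric.ball 0 r)) :
    ∃ (c : ℝ → Ambient n) (K : NNReal), LipschitzOnWith K c (Set.Icc 0 1) ∧
      Set.MapsTo c (Set.Icc 0 1) M ∧ c 0 = x ∧ c 1 = q := by
  obtain ⟨y, hy, rfl⟩ := hx
  have hmem : Set.MapsTo (AffineMap.lineMap (k := ℝ) y 0) (Set.Icc 0 1) (C ∩ Metric.ball 0 r) :=
    fun t ht => (h.convex.inter (convex_ball 0 r)).lineMap_mem hy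
      ⟨h.zero_mem, Metric.mem_ball_self h.radius_pos⟩ ht
  refine ⟨Ψ ∘ AffineMap.lineMap y 0, _, h.lipschitz.comp
    (lipschitzWith_lineMap y 0).lipschitzOnWith fun t ht => (hmem ht).2, h.mapsTo.comp hmem, ?_, ?_⟩
  · rw [Function.comp_apply, AffineMap.lineMap_apply_zero]
  · rw [Function.comp_apply, AffineMap.lineMap_apply_one, h.map_zero]

theorem IsEmbeddedHypersurface.exists_isPreconnected_dense (hM : IsEmbeddedHypersurface M)
    (hq : q ∈ M) {W : Set (Ambient n)} (hW : W ∈ 𝓝 q) :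
    ∃ D ⊆ hypInterior M ∩ W, IsPreconnected D ∧ ∀ᶠ x in 𝓝 q, x ∈ M → x ∈ closure D := by
  obtain ⟨Φ, C, C', h⟩ := hM.exists_isStraightening hq
  obtain ⟨Ψ, K, r, hΨ, hΨW⟩ := h.exists_isConvexChart hW
  refine ⟨Ψ '' (C' ∩ Metric.ball 0 r), ?_, ?_,
    hΨ.mem_image.mono fun x hx hxM => hΨ.subset_closure_image (hx hxM)⟩
  · exact Set.image_subset_iff.mpr fun y hy => ⟨hΨ.mapsTo_interior hy, hΨW hy.2⟩
  · exact (hΨ.convex'.inter (convex_ball 0 r)).isPreconnected.image _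
      (hΨ.lipschitz.continuousOn.mono Set.inter_subset_right)

theorem IsEmbeddedHypersurface.eventually_exists_lipschitz_path (hM : IsEmbeddedHypersurface M)
    (hq : q ∈ M) : ∀ᶠ x in 𝓝 q, x ∈ M →
      ∃ (c : ℝ → Ambient n) (K : NNReal), LipschitzOnWith K c (Set.Icc 0 1) ∧
        Set.MapsTo c (Set.Icc 0 1) M ∧ c 0 = x ∧ c 1 = q := by
  obtain ⟨Φ, C, C', h⟩ := hM.exists_isStraightening hq
  obtain ⟨Ψ, K, r, hΨ, -⟩ := h.exists_isConvexChart Filter.univ_mem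
  exact hΨ.mem_image.mono fun x hx hxM => hΨ.exists_lipschitz_path (hx hxM)

end LocalStructure

section GlobalCoincidence

variable {n : ℕ} {M M₁ M₂ : Set (Ambient n)} {p q x : Ambient n} {c : ℝ → Ambient n} {K : NNReal}

section Topology

variable {X : Type*} [TopologicalSpace X]

theorem subset_of_inter_closure_inter_subset {s O : Set X} (hs : IsPreconnected s)
    (hO : IsOpen O) (hne : (s ∩ O).Nonempty) (h : s ∩ closure (s ∩ O) ⊆ O) : s ⊆ O := by
  by_contra hcon
  obtain ⟨x, hx, hxO⟩ := Set.not_subset.mp hcon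
  have hcover : s ⊆ O ∪ (closure (s ∩ O))ᶜ := fun z hz => or_iff_not_imp_right.mpr fun hzc =>
    h ⟨hz, Set.notMem_compl_iff.mp hzc⟩
  obtain ⟨y, hy, hyO, hyc⟩ := hs O (closure (s ∩ O))ᶜ hO isClosed_closure.isOpen_compl hcover hne
    ⟨x, hx, fun hxc => hxO (h ⟨hx, hxc⟩)⟩
  exact hyc (subset_closure ⟨hy, hyO⟩)

theorem exists_first_exit {c : ℝ → X} {O : Set X} (hc : ContinuousOn c (Set.Icc 0 1))
    (hO : IsOpen O) (h0 : c 0 ∈ O) (h1 : c 1 ∉ O) :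
    ∃ t ∈ Set.Ioc (0 : ℝ) 1, c t ∉ O ∧ Set.MapsTo c (Set.Ico 0 t) O := by
  have hcompact : IsCompact (Set.Icc (0 : ℝ) 1 ∩ c ⁻¹' Oᶜ) :=
    isCompact_Icc.of_isClosed_subset (hc.preimage_isClosed_of_isClosed isClosed_Icc
      hO.isClosed_compl) Set.inter_subset_left
  obtain ⟨t, ⟨ht, htO⟩, hmin⟩ := hcompact.exists_isLeast ⟨1, Set.right_mem_Icc.mpr zero_le_one, h1⟩
  have ht0 : 0 ≠ t := by
    rintro rfl
    exact htO h0
  refine ⟨t, ⟨ht.1.lt_of_ne ht0, ht.2⟩, htO, fun s hs => ?_⟩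
  by_contra hsO
  exact (hmin ⟨⟨hs.1, hs.2.le.trans ht.2⟩, hsO⟩).not_gt hs.2

end Topology

/-- The points near which `M₁` and `M₂` coincide. -/
def coincidenceSet (M₁ M₂ : Set (Ambient n)) : Set (Ambient n) :=
  {x | ∀ᶠ y in 𝓝 x, y ∈ M₁ ↔ y ∈ M₂}

theorem isOpen_coincidenceSet (M₁ M₂ : Set (Ambient n)) : IsOpen (coincidenceSet M₁ M₂) :=
  isOpen_setOfPred_eventually_nhds

theorem coincidenceSet_comm (M₁ M₂ : Set (Ambient n)) :
    coincidenceSet M₁ M₂ = coincidenceSet M₂ M₁ :=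
  Set.ext fun _ => Filter.eventually_congr (Filter.Eventually.of_forall fun _ => iff_comm)

theorem mem_iff_of_mem_coincidenceSet (h : x ∈ coincidenceSet M₁ M₂) : x ∈ M₁ ↔ x ∈ M₂ :=
  Filter.Eventually.self_of_nhds (p := fun y => y ∈ M₁ ↔ y ∈ M₂) h

theorem inter_coincidenceSet (M₁ M₂ : Set (Ambient n)) :
    M₁ ∩ coincidenceSet M₁ M₂ = M₂ ∩ coincidenceSet M₁ M₂ :=
  Set.ext fun _ => and_congr_left mem_iff_of_mem_coincidenceSet

theorem eventually_mem_of_mem_closure_coincidenceSet (hM₁ : IsEmbeddedHypersurface M₁)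
    (hM₂ : IsEmbeddedHypersurface M₂)
    (hint : hypInterior M₁ ∩ hypInterior M₂ ⊆ coincidenceSet M₁ M₂)
    (hcompat : Disjoint (hypBoundary M₂) (hypInterior M₁)) (hq₁ : q ∈ M₁) (hq₂ : q ∈ M₂)
    (hq : q ∈ closure (M₁ ∩ coincidenceSet M₁ M₂)) : ∀ᶠ x in 𝓝 q, x ∈ M₁ → x ∈ M₂ := by
  have hW := hM₂.eventually_mem_of_mem_closure hq₂
  obtain ⟨D, hD, hDc, hdense⟩ := hM₁.exists_isPreconnected_dense hq₁ hW
  have hDM₂ : D ∩ coincidenceSet M₁ M₂ ⊆ M₂ := fun x hx =>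
    (mem_iff_of_mem_coincidenceSet hx.2).mp (IsInteriorPoint.mem (hD hx.1).1)
  have hne : (D ∩ coincidenceSet M₁ M₂).Nonempty := by
    obtain ⟨s, ⟨hsM, hsO⟩, hs⟩ :=
      ((mem_closure_iff_frequently.mp hq).and_eventually hdense).exists
    rw [Set.inter_comm]
    exact mem_closure_iff.mp (hs hsM) _ (isOpen_coincidenceSet M₁ M₂) hsO
  have hsub : D ⊆ coincidenceSet M₁ M₂ := by
    refine subset_of_inter_closure_inter_subset hDc (isOpen_coincidenceSet M₁ M₂) hne ?_
    rintro y ⟨hyD, hyc⟩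
    have hy₂ : y ∈ M₂ := (hD hyD).2 (closure_mono hDM₂ hyc)
    exact hint ⟨(hD hyD).1, (hM₂ y hy₂).resolve_right fun hb =>
      Set.disjoint_left.mp hcompat hb (hD hyD).1⟩
  filter_upwards [hdense, hW] with x hx hxW hxM
  exact hxW (closure_mono (fun z hz => hDM₂ ⟨hz, hsub hz⟩) (hx hxM))

theorem mem_coincidenceSet_of_mem_closure (hM₁ : IsEmbeddedHypersurface M₁)
    (hM₂ : IsEmbeddedHypersurface M₂)
    (hint : hypInterior M₁ ∩ hypInterior M₂ ⊆ coincidenceSet M₁ M₂)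
    (hcompat : BoundariesCompatible M₁ M₂) (hq₁ : q ∈ M₁) (hq₂ : q ∈ M₂)
    (hq : q ∈ closure (M₁ ∩ coincidenceSet M₁ M₂)) : q ∈ coincidenceSet M₁ M₂ := by
  have hle := eventually_mem_of_mem_closure_coincidenceSet hM₁ hM₂ hint hcompat.2 hq₁ hq₂ hq
  have hge := eventually_mem_of_mem_closure_coincidenceSet hM₂ hM₁
    (by rwa [Set.inter_comm, coincidenceSet_comm]) hcompat.1 hq₂ hq₁
    (by rwa [coincidenceSet_comm, ← inter_coincidenceSet])
  filter_upwards [hle, hge] with y hy₁ hy₂ using ⟨hy₁, hy₂⟩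

theorem IsCompleteHyp.mem_of_lipschitzOnWith (hM : IsCompleteHyp M) {t : ℝ} (ht : 0 < t)
    (hc : LipschitzOnWith K c (Set.Icc 0 t)) (hcM : Set.MapsTo c (Set.Ico 0 t) M) : c t ∈ M := by
  have hscale : Set.MapsTo (t * ·) (Set.Ico 0 1) (Set.Ico 0 t) := fun s hs =>
    ⟨mul_nonneg ht.le hs.1, mul_lt_of_lt_one_right ht hs.2⟩
  have hscale' := hscale.mono_right Set.Ico_subset_Icc_self
  have hmul : LipschitzWith ‖t‖₊ (t * ·) := lipschitzWith_smul t
  obtain ⟨q, hq, hlim⟩ := hM _ _ (hc.comp hmul.lipschitzOnWith hscale') (hcM.comp hscale)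
  have hmul1 : Filter.Tendsto (t * ·) (𝓝[<] 1) (𝓝 t) := by
    simpa only [mul_one] using (hmul.continuous.tendsto 1).mono_left nhdsWithin_le_nhds
  have hlim' : Filter.Tendsto (c ∘ (t * ·)) (𝓝[<] 1) (𝓝 (c t)) :=
    (hc.continuousOn t (Set.right_mem_Icc.mpr ht.le)).tendsto.comp
      (tendsto_nhdsWithin_iff.mpr ⟨hmul1, Filter.mem_of_superset (Ico_mem_nhdsLT one_pos) hscale'⟩)
  exact tendsto_nhds_unique hlim hlim' ▸ hq

theorem mem_coincidenceSet_of_path (hM₂ : IsCompleteHyp M₂)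
    (hclosed : ∀ x ∈ M₁, x ∈ M₂ → x ∈ closure (M₁ ∩ coincidenceSet M₁ M₂) →
      x ∈ coincidenceSet M₁ M₂) (hc : LipschitzOnWith K c (Set.Icc 0 1))
    (hcM : Set.MapsTo c (Set.Icc 0 1) M₁) (h0 : c 0 ∈ coincidenceSet M₁ M₂) :
    c 1 ∈ coincidenceSet M₁ M₂ := by
  by_contra h1
  obtain ⟨t, ht, htO, hlt⟩ := exists_first_exit hc.continuousOn (isOpen_coincidenceSet M₁ M₂) h0 h1
  have hIcc : Set.Icc 0 t ⊆ Set.Icc 0 1 := Set.Icc_subset_Icc_right ht.2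
  have hcO : Set.MapsTo c (Set.Ico 0 t) (M₁ ∩ coincidenceSet M₁ M₂) := fun s hs =>
    ⟨hcM (hIcc (Set.Ico_subset_Icc_self hs)), hlt hs⟩
  have ht₂ : c t ∈ M₂ := hM₂.mem_of_lipschitzOnWith ht.1 (hc.mono hIcc) fun s hs =>
    (mem_iff_of_mem_coincidenceSet (hlt hs)).mp (hcO hs).1
  have htcl : t ∈ closure (Set.Ico 0 t) := by
    rw [closure_Ico ht.1.ne]
    exact Set.right_mem_Icc.mpr ht.1.le
  have hcont : ContinuousWithinAt c (Set.Ico 0 t) t :=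
    (hc.continuousOn t (Set.Ioc_subset_Icc_self ht)).mono (Set.Ico_subset_Icc_self.trans hIcc)
  exact htO (hclosed (c t) (hcM (Set.Ioc_subset_Icc_self ht)) ht₂ (hcont.mem_closure htcl hcO))

theorem subset_of_mem_coincidenceSet (hM₁ : IsEmbeddedHypersurface M₁)
    (hM₂ : IsEmbeddedHypersurface M₂) (hconn : IsPreconnected M₁) (hcomp : IsCompleteHyp M₂)
    (hint : hypInterior M₁ ∩ hypInterior M₂ ⊆ coincidenceSet M₁ M₂)
    (hcompat : BoundariesCompatible M₁ M₂) (hp₁ : p ∈ M₁) (hp : p ∈ coincidenceSet M₁ M₂) :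
    M₁ ⊆ M₂ := by
  have hsub : M₁ ⊆ coincidenceSet M₁ M₂ := by
    refine subset_of_inter_closure_inter_subset hconn (isOpen_coincidenceSet M₁ M₂)
      ⟨p, hp₁, hp⟩ ?_
    rintro q ⟨hq₁, hq⟩
    obtain ⟨s, ⟨hsM, hsO⟩, hs⟩ := ((mem_closure_iff_frequently.mp hq).and_eventually
      (hM₁.eventually_exists_lipschitz_path hq₁)).exists
    obtain ⟨c, K, hc, hcM, rfl, rfl⟩ := hs hsM
    exact mem_coincidenceSet_of_path hcomp
      (fun x => mem_coincidenceSet_of_mem_closure hM₁ hM₂ hint hcompat) hc hcM hsO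
  exact fun x hx => (mem_iff_of_mem_coincidenceSet (hsub hx)).mp hx

theorem eq_of_mem_coincidenceSet (hM₁ : IsEmbeddedHypersurface M₁)
    (hM₂ : IsEmbeddedHypersurface M₂) (hconn₁ : IsPreconnected M₁) (hconn₂ : IsPreconnected M₂)
    (hcomp₁ : IsCompleteHyp M₁) (hcomp₂ : IsCompleteHyp M₂)
    (hint : hypInterior M₁ ∩ hypInterior M₂ ⊆ coincidenceSet M₁ M₂)
    (hcompat : BoundariesCompatible M₁ M₂) (hp₁ : p ∈ M₁) (hp : p ∈ coincidenceSet M₁ M₂) :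
    M₁ = M₂ := by
  refine (subset_of_mem_coincidenceSet hM₁ hM₂ hconn₁ hcomp₂ hint hcompat hp₁ hp).antisymm
    (subset_of_mem_coincidenceSet hM₂ hM₁ hconn₂ hcomp₁ ?_ hcompat.symm
      ((mem_iff_of_mem_coincidenceSet hp).mp hp₁) (by rwa [coincidenceSet_comm]))
  rwa [Set.inter_comm, coincidenceSet_comm]

end GlobalCoincidence

theorem theorem1p2_general {n : ℕ} {Γ : Set (Fin n → ℝ)} {γ : (Fin n → ℝ) → ℝ}
    (hγ : IsEllipticSpeed Γ γ) {M₁ M₂ : Set (Ambient n)} {ν₁ ν₂ : Ambient n → Ambient n}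
    (h₁ : IsTranslator Γ γ M₁ ν₁) (h₂ : IsTranslator Γ γ M₂ ν₂)
    (hconv₁ : IsStrictlyConvexHyp M₁ ν₁) (hconv₂ : IsConvexHyp M₂ ν₂)
    (hside : LiesAtOneSide M₁ M₂) :
    (∀ p ∈ hypInterior M₁ ∩ hypInterior M₂,
      (∀ᶠ x in 𝓝 p, x ∈ M₁ ↔ x ∈ M₂) ∧
      (IsCompleteHyp M₁ → IsCompleteHyp M₂ → BoundariesCompatible M₁ M₂ → M₁ = M₂)) ∧
    (∀ (a : Ambient n) (b : ℝ), a ≠ 0 →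
      hypBoundary M₁ ⊆ affineHyperplane a b → hypBoundary M₂ ⊆ affineHyperplane a b →
      ∀ p ∈ hypBoundary M₁ ∩ hypBoundary M₂,
        (∃ w ∈ tangentSpaceAt M₁ p, inner ℝ a w ≠ 0) →
        (∀ᶠ x in 𝓝 p, x ∈ M₁ ∪ M₂ → b ≤ inner ℝ a x) →
        tangentSpaceAt M₁ p = tangentSpaceAt M₂ p →
          (∀ᶠ x in 𝓝 p, x ∈ M₁ ↔ x ∈ M₂) ∧
          (IsCompleteHyp M₁ → IsCompleteHyp M₂ → BoundariesCompatible M₁ M₂ → M₁ = M₂)) := by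
  have hint : hypInterior M₁ ∩ hypInterior M₂ ⊆ coincidenceSet M₁ M₂ := fun q hq =>
    eventually_mem_iff_of_mem_hypInterior hγ h₁ h₂ hconv₁ hconv₂ hside hq.1 hq.2
  have hglobal : ∀ p ∈ M₁, p ∈ coincidenceSet M₁ M₂ → IsCompleteHyp M₁ → IsCompleteHyp M₂ →
      BoundariesCompatible M₁ M₂ → M₁ = M₂ := fun p hp₁ hp hc₁ hc₂ hcompat =>
    eq_of_mem_coincidenceSet h₁.hypersurface h₂.hypersurface h₁.connected.isPreconnected
      h₂.connected.isPreconnected hc₁ hc₂ hint hcompat hp₁ hp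
  refine ⟨fun p hp => ⟨hint hp, hglobal p (IsInteriorPoint.mem hp.1) (hint hp)⟩, ?_⟩
  intro a b ha hbd₁ hbd₂ p hp htr hhalf hT
  have hpO : p ∈ coincidenceSet M₁ M₂ := eventually_mem_iff_of_mem_hypBoundary hγ h₁ h₂ hconv₁
    hconv₂ hside ha hbd₁ hbd₂ htr hp.1 hp.2 hhalf hT
  exact ⟨hpO, hglobal p (IsBoundaryPoint.mem hp.1) hpO⟩

theorem theorem1p2 {n : ℕ} (Γ : Set (Fin n → ℝ)) (γ : (Fin n → ℝ) → ℝ) (α : ℝ)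
    (hγ : IsSpeedFunction Γ γ α)
    (M₁ M₂ : Set (Ambient n)) (ν₁ ν₂ : Ambient n → Ambient n)
    (h₁ : IsTranslator Γ γ M₁ ν₁) (h₂ : IsTranslator Γ γ M₂ ν₂)
    (hconv₁ : IsStrictlyConvexHyp M₁ ν₁) (hconv₂ : IsConvexHyp M₂ ν₂)
    (hside : LiesAtOneSide M₁ M₂) :
    -- interior tangency principle: the hypersurfaces coincide near `p`, and they are equal
    -- if moreover both are complete and no boundary point of one is interior to the other
    (∀ p ∈ hypInterior M₁ ∩ hypInterior M₂,
      tangentSpaceAt M₁ p = tangentSpaceAt M₂ p →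
        (∀ᶠ x in 𝓝 p, x ∈ M₁ ↔ x ∈ M₂) ∧
        (IsCompleteHyp M₁ → IsCompleteHyp M₂ → BoundariesCompatible M₁ M₂ → M₁ = M₂)) ∧
    -- boundary tangency principle
    (∀ (a : Ambient n) (b : ℝ), a ≠ 0 →
      hypBoundary M₁ ⊆ affineHyperplane a b → hypBoundary M₂ ⊆ affineHyperplane a b →
      IsTransversalTo M₁ a b → IsTransversalTo M₂ a b →
      ∀ p ∈ hypBoundary M₁ ∩ hypBoundary M₂,
        -- near `p` both hypersurfaces lie in the same closed half-space
        (∀ᶠ x in 𝓝 p, x ∈ M₁ ∪ M₂ → b ≤ inner ℝ a x) →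
        tangentSpaceAt M₁ p = tangentSpaceAt M₂ p →
        tangentSpaceAt (hypBoundary M₁) p = tangentSpaceAt (hypBoundary M₂) p →
          (∀ᶠ x in 𝓝 p, x ∈ M₁ ↔ x ∈ M₂) ∧
          (IsCompleteHyp M₁ → IsCompleteHyp M₂ → BoundariesCompatible M₁ M₂ → M₁ = M₂)) := by
  have h := theorem1p2_general hγ.isEllipticSpeed h₁ h₂ hconv₁ hconv₂ hside
  exact ⟨fun p hp _ => h.1 p hp, fun a b ha hbd₁ hbd₂ htr₁ _ p hp hhalf hT _ => h.2 a b ha hbd₁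
    hbd₂ p hp (htr₁ p ⟨IsBoundaryPoint.mem hp.1, hbd₁ hp.1⟩) hhalf hT⟩
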